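/- For a finite subgroup $G\leq \mathrm{GL}(n,\mathbb Z)$ let $M_G$ be the $G$-lattice with $\mathbb Z$-basis $u_1,\dots,u_n$ on which $G$ acts by $g(u_i)=\sum_{j} a_{i,j}u_j$ for $g=[a_{i,j}]\in G$. For $\sigma\in\mathrm{Aut}(G)$ let $M_{G^\sigma}$ be the same group with $g\in G$ acting through the matrix $g^\sigma$. Let $\mathrm{Inn}(G)\leq \mathrm{Aut}(G)$ be the group of inner automorphisms, and let $$\mathrm{Aut}_{\mathrm{GL}(n,\mathbb Z)}(G)=\{\sigma\in \mathrm{Aut}(G)\mid \exists x\in \mathrm{GL}(n,\mathbb Z)\ \forall g\in G:\ g^\sigma=xgx^{-1}\}.$$ Put $$c=\begin{pmatrix}0&1&0&0\\0&0&1&0\\0&0&0&1\\-1&-1&-1&-1\end{pmatrix},\quad f=\begin{pmatrix}0&1&0&0\\0&0&0&1\\1&0&0&0\\0&0&1&0\end{pmatrix},\quad t=\begin{pmatrix}0&1&0&0\\1&0&0&0\\0&0&1&0\\0&0&0&1\end{pmatrix},$$ $$\lambda_1=\begin{pmatrix}0&1&0&-1\\0&0&-1&1\\-1&0&0&1\\0&1&0&0\end{pmatrix},\quad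 \lambda_4=\begin{pmatrix}0&0&-1&0\\-1&0&0&0\\1&1&1&-2\\0&1&0&-1\end{pmatrix},$$ and define the following subgroups of $\mathrm{GL}(4,\mathbb Z)$, where $F_{20}$ is the Frobenius group of order $20$: $I_{4,1}=\langle c,f\rangle\simeq F_{20}$, $I_{4,2}=\langle c,-f\rangle\simeq F_{20}$, $I_{4,3}=\langle c,f,-1\rangle\simeq F_{20}\times C_2$, $I_{4,4}=\langle c,t\rangle\simeq S_5$, $I_{4,5}=\langle c,-t\rangle\simeq S_5$, $I_{4,6}=\langle c,t,-1\rangle\simeq S_5\times C_2$, $I_{4,7}=\langle\lambda_1,\lambda_4\rangle\simeq C_3\rtimes C_8$. **Theorem 1.31.** Let $k$ be a field and let $L/k$ be a finite Galois extension. For $1\leq i\leq 7$ let $T_i$ be an algebraic $k$-torus of dimension $4$ with minimal splitting field $L$ and character module $\widehat{T}_i\simeq M_G$, where $\mathrm{Gal}(L/k)$ is identified with $G$ and $G=G_i$ is $\mathrm{GL}(4,\mathbb Z)$-conjugate to $I_{4,i}$. For $\sigma\in\mathrm{Aut}(G)$ let $T_i^\sigma$ be the algebraic $k$-torus with $\widehat{T_i^\sigma}\simeq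 M_{G^\sigma}$, for the same $L$ and the same identification. (Each assertion concerns those $L/k$ for which the tori it names exist.) Then $T_i$ and $T_i^\sigma$ are not stably $k$-rational for any $i$ and $\sigma$, but: 1. $T_1\times_k T_2$ is stably $k$-rational. 2. For $i=3$, $\mathrm{Aut}(G)/\mathrm{Inn}(G)\simeq C_2$, and $T_3\times_k T_3^\sigma$ is stably $k$-rational for every $\sigma\in\mathrm{Aut}(G)\setminus\mathrm{Inn}(G)$. 3. $T_4\times_k T_5$ is stably $k$-rational. 4. For $i=6$, $\mathrm{Aut}(G)/\mathrm{Inn}(G)\simeq C_2$, and $T_6\times_k T_6^\sigma$ is stably $k$-rational for every $\sigma\in\mathrm{Aut}(G)\setminus\mathrm{Inn}(G)$. 5. For $i=7$, the subgroup $X=\mathrm{Aut}_{\mathrm{GL}(4,\mathbb Z)}(G)$ is isomorphic to the dihedral group $D_6$ of order $12$, $\mathrm{Aut}(G)/X\simeq C_2$, and $T_7\times_k T_7^\sigma$ is stably $k$-rational for every $\sigma\in\mathrm{Aut}(G)\setminus X$. -/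

import Mathlib

open scoped TensorProduct

universe u₁ u₂ u₃ u₄

/-! ### Algebraic tori through their coordinate Hopf algebras

An affine commutative group scheme `T = Spec A` over `k` is given by the commutative Hopf algebra
`A`.  The base change `T ×_k L` is `Spec (L ⊗[k] A)`, the product `T ×_k T'` is
`Spec (A ⊗[k] A')`, the split torus `(𝔾_m)ⁿ` over `L` is the spectrum of the group algebra
`L[ℤⁿ]`, and the characters of an affine group scheme are the group-like elements of its
coordinate ring. -/

section Tori

universe u v w

variable (k : Type u) [Field k] (L : Type v) [Field L] [Algebra k L]
  (A : Type w) [CommRing A] [HopfAlgebra k A]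

/-- `T = Spec A` becomes isomorphic over `L`, as a group scheme, to `(𝔾_m)ⁿ`.  For `L / k` finite
Galois this says that `T` is an algebraic `k`-torus of dimension `n` that splits over `L`. -/
def IsTorusSplitBy (n : ℕ) : Prop :=
  Nonempty ((L ⊗[k] A) ≃ₐc[L] AddMonoidAlgebra L (Fin n → ℤ))

/-- The action of a `k`-automorphism `s` of `L` on the coordinate ring `L ⊗[k] A` of `T ×_k L`,
through the first factor.  Restricted to group-like elements, it is the Galois action on the
character module of `T`. -/
noncomputable def galoisConj (s : L ≃ₐ[k] L) : (L ⊗[k] A) →ₐ[k] (L ⊗[k] A) :=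
  Algebra.TensorProduct.map (s : L →ₐ[k] L) (AlgHom.id k A)

/-- `T = Spec A` is an algebraic `k`-torus of dimension `n` with minimal splitting field `L` and
character module `T̂ ≃ M_G`, where `G ≤ GL(n, ℤ)` and `Gal(L/k)` is identified with `G` through
`φ`: there is a `ℤ`-basis `u_1, …, u_n` of the (multiplicatively written) character group such that
`s (u_i) = ∑ j, a_{i,j} u_j` for every `s ∈ Gal(L/k)`, where `φ s = [a_{i,j}]`.

With this row convention composition of automorphisms corresponds to the opposite multiplication
of matrices, so that `φ` takes values in `Gᵐᵒᵖ`.  As `φ` is an isomorphism, `Gal(L/k)` acts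
faithfully on `T̂`, which says that `L` is the minimal splitting field. -/
structure HasCharacterModule {n : ℕ} (G : Subgroup (GL (Fin n) ℤ))
    (φ : (L ≃ₐ[k] L) ≃* (G)ᵐᵒᵖ) : Prop where
  split : IsTorusSplitBy k L A n
  basis : ∃ u : Multiplicative (Fin n → ℤ) ≃* GroupLike L (L ⊗[k] A),
    ∀ (s : L ≃ₐ[k] L) (i : Fin n),
      galoisConj k L A s (u (Multiplicative.ofAdd (Pi.single i 1))).val =
        (u (Multiplicative.ofAdd
          (fun j => (((φ s).unop : GL (Fin n) ℤ) : Matrix (Fin n) (Fin n) ℤ) i j))).val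

/-- An extension `K` of `k` is stably `k`-rational: for some `m` and `n`, the rational function
field `K(y_1, …, y_m)` is isomorphic over `k` to `k(x_1, …, x_n)`. -/
def IsStablyRationalField (K : Type w) [CommRing K] [Algebra k K] : Prop :=
  ∃ m n : ℕ, Nonempty
    (FractionRing (MvPolynomial (Fin m) K) ≃ₐ[k] FractionRing (MvPolynomial (Fin n) k))

/-- The integral affine `k`-scheme `Spec A` (such as a torus or a product of tori) is stably
`k`-rational: its function field, the fraction field of `A`, is so. -/
def IsStablyRational (A : Type w) [CommRing A] [Algebra k A] : Prop :=
  IsStablyRationalField k (FractionRing A)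

end Tori

/-! ### Finite subgroups of `GL(n, ℤ)` -/

/-- The subgroups `G` and `H` of `GL(n, ℤ)` are `GL(n, ℤ)`-conjugate. -/
def IsConjSubgroup {n : ℕ} (G H : Subgroup (GL (Fin n) ℤ)) : Prop :=
  ∃ x : GL (Fin n) ℤ, G = H.map (MulAut.conj x).toMonoidHom

/-- The subgroup `Inn(G)` of `Aut(G)`. -/
def innerAut (G : Type*) [Group G] : Subgroup (MulAut G) :=
  (MulAut.conj : G →* MulAut G).range

/-- The subgroup `Aut_{GL(n, ℤ)}(G)` of `Aut(G)`, consisting of the `σ` for which `G` and `G^σ`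
are conjugate in `GL(n, ℤ)`: some `x` satisfies `σ g = x g x⁻¹` for all `g ∈ G`. -/
def autGL {n : ℕ} (G : Subgroup (GL (Fin n) ℤ)) : Subgroup (MulAut G) where
  carrier := {σ | ∃ x : GL (Fin n) ℤ, ∀ g : G, ((σ g : G) : GL (Fin n) ℤ) = x * g * x⁻¹}
  one_mem' := ⟨1, by simp⟩
  mul_mem' := by
    rintro σ τ ⟨x, hx⟩ ⟨y, hy⟩
    refine ⟨x * y, fun g => ?_⟩
    rw [MulAut.mul_apply, hx, hy]
    group
  inv_mem' := by
    rintro σ ⟨x, hx⟩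
    refine ⟨x⁻¹, fun g => ?_⟩
    have h := hx (σ⁻¹ g)
    rw [MulAut.apply_inv_self] at h
    rw [h]
    group

/-- The identification `Gal(L/k) ≃ Gᵐᵒᵖ` that gives the lattice `M_{G^σ}`: the Galois element that
acts through `g` on `M_G` acts through `g^σ` on `M_{G^σ}`. -/
def twist {Γ : Type*} [Group Γ] {n : ℕ} {G : Subgroup (GL (Fin n) ℤ)} (φ : Γ ≃* (G)ᵐᵒᵖ)
    (σ : MulAut G) : Γ ≃* (G)ᵐᵒᵖ :=
  φ.trans (MulEquiv.op (σ : G ≃* G))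

namespace I4

/-- On the lattice `ℤ⁵ / ℤ(1,1,1,1,1)` with basis the classes `e_1, …, e_4` (and
`e_0 = -(e_1 + e_2 + e_3 + e_4)`), the permutation `e_i ↦ e_{i+1}` of order 5. -/
def c : GL (Fin 4) ℤ where
  val := !![0, 1, 0, 0; 0, 0, 1, 0; 0, 0, 0, 1; -1, -1, -1, -1]
  inv := !![-1, -1, -1, -1; 1, 0, 0, 0; 0, 1, 0, 0; 0, 0, 1, 0]
  val_inv := by decide
  inv_val := by decide

/-- On the same lattice, the permutation `e_i ↦ e_{2i}` of order 4, indices modulo 5. -/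
def f : GL (Fin 4) ℤ where
  val := !![0, 1, 0, 0; 0, 0, 0, 1; 1, 0, 0, 0; 0, 0, 1, 0]
  inv := !![0, 0, 1, 0; 1, 0, 0, 0; 0, 0, 0, 1; 0, 1, 0, 0]
  val_inv := by decide
  inv_val := by decide

/-- On the same lattice, the transposition of `e_1` and `e_2`. -/
def t : GL (Fin 4) ℤ where
  val := !![0, 1, 0, 0; 1, 0, 0, 0; 0, 0, 1, 0; 0, 0, 0, 1]
  inv := !![0, 1, 0, 0; 1, 0, 0, 0; 0, 0, 1, 0; 0, 0, 0, 1]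
  val_inv := by decide
  inv_val := by decide

/-- The generator `λ_1` (of order 12) of `I_{4,7}`. -/
def l1 : GL (Fin 4) ℤ where
  val := !![0, 1, 0, -1; 0, 0, -1, 1; -1, 0, 0, 1; 0, 1, 0, 0]
  inv := !![-1, 0, -1, 1; 0, 0, 0, 1; -1, -1, 0, 1; -1, 0, 0, 1]
  val_inv := by decide
  inv_val := by decide

/-- The generator `λ_4` (of order 8) of `I_{4,7}`. -/
def l4 : GL (Fin 4) ℤ where
  val := !![0, 0, -1, 0; -1, 0, 0, 0; 1, 1, 1, -2; 0, 1, 0, -1]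
  inv := !![0, -1, 0, 0; -1, -1, -1, 2; -1, 0, 0, 0; -1, -1, -1, 1]
  val_inv := by decide
  inv_val := by decide

/-- `I_{4,1} ≃ F₂₀` -/
def G1 : Subgroup (GL (Fin 4) ℤ) := Subgroup.closure {c, f}
/-- `I_{4,2} ≃ F₂₀` -/
def G2 : Subgroup (GL (Fin 4) ℤ) := Subgroup.closure {c, -f}
/-- `I_{4,3} ≃ F₂₀ × C₂` -/
def G3 : Subgroup (GL (Fin 4) ℤ) := Subgroup.closure {c, f, -1}
/-- `I_{4,4} ≃ S₅` -/
def G4 : Subgroup (GL (Fin 4) ℤ) := Subgroup.closure {c, t}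
/-- `I_{4,5} ≃ S₅` -/
def G5 : Subgroup (GL (Fin 4) ℤ) := Subgroup.closure {c, -t}
/-- `I_{4,6} ≃ S₅ × C₂` -/
def G6 : Subgroup (GL (Fin 4) ℤ) := Subgroup.closure {c, t, -1}
/-- `I_{4,7} ≃ C₃ ⋊ C₈` -/
def G7 : Subgroup (GL (Fin 4) ℤ) := Subgroup.closure {l1, l4}

/-- The seven groups `I_{4,1}, …, I_{4,7}`, listed in this order. -/
def all : List (Subgroup (GL (Fin 4) ℤ)) := [G1, G2, G3, G4, G5, G6, G7]

end I4

/-! Everything rests on one criterion: a torus split by `L` is stably rational exactly when its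
character lattice `M` fits into a Galois-equivariant exact sequence `0 → M → P → Q → 0` with
permutation lattices `P` and `Q` of finite rank.

Sufficiency is the no-name lemma. Monomials that lift a permutation basis of `Q` span a semilinear
representation over `L(M)`. By Galois descent this span has a basis of invariants, so `L(P)^Gal` is
purely transcendental over `L(M)^Gal`, the function field of the torus. With the zero lattice in
place of `M`, the same lemma makes `L(P)^Gal` purely transcendental over `k`. See
`exists_mvPolynomial_ringHom_fixed_of_isSplitWith` and `isStablyRational_of_isSplitWith`.

For the products, such a sequence is written down for `M ⊕ M'`, where `M'` is the twist of `M` by a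
quadratic character. One matrix between permutation lattices of ranks 88 and 80 serves `S₅ × C₂`
and, by restriction, all of the first six groups. For `G = C₃ ⋊ C₈` the map `ℤ[G] ⊕ ℤ[G/C₆] →
ℤ[G/C₃] ⊕ ℤ[G/C₂]`, with ranks 28 and 20, is enough. `isStablyRational_tensor_of_lists` reduces the
verification to finitely many equations on generators and orbit representatives. Automorphism groups
then bring arbitrary tori to this form. Automorphisms of `S₅` and `F₂₀` are inner; those of their
products with `C₂` are inner up to the sign twist. An automorphism of `C₃ ⋊ C₈` is, up to the twist
`λ₄ ↦ λ₄⁵ = -λ₄`, conjugation by an integral matrix.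

For necessity, let the torus be `Spec C`. If it is stably rational, then polynomial rings over `k`
and over `C` have a common localization `D`. Over `L` both become factorial, with unit groups `Lˣ`
and `Lˣ × M`. The quotients of `(L ⊗ D)ˣ` by these unit groups are permutation lattices on the prime
divisors that were removed, and the kernel of the map between the quotients is `M`; see
`hasPermutationResolution_of_models`.

The obstruction is a trace in Tate cohomology. Let `c` have prime order `p` and no nonzero
invariants in `M`, and let `f` normalize `⟨c⟩`. If `X` and `Y` are the permutation bases, the
sequence gives `0 → 𝔽_p^(X^c) → 𝔽_p^(Y^c) → M/(c-1)M → 0`, which respects `f` up to the factor `a`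
by which conjugation raises `c`. The traces of `f` on the first two terms count fixed points and
agree for `f` and `f⁻¹`. Hence `a tr(f) = b tr(f⁻¹)` on `M/(c-1)M`, with `b` the factor for `f⁻¹`.
On five letters the quotient is `𝔽₅`, `f` acts by a sign and the factors are 3 and 2. For `C₃ ⋊ C₈`
the quotient is `𝔽₃²`, both factors are 2, and `λ₄` and its inverse have traces 1 and 2. Both
relations fail. -/

/-! ### Semilinear descent -/

section NoName

open MvPolynomial

variable {G E : Type*} [Group G] [Finite G] [Field E] [MulSemiringAction G E]

/-- Galois descent for vector spaces: a `G`-stable subspace is spanned by its invariants. -/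
theorem Submodule.span_fixed_of_faithful (F : Subfield E) (hF : ∀ (g : G), ∀ a ∈ F, g • a ∈ F)
    (hfaith : ∀ g : G, (∀ a ∈ F, g • a = a) → g = 1) (V : Submodule F E)
    (hV : ∀ (g : G), ∀ v ∈ V, g • v ∈ V) :
    Submodule.span F {v | v ∈ V ∧ ∀ g : G, g • v = v} = V := by
  have := Fintype.ofFinite G
  refine le_antisymm (Submodule.span_le.2 fun v hv => hv.1) fun v hv => ?_
  by_contra hcon
  obtain ⟨l, hl, hker⟩ := Submodule.exists_le_ker_of_notMem hcon
  have hinj : Function.Injective (fun (g : G) => (⟨⟨fun a : F => (g • (a : E) : E),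
      by simp⟩, fun a b => by simp [smul_mul']⟩ : F →* E)) := by
    intro g h hgh
    have := hfaith (h⁻¹ * g) fun a ha => by
      have h1 := DFunLike.congr_fun hgh (⟨a, ha⟩ : F)
      simp only [MonoidHom.coe_mk, OneHom.coe_mk] at h1
      rw [mul_smul, h1, inv_smul_smul]
    rw [inv_mul_eq_one] at this
    exact this.symm
  have hli := (linearIndependent_monoidHom F E).comp _ hinj
  rw [Fintype.linearIndependent_iff] at hli
  refine hl ?_
  -- The sum of `g • (a v)` over `g` is invariant, so `l` kills it for every `a`. This is a linear
  -- relation between the characters `a ↦ g • a` with coefficients `l (g • v)`. Independence of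
  -- characters makes the coefficient at `g = 1` vanish.
  have key := hli (fun g => ((l (g • v) : F) : E)) (by
    funext a
    have hmem : (∑ g : G, g • ((a : E) * v)) ∈ {v | v ∈ V ∧ ∀ g : G, g • v = v} := by
      refine ⟨V.sum_mem fun g _ => hV g _ (V.smul_mem a hv), fun g => ?_⟩
      rw [Finset.smul_sum]
      simp only [smul_smul]
      exact Fintype.sum_equiv (Equiv.mulLeft g) _ _ fun _ => rfl
    have h0 := hker (Submodule.subset_span hmem)
    rw [LinearMap.mem_ker, map_sum] at h0
    have h1 : ∀ g : G, l (g • ((a : E) * v)) = (⟨g • (a : E), hF g _ a.2⟩ : F) * l (g • v) := by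
      intro g
      refine Eq.trans ?_ (l.map_smul (⟨g • (a : E), hF g _ a.2⟩ : F) (g • v))
      rw [smul_mul']
      rfl
    simp only [h1] at h0
    have h2 := congrArg (fun t : F => (t : E)) h0
    simp only [AddSubmonoidClass.coe_finsetSum, MulMemClass.coe_mul, ZeroMemClass.coe_zero] at h2
    simp only [Finset.sum_apply, Pi.smul_apply, Pi.zero_apply, Function.comp_apply,
      MonoidHom.coe_mk, OneHom.coe_mk, smul_eq_mul]
    rw [← h2]
    exact Finset.sum_congr rfl fun g _ => mul_comm _ _) 1
  rw [one_smul] at key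
  exact_mod_cast key

/-- The no-name lemma: if `E = F(x_1, …, x_q)` with `x` algebraically independent over the
`G`-stable subfield `F` on which `G` acts faithfully, and `G` acts semilinearly on the span of the
`x_i`, then `E^G` is a rational function field in `q` variables over `F^G`. -/
theorem exists_mvPolynomial_ringHom_fixed {K₀ : Type*} [Field K₀] (F : Subfield E)
    (hF : ∀ (g : G), ∀ a ∈ F, g • a ∈ F)
    (hfaith : ∀ g : G, (∀ a ∈ F, g • a = a) → g = 1)
    (j : K₀ →+* E) (hj : ∀ a, a ∈ Set.range j ↔ a ∈ F ∧ ∀ g : G, g • a = a)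
    {q : ℕ} (x : Fin q → E) (hx : AlgebraicIndependent F x)
    (hE : ∀ e : E, ∃ a b : MvPolynomial (Fin q) F, aeval x b ≠ 0 ∧ e * aeval x b = aeval x a)
    (hspan : ∀ (g : G) (i : Fin q), g • x i ∈ Submodule.span F (Set.range x)) :
    ∃ Φ : FractionRing (MvPolynomial (Fin q) K₀) →+* E,
      (∀ a, Φ (algebraMap (MvPolynomial (Fin q) K₀) _ (C a)) = j a) ∧ Set.range Φ = {e | ∀ g : G, g • e = e} := by
  have := Fintype.ofFinite G
  set V := Submodule.span F (Set.range x) with hVdef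
  have hV : ∀ (g : G), ∀ v ∈ V, g • v ∈ V := by
    intro g v hv
    induction hv using Submodule.span_induction with
    | mem v hv => obtain ⟨i, rfl⟩ := hv; exact hspan g i
    | zero => simp
    | add v w _ _ h1 h2 => rw [smul_add]; exact V.add_mem h1 h2
    | smul a v _ h =>
      have : g • (a • v) = (⟨g • (a : E), hF g _ a.2⟩ : F) • (g • v) := smul_mul' g (a : E) v
      rw [this]; exact V.smul_mem _ h
  have hdesc := Submodule.span_fixed_of_faithful F hF hfaith V hV
  obtain ⟨b, hbsub, hbspan, hbli⟩ :=
    exists_linearIndependent F {v | v ∈ V ∧ ∀ g : G, g • v = v}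
  rw [hdesc] at hbspan
  have hcard : Nonempty (Fin q ≃ b) := by
    let b1 := Module.Basis.span hx.linearIndependent
    let b2 := Module.Basis.span hbli
    have e : Submodule.span F (Set.range x) = Submodule.span F (Set.range (Subtype.val : b → E)) := by
      rw [Subtype.range_coe, hbspan]
    exact ⟨(b1.map (LinearEquiv.ofEq _ _ e)).indexEquiv b2⟩
  obtain ⟨e⟩ := hcard
  let z : Fin q → E := fun i => (e i : E)
  have hzfix : ∀ i (g : G), g • z i = z i := fun i g => (hbsub (e i).2).2 g
  have hzrange : Set.range z = b := by
    ext v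
    constructor
    · rintro ⟨i, rfl⟩; exact (e i).2
    · intro hv; exact ⟨e.symm ⟨v, hv⟩, by simp [z]⟩
  have hadj : Algebra.adjoin F (Set.range x) = Algebra.adjoin F (Set.range z) := by
    refine le_antisymm (Algebra.adjoin_le ?_) (Algebra.adjoin_le ?_)
    · rintro _ ⟨i, rfl⟩
      have : x i ∈ Submodule.span F (Set.range z) := by
        rw [hzrange, hbspan]; exact Submodule.subset_span ⟨i, rfl⟩
      exact Algebra.span_le_adjoin _ _ this
    · rintro _ ⟨i, rfl⟩
      exact Algebra.span_le_adjoin _ _ (hbsub (e i).2).1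
  have hrx : ∀ p : MvPolynomial (Fin q) F, aeval x p ∈ Algebra.adjoin F (Set.range x) := by
    intro p; rw [Algebra.adjoin_range_eq_range_aeval]; exact ⟨p, rfl⟩
  have hfrac : ∀ u : E, ∃ s t : E, s ∈ Algebra.adjoin F (Set.range z) ∧
      t ∈ Algebra.adjoin F (Set.range z) ∧ t ≠ 0 ∧ u * t = s := by
    intro u
    obtain ⟨s, t, ht, h⟩ := hE u
    exact ⟨_, _, hadj ▸ hrx s, hadj ▸ hrx t, ht, h⟩
  have halg : Algebra.IsAlgebraic (Algebra.adjoin F (Set.range z)) E := by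
    refine ⟨fun u => ?_⟩
    obtain ⟨s, t, hs, ht, ht0, h⟩ := hfrac u
    refine ⟨Polynomial.C ⟨t, ht⟩ * Polynomial.X - Polynomial.C ⟨s, hs⟩, ?_, ?_⟩
    · intro h0
      have := congrArg (fun p => Polynomial.coeff p 1) h0
      simp [Polynomial.coeff_C] at this
      exact ht0 (congrArg Subtype.val this)
    · simp only [map_sub, map_mul, Polynomial.aeval_C, Polynomial.aeval_X]
      change t * u - s = 0
      rw [mul_comm, h, sub_self]
  have halgx : IsTranscendenceBasis F x := by
    rw [hx.isTranscendenceBasis_iff_isAlgebraic, hadj]; exact halg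
  -- `E` is algebraic over the field generated by the `z i`, and their number is the transcendence
  -- degree, so no relation is possible.
  have hz : AlgebraicIndependent F z :=
    (Algebra.IsAlgebraic.isTranscendenceBasis_of_lift_le_trdeg_of_finite F z
      halgx.lift_cardinalMk_eq_trdeg.le).1
  -- the action on polynomials in `z`
  let gF : G → F →+* F := fun g =>
    { toFun := fun a => ⟨g • (a : E), hF g _ a.2⟩
      map_one' := by ext; simp
      map_mul' := fun a b => by ext; simp [smul_mul']
      map_zero' := by ext; simp
      map_add' := fun a b => by ext; simp [smul_add] }
  have hact : ∀ (g : G) (p : MvPolynomial (Fin q) F), g • aeval z p = aeval z (map (gF g) p) := by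
    intro g p
    induction p using MvPolynomial.induction_on with
    | C a => simp only [map_C, algHom_C]; rfl
    | add p r h1 h2 => simp only [map_add, smul_add, h1, h2]
    | mul_X p i h => simp only [map_mul, smul_mul', h, map_X, aeval_X, hzfix]
  have hfixpoly : ∀ p : MvPolynomial (Fin q) F, (∀ g : G, g • aeval z p = aeval z p) →
      ∃ r : MvPolynomial (Fin q) K₀, eval₂ j z r = aeval z p := by
    intro p hp
    have hcoef : ∀ m, ∃ a : K₀, j a = ((p.coeff m : F) : E) := by
      intro m
      refine (hj _).2 ⟨(p.coeff m).2, fun g => ?_⟩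
      have h1 := hz ((hact g p).symm.trans (hp g))
      have h2 := congrArg (fun r : MvPolynomial (Fin q) F => ((coeff m r : F) : E)) h1
      simpa [coeff_map, gF] using h2
    choose a ha using hcoef
    refine ⟨∑ m ∈ p.support, monomial m (a m), ?_⟩
    rw [eval₂_sum, aeval_def, eval₂_eq']
    refine Finset.sum_congr rfl fun m _ => ?_
    rw [eval₂_monomial, ha, Finsupp.prod_fintype _ _ (fun i => pow_zero _)]
    rfl
  have hjF : ∀ a : K₀, j a ∈ F := fun a => ((hj _).1 ⟨a, rfl⟩).1
  let jF : K₀ →+* F := j.codRestrict F hjF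
  have hinj : Function.Injective (eval₂Hom j z) := by
    have h1 : ∀ p, eval₂Hom j z p = aeval z (map jF p) := by
      intro p
      rw [aeval_def, eval₂_map]; rfl
    intro p r hpr
    rw [h1, h1] at hpr
    exact map_injective _ jF.injective (hz hpr)
  refine ⟨IsFractionRing.lift hinj, fun a => ?_, ?_⟩
  · rw [IsFractionRing.lift_algebraMap]; simp
  · have hfixr : ∀ (g : G) (r : MvPolynomial (Fin q) K₀), g • eval₂Hom j z r = eval₂Hom j z r := by
      intro g r
      induction r using MvPolynomial.induction_on with
      | C a => simpa using ((hj _).1 ⟨a, rfl⟩).2 g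
      | add p r h1 h2 => simp only [map_add, smul_add, h1, h2]
      | mul_X p i h => rw [map_mul, smul_mul', h]; simp [hzfix]
    ext u
    constructor
    · rintro ⟨w, rfl⟩ g
      obtain ⟨s, t, ht, rfl⟩ := IsFractionRing.div_surjective (A := MvPolynomial (Fin q) K₀) w
      rw [map_div₀, IsFractionRing.lift_algebraMap, IsFractionRing.lift_algebraMap, smul_div₀',
        hfixr, hfixr]
    · intro hu
      obtain ⟨s, t, hs, ht, ht0, h⟩ := hfrac u
      rw [Algebra.adjoin_range_eq_range_aeval] at ht hs
      obtain ⟨s, rfl⟩ := hs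
      obtain ⟨t, rfl⟩ := ht
      change aeval z t ≠ 0 at ht0
      change u * aeval z t = aeval z s at h
      -- The norm of the denominator is an invariant denominator. As `u` is invariant, the new
      -- numerator is invariant too.
      let N : MvPolynomial (Fin q) F := ∏ g : G, map (gF g) t
      have hN : aeval z N = ∏ g : G, g • aeval z t := by simp only [N, map_prod, hact]
      have hNfix : ∀ g : G, g • aeval z N = aeval z N := by
        intro g
        rw [hN, Finset.smul_prod']
        simp only [smul_smul]
        exact Fintype.prod_equiv (Equiv.mulLeft g) _ _ fun _ => rfl
      have hN0 : aeval z N ≠ 0 := by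
        rw [hN, Finset.prod_ne_zero_iff]
        intro g _ h0
        exact ht0 ((smul_eq_zero_iff_eq g).1 h0)
      have hone : map (gF 1) t = t := by
        have : gF 1 = RingHom.id F := by ext a; simp [gF]
        rw [this, map_id]
      obtain ⟨w, hw⟩ : ∃ w : MvPolynomial (Fin q) F, u * aeval z N = aeval z w := by
        classical
        refine ⟨s * ∏ g ∈ Finset.univ.erase (1 : G), map (gF g) t, ?_⟩
        have : N = t * ∏ g ∈ Finset.univ.erase (1 : G), map (gF g) t := by
          have := Finset.mul_prod_erase Finset.univ (fun g => map (gF g) t) (Finset.mem_univ 1)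
          simp only [hone] at this
          exact this.symm
        rw [this, map_mul, map_mul, ← mul_assoc, h]
      obtain ⟨r1, hr1⟩ := hfixpoly N hNfix
      obtain ⟨r2, hr2⟩ := hfixpoly w fun g => by rw [← hw, smul_mul', hu g, hNfix]
      refine ⟨algebraMap _ _ r2 / algebraMap _ _ r1, ?_⟩
      rw [map_div₀, IsFractionRing.lift_algebraMap, IsFractionRing.lift_algebraMap]
      change eval₂ j z r2 / eval₂ j z r1 = u
      rw [hr1, hr2, ← hw, mul_div_cancel_right₀ _ hN0]

end NoName

/-! ### Group algebras of lattices with semilinear Galois action -/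

section SemilinearAction

variable {k L : Type*} [Field k] [Field L] [Algebra k L] {N : Type*} [AddCommGroup N]

/-- The semilinear ring endomorphism of `L[N]` induced by `s` on `L` and by an endomorphism of
`N`. -/
noncomputable def semilinearMap (s : L ≃ₐ[k] L) (e : AddMonoid.End N) :
    AddMonoidAlgebra L N →+* AddMonoidAlgebra L N :=
  (AddMonoidAlgebra.mapDomainRingHom L e).comp
    (AddMonoidAlgebra.mapRingHom N (s : L →+* L))

theorem semilinearMap_single (s : L ≃ₐ[k] L) (e : AddMonoid.End N) (n : N) (l : L) :
    semilinearMap s e (AddMonoidAlgebra.single n l) = AddMonoidAlgebra.single (e n) (s l) := by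
  simp only [semilinearMap, RingHom.comp_apply, AddMonoidAlgebra.mapRingHom_single]
  exact AddMonoidAlgebra.mapDomain_single

theorem AddMonoidAlgebra.addHom_ext_single {R M : Type*} [Semiring R] [AddCommMonoid M] {N : Type*}
    {f g : AddMonoidAlgebra R N →+ M} (h : ∀ n r, f (single n r) = g (single n r)) : f = g := by
  refine AddMonoidHom.ext fun x => ?_
  induction x using AddMonoidAlgebra.induction_linear with
  | zero => simp
  | add a b ha hb => rw [map_add, map_add, ha, hb]
  | single n r => exact h n r

theorem semilinearMap_mul (s t : L ≃ₐ[k] L) (e f : AddMonoid.End N) (x : AddMonoidAlgebra L N) :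
    semilinearMap (s * t) (e * f) x = semilinearMap s e (semilinearMap t f x) := by
  have : (semilinearMap (s * t) (e * f)).toAddMonoidHom =
      (semilinearMap s e).toAddMonoidHom.comp (semilinearMap t f).toAddMonoidHom :=
    AddMonoidAlgebra.addHom_ext_single fun n r => by
      change semilinearMap _ _ _ = semilinearMap _ _ (semilinearMap _ _ _)
      simp only [semilinearMap_single]; rfl
  exact DFunLike.congr_fun this x

theorem semilinearMap_one (x : AddMonoidAlgebra L N) :
    semilinearMap (1 : L ≃ₐ[k] L) (1 : AddMonoid.End N) x = x := by
  have : (semilinearMap (1 : L ≃ₐ[k] L) (1 : AddMonoid.End N)).toAddMonoidHom = AddMonoidHom.id _ :=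
    AddMonoidAlgebra.addHom_ext_single fun n r => by
      change semilinearMap _ _ _ = _
      simp only [semilinearMap_single]; rfl
  exact DFunLike.congr_fun this x

/-- The action of `Gal(L/k)` on `L[N]` for a lattice `N` with Galois action. -/
@[reducible]
noncomputable def galoisActionGroupAlgebra (a : (L ≃ₐ[k] L) →* AddMonoid.End N) :
    MulSemiringAction (L ≃ₐ[k] L) (AddMonoidAlgebra L N) where
  smul s x := semilinearMap s (a s) x
  one_smul x := by
    change semilinearMap 1 (a 1) x = x
    rw [map_one, semilinearMap_one]
  mul_smul s t x := by
    change semilinearMap (s * t) (a (s * t)) x = semilinearMap s (a s) (semilinearMap t (a t) x)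
    rw [map_mul, semilinearMap_mul]
  smul_zero s := map_zero _
  smul_add s := map_add _
  smul_one s := map_one _
  smul_mul s := map_mul _

/-- The coordinate ring `L ⊗ C` of a split torus with Galois action on the character lattice. -/
def IsSplitWith (k L : Type*) [Field k] [Field L] [Algebra k L] (C : Type*) [CommRing C]
    [Algebra k C] {N : Type*} [AddCommGroup N] (a : (L ≃ₐ[k] L) →* AddMonoid.End N) : Prop :=
  ∃ u : AddMonoidAlgebra L N ≃ₐ[L] L ⊗[k] C, ∀ (s : L ≃ₐ[k] L) (n : N),
    Algebra.TensorProduct.map (s : L →ₐ[k] L) (AlgHom.id k C) (u (AddMonoidAlgebra.single n 1)) =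
      u (AddMonoidAlgebra.single (a s n) 1)

/-- A `k`-basis of `C` is an `L`-basis of `L ⊗ C` on which the Galois group acts through the
coordinates only. Fixed elements therefore have fixed coordinates, and these lie in `k`. -/
theorem mem_range_includeRight_of_fixed [FiniteDimensional k L] [IsGalois k L] {C : Type*}
    [CommRing C] [Algebra k C] (x : L ⊗[k] C)
    (hx : ∀ s : L ≃ₐ[k] L,
      Algebra.TensorProduct.map (s : L →ₐ[k] L) (AlgHom.id k C) x = x) :
    ∃ c : C, x = 1 ⊗ₜ c := by
  classical
  let b := Module.Basis.ofVectorSpace k C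
  let B := Algebra.TensorProduct.basis L b
  have hB : ∀ (s : L ≃ₐ[k] L) (y : L ⊗[k] C) i,
      B.repr (Algebra.TensorProduct.map (s : L →ₐ[k] L) (AlgHom.id k C) y) i = s (B.repr y i) := by
    intro s y i
    induction y using TensorProduct.induction_on with
    | zero => simp
    | add y z h1 h2 => simp only [map_add, Finsupp.add_apply, h1, h2]
    | tmul l c =>
      simp only [Algebra.TensorProduct.map_tmul, B, Algebra.TensorProduct.basis_repr_tmul,
        Finsupp.smul_apply, smul_eq_mul, AlgHom.id_apply, Finsupp.mapRange_apply, map_mul]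
      congr 1
      simp
  have hfix : ∀ i, ∃ c : k, algebraMap k L c = B.repr x i := by
    intro i
    apply (IsGalois.mem_range_algebraMap_iff_fixed (F := k) (E := L) _).2
    intro s
    rw [← hB s x i, hx s]
  choose c hc using hfix
  refine ⟨∑ i ∈ (B.repr x).support, c i • b i, ?_⟩
  rw [TensorProduct.tmul_sum]
  conv_lhs => rw [← B.linearCombination_repr x, Finsupp.linearCombination_apply, Finsupp.sum]
  refine Finset.sum_congr rfl fun i _ => ?_
  rw [← hc, Algebra.TensorProduct.basis_apply, TensorProduct.tmul_smul, algebraMap_smul]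

end SemilinearAction

/-! ### Invariants of function fields of lattices. -/

section FixedField

open MvPolynomial

/-- Describes the fraction field of `R` inside `E` by cross-multiplied equations, which is the form
used for clearing denominators. -/
theorem RingHom.mem_fieldRange_lift_iff {R E : Type*} [CommRing R] [IsDomain R] [Field E]
    {f : R →+* E} (hf : Function.Injective f) (e : E) :
    e ∈ (IsFractionRing.lift (K := FractionRing R) hf).fieldRange ↔
      ∃ r s : R, s ≠ 0 ∧ e * f s = f r := by
  constructor
  · rintro ⟨w, rfl⟩
    obtain ⟨r, s, hs, rfl⟩ := IsFractionRing.div_surjective (A := R) w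
    have hs0 := nonZeroDivisors.ne_zero hs
    refine ⟨r, s, hs0, ?_⟩
    rw [map_div₀, IsFractionRing.lift_algebraMap, IsFractionRing.lift_algebraMap,
      div_mul_cancel₀]
    exact fun h => hs0 (hf (by rw [h, map_zero]))
  · rintro ⟨r, s, hs, h⟩
    refine ⟨algebraMap _ _ r / algebraMap _ _ s, ?_⟩
    rw [map_div₀, IsFractionRing.lift_algebraMap, IsFractionRing.lift_algebraMap, ← h,
      mul_div_cancel_right₀]
    exact fun h => hs (hf (by rw [h, map_zero]))

variable {k L : Type*} [Field k] [Field L] [Algebra k L] {N P : Type*} [AddCommGroup N]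
  [AddCommGroup P]

/-- Algebraic independence of the monomials of a complement of a sublattice. -/
theorem algebraicIndependent_single_of_injective [NoZeroDivisors (AddMonoidAlgebra L P)]
    {E : Type*} [Field E] [Algebra (AddMonoidAlgebra L P) E]
    [IsFractionRing (AddMonoidAlgebra L P) E] (j : N →+ P) {q : ℕ} (p : Fin q → P)
    (hinj : Function.Injective fun nv : N × (Fin q → ℤ) => j nv.1 + ∑ y, nv.2 y • p y)
    (F : Subfield E)
    (hF : ∀ e ∈ F, ∃ r s : AddMonoidAlgebra L N, s ≠ 0 ∧
      e * algebraMap _ E (AddMonoidAlgebra.mapDomainRingHom L j s) =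
        algebraMap _ E (AddMonoidAlgebra.mapDomainRingHom L j r)) :
    AlgebraicIndependent F fun y => algebraMap (AddMonoidAlgebra L P) E
      (AddMonoidAlgebra.single (p y) 1) := by
  classical
  set J := AddMonoidAlgebra.mapDomainRingHom L j with hJ
  have hjinj : Function.Injective j := fun n n' h => by
    have := @hinj (n, 0) (n', 0) (by simpa using h)
    exact congrArg Prod.fst this
  have hJinj : Function.Injective J := AddMonoidAlgebra.mapDomain_injective hjinj
  have hdom : IsDomain (AddMonoidAlgebra L P) := {}
  have hdomN : IsDomain (AddMonoidAlgebra L N) := hJinj.isDomain J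
  have hEinj := IsFractionRing.injective (AddMonoidAlgebra L P) E
  set x : Fin q → E := fun y => algebraMap (AddMonoidAlgebra L P) E
      (AddMonoidAlgebra.single (p y) 1) with hx
  rw [AlgebraicIndependent, injective_iff_map_eq_zero]
  intro f hf
  choose r s hs hrs using fun m => hF (coeff m f : F) (coeff m f).2
  -- clear denominators
  let D := ∏ m ∈ f.support, s m
  let r' : (Fin q →₀ ℕ) → AddMonoidAlgebra L N := fun m => r m * ∏ m' ∈ f.support.erase m, s m'
  have hD : ∀ m ∈ f.support, ((coeff m f : F) : E) * algebraMap _ E (J D) =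
      algebraMap _ E (J (r' m)) := by
    intro m hm
    have : D = s m * ∏ m' ∈ f.support.erase m, s m' := (Finset.mul_prod_erase _ _ hm).symm
    rw [this, map_mul, map_mul, ← mul_assoc, hrs, ← map_mul, ← map_mul]
  have hmono : ∀ m : Fin q →₀ ℕ, ∏ y, x y ^ m y = algebraMap _ E
      (AddMonoidAlgebra.single (∑ y, (m y : ℤ) • p y) (1 : L)) := by
    intro m
    have : ∀ y, x y ^ m y = algebraMap _ E (AddMonoidAlgebra.single ((m y : ℤ) • p y) (1 : L)) := by
      intro y
      simp only [hx]
      rw [← map_pow, AddMonoidAlgebra.single_pow, one_pow, natCast_zsmul]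
    simp only [this]
    rw [← map_prod]
    congr 1
    induction (Finset.univ : Finset (Fin q)) using Finset.induction_on with
    | empty => simp [AddMonoidAlgebra.one_def]
    | insert y t hy ih =>
      rw [Finset.prod_insert hy, Finset.sum_insert hy, ih, AddMonoidAlgebra.single_mul_single,
        one_mul]
  have hsum : ∑ m ∈ f.support, J (r' m) *
      AddMonoidAlgebra.single (∑ y, (m y : ℤ) • p y) (1 : L) = 0 := by
    apply hEinj
    rw [map_sum, map_zero]
    have h1 : aeval x f * algebraMap _ E (J D) = 0 := by rw [hf, zero_mul]
    rw [← h1, aeval_def, eval₂_eq', Finset.sum_mul]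
    refine Finset.sum_congr rfl fun m hm => ?_
    rw [map_mul, ← hD m hm, ← hmono]
    change _ = ((coeff m f : F) : E) * _ * _
    ring
  ext m
  by_contra hm
  have hm' : m ∈ f.support := by
    rw [mem_support_iff]; intro h0; apply hm; rw [h0]; simp
  -- Compare coefficients at `j n + ∑ m_y p_y`. By `hinj` only the summand with index `m` reaches
  -- this exponent, and it contributes the coefficient of `r' m` at `n`.
  have hr0 : r' m = 0 := by
    ext n
    have h2 := congrArg (fun z : AddMonoidAlgebra L P => z.coeff (j n + ∑ y, (m y : ℤ) • p y)) hsum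
    simp only [AddMonoidAlgebra.coeff_sum, Finsupp.coe_finsetSum, Finset.sum_apply,
      AddMonoidAlgebra.coeff_mul_single_apply, mul_one] at h2
    rw [Finset.sum_eq_single m] at h2
    · rw [add_neg_cancel_right] at h2
      exact (Finsupp.mapDomain_apply hjinj _ n).symm.trans h2
    · intro m' hm' hne
      refine Finsupp.mapDomain_of_notMem_range _ _ ?_
      rintro ⟨n', hn'⟩
      have h3 := @hinj (n', fun y => m' y) (n, fun y => m y) (by simp only; rw [hn']; abel)
      refine hne (Finsupp.ext fun y => ?_)
      have h4 := congrFun (congrArg Prod.snd h3) y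
      simp only at h4
      exact_mod_cast h4
    · intro h; exact absurd hm' h
  have hrm : r m = 0 := by
    refine (mul_eq_zero.1 hr0).resolve_right ?_
    exact Finset.prod_ne_zero_iff.2 fun m' _ => hs m'
  have h3 := hrs m
  rw [hrm, map_zero, map_zero] at h3
  rcases mul_eq_zero.1 h3 with h3 | h3
  · exact hm (by rw [coeff_zero]; exact_mod_cast h3)
  · exact hs m (hJinj (hEinj (by rw [h3, map_zero, map_zero])))

end FixedField

section FixedField

open MvPolynomial

variable {k L : Type*} [Field k] [Field L] [Algebra k L]

/-- Multiplying numerator and denominator by the other conjugates of the denominator turns the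
denominator into a norm. Both parts are then invariant and come from `B`. -/
theorem exists_fixed_fraction_of_norm {Γ A B E : Type*} [Group Γ] [Finite Γ] [CommRing A]
    (σ : Γ → A →+* A) (hσ : ∀ g h x, σ g (σ h x) = σ (g * h) x) (hσ₁ : ∀ x, σ 1 x = x)
    [Field E] [MulSemiringAction Γ E] (f : A →+* E)
    (hf : Function.Injective f) (hequiv : ∀ (g : Γ) x, g • f x = f (σ g x)) [CommRing B]
    (ι : B →+* A) (hι : ∀ x : A, (∀ g : Γ, σ g x = x) → ∃ b, ι b = x) (e : E)
    (he : ∀ g : Γ, g • e = e) (h : ∃ r s : A, s ≠ 0 ∧ e * f s = f r) :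
    ∃ c d : B, f (ι d) ≠ 0 ∧ e * f (ι d) = f (ι c) := by
  classical
  have := Fintype.ofFinite Γ
  have hdom : IsDomain A := hf.isDomain f
  obtain ⟨r, s, hs, hrs⟩ := h
  let D := ∏ g : Γ, σ g s
  have hD0 : D ≠ 0 := Finset.prod_ne_zero_iff.2 fun g _ h => hs (by
    rw [← hσ₁ s, ← inv_mul_cancel g, ← hσ, h, map_zero])
  have hDfix : ∀ g : Γ, σ g D = D := by
    intro g
    simp only [D, map_prod, hσ]
    exact Fintype.prod_equiv (Equiv.mulLeft g) _ _ fun _ => rfl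
  let r' := r * ∏ g ∈ Finset.univ.erase (1 : Γ), σ g s
  have hr' : e * f D = f r' := by
    have : D = s * ∏ g ∈ Finset.univ.erase (1 : Γ), σ g s :=
      (Finset.mul_prod_erase _ (fun g => σ g s) (Finset.mem_univ _)).symm.trans (by rw [hσ₁])
    rw [this, map_mul, ← mul_assoc, hrs, ← map_mul]
  have hr'fix : ∀ g : Γ, σ g r' = r' := by
    intro g
    apply hf
    rw [← hequiv, ← hr', smul_mul', he, hequiv, hDfix]
  obtain ⟨d, hd⟩ := hι D hDfix
  obtain ⟨c, hc⟩ := hι r' hr'fix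
  refine ⟨c, d, ?_, by rw [hd, hc, hr']⟩
  rw [hd]
  exact fun h => hD0 (hf (by rw [h, map_zero]))

variable {N P : Type*} [AddCommGroup N] [AddCommGroup P]

/-- The torus version of the no-name lemma: if `P` is a lattice with Galois action containing the
character lattice `N` of the torus `Spec C`, and if `P / N` is a permutation lattice, then the
invariants of the function field `E` of `L[P]` are a rational function field over the function
field `K₀` of `Spec C`. -/
theorem exists_mvPolynomial_ringHom_fixed_of_isSplitWith [FiniteDimensional k L] [IsGalois k L]
    {C : Type*} [CommRing C] [Algebra k C] {a : (L ≃ₐ[k] L) →* AddMonoid.End N}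
    (hC : IsSplitWith k L C a) (K₀ : Type*) [Field K₀] [Algebra C K₀] [IsFractionRing C K₀]
    [Algebra k K₀] [IsScalarTower k C K₀] [NoZeroDivisors (AddMonoidAlgebra L P)]
    (aP : (L ≃ₐ[k] L) →* AddMonoid.End P) (j : N →+ P) {q : ℕ} (p : Fin q → P)
    (hbij : Function.Bijective fun nv : N × (Fin q → ℤ) => j nv.1 + ∑ y, nv.2 y • p y)
    (hj : ∀ s n, aP s (j n) = j (a s n)) (hp : ∀ s y, ∃ y' n, aP s (p y) = p y' + j n)
    (E : Type*) [Field E] [Algebra (AddMonoidAlgebra L P) E]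
    [IsFractionRing (AddMonoidAlgebra L P) E] [MulSemiringAction (L ≃ₐ[k] L) E]
    (hact : ∀ (s : L ≃ₐ[k] L) x, s • algebraMap (AddMonoidAlgebra L P) E x =
      algebraMap (AddMonoidAlgebra L P) E (semilinearMap s (aP s) x)) :
    ∃ Φ : FractionRing (MvPolynomial (Fin q) K₀) →+* E,
      (∀ c : k, Φ (algebraMap (MvPolynomial (Fin q) K₀) _ (MvPolynomial.C (algebraMap k K₀ c))) =
        algebraMap (AddMonoidAlgebra L P) E (AddMonoidAlgebra.single 0 (algebraMap k L c))) ∧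
      Set.range Φ = {e | ∀ s : L ≃ₐ[k] L, s • e = e} := by
  classical
  set J := AddMonoidAlgebra.mapDomainRingHom L j with hJ
  have hJs : ∀ n l, J (AddMonoidAlgebra.single n l) = AddMonoidAlgebra.single (j n) l :=
    fun n l => AddMonoidAlgebra.mapDomain_single
  have hjinj : Function.Injective j := fun n n' h => by
    have := @hbij.1 (n, 0) (n', 0) (by simpa using h)
    exact congrArg Prod.fst this
  have hJinj : Function.Injective J := AddMonoidAlgebra.mapDomain_injective hjinj
  have hdom : IsDomain (AddMonoidAlgebra L P) := {}
  have hEinj := IsFractionRing.injective (AddMonoidAlgebra L P) E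
  let JE : AddMonoidAlgebra L N →+* E := (algebraMap (AddMonoidAlgebra L P) E).comp J
  have hJE : Function.Injective JE := hEinj.comp hJinj
  let g₀ : (L ≃ₐ[k] L) → AddMonoidAlgebra L N →+* AddMonoidAlgebra L N :=
    fun s => semilinearMap s (a s)
  have hg₀ : ∀ g h x, g₀ g (g₀ h x) = g₀ (g * h) x := fun g h x => by
    simp only [g₀, map_mul]
    rw [semilinearMap_mul]
  have hg₁ : ∀ x, g₀ 1 x = x := fun x => by simp only [g₀, map_one]; exact semilinearMap_one x
  have hJsemi : ∀ (s : L ≃ₐ[k] L) (x : AddMonoidAlgebra L N),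
      semilinearMap s (aP s) (J x) = J (g₀ s x) := by
    intro s x
    have : ((semilinearMap s (aP s)).comp J).toAddMonoidHom =
        (J.comp (semilinearMap s (a s))).toAddMonoidHom :=
      AddMonoidAlgebra.addHom_ext_single fun n r => by
        change semilinearMap _ _ (J _) = J (semilinearMap _ _ _)
        rw [semilinearMap_single, hJs, hJs, semilinearMap_single, hj]
    exact DFunLike.congr_fun this x
  have hJEact : ∀ (s : L ≃ₐ[k] L) (x : AddMonoidAlgebra L N), s • JE x = JE (g₀ s x) := by
    intro s x
    change s • algebraMap _ E (J x) = algebraMap _ E (J _)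
    rw [hact, hJsemi]
  obtain ⟨u, hu⟩ := hC
  have hus : ∀ (s : L ≃ₐ[k] L) (x : AddMonoidAlgebra L N),
      Algebra.TensorProduct.map (s : L →ₐ[k] L) (AlgHom.id k C) (u x) = u (g₀ s x) := by
    intro s x
    have : ((Algebra.TensorProduct.map (s : L →ₐ[k] L) (AlgHom.id k C)).toRingHom.comp
          u.toRingEquiv.toRingHom).toAddMonoidHom =
        (u.toRingEquiv.toRingHom.comp (semilinearMap s (a s))).toAddMonoidHom :=
      AddMonoidAlgebra.addHom_ext_single fun n r => by
        change Algebra.TensorProduct.map _ _ (u _) = u (semilinearMap _ _ _)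
        have h1 : ∀ (m : N) (t : L), u (AddMonoidAlgebra.single m t) =
            (t ⊗ₜ[k] (1 : C)) * u (AddMonoidAlgebra.single m 1) := by
          intro m t
          have : AddMonoidAlgebra.single m t = t • AddMonoidAlgebra.single m (1 : L) := by
            rw [AddMonoidAlgebra.smul_single, smul_eq_mul, mul_one]
          rw [this, map_smul, Algebra.smul_def]
          rfl
        rw [semilinearMap_single, h1, map_mul, hu, h1 _ (s r)]
        simp
    exact DFunLike.congr_fun this x
  let ι : C →+* AddMonoidAlgebra L N := (u.symm.toRingEquiv.toRingHom).comp
    (Algebra.TensorProduct.includeRight : C →ₐ[k] L ⊗[k] C).toRingHom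
  have hι : ∀ c, u (ι c) = 1 ⊗ₜ c := fun c => u.apply_symm_apply _
  have hιinj : Function.Injective ι :=
    u.symm.injective.comp (Algebra.TensorProduct.includeRight_injective
      (algebraMap k L).injective)
  have hιfix : ∀ (s : L ≃ₐ[k] L) c, g₀ s (ι c) = ι c := by
    intro s c
    apply u.injective
    rw [← hus, hι]
    simp
  have hιsurj : ∀ x : AddMonoidAlgebra L N, (∀ s : L ≃ₐ[k] L, g₀ s x = x) → ∃ c, ι c = x := by
    intro x hx
    obtain ⟨c, hc⟩ := mem_range_includeRight_of_fixed (u x) fun s => by rw [hus, hx]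
    exact ⟨c, u.injective (by rw [hι, hc])⟩
  have hιk : ∀ c : k, ι (algebraMap k C c) = AddMonoidAlgebra.single 0 (algebraMap k L c) := by
    intro c
    apply u.injective
    rw [hι]
    have : AddMonoidAlgebra.single (0 : N) (algebraMap k L c) =
        algebraMap L (AddMonoidAlgebra L N) (algebraMap k L c) := rfl
    rw [this, u.commutes, Algebra.TensorProduct.algebraMap_apply, Algebra.algebraMap_self_apply,
      Algebra.algebraMap_eq_smul_one, Algebra.algebraMap_eq_smul_one, TensorProduct.tmul_smul,
      TensorProduct.smul_tmul']
  have hCinj : Function.Injective (JE.comp ι) := hJE.comp hιinj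
  set j₀ : K₀ →+* E := IsFractionRing.lift hCinj with hj₀
  have hj₀C : ∀ c, j₀ (algebraMap C K₀ c) = JE (ι c) := fun c =>
    IsFractionRing.lift_algebraMap hCinj c
  have hdomN : IsDomain (AddMonoidAlgebra L N) := hJinj.isDomain J
  -- `F` is the copy of `L(N)` inside `E`. Its invariants form the image of `K₀`.
  let F : Subfield E :=
    (IsFractionRing.lift (K := FractionRing (AddMonoidAlgebra L N)) hJE).fieldRange
  have hmemF : ∀ e, e ∈ F ↔ ∃ r s : AddMonoidAlgebra L N, s ≠ 0 ∧ e * JE s = JE r :=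
    RingHom.mem_fieldRange_lift_iff hJE
  have hJEF : ∀ x, JE x ∈ F := fun x => (hmemF _).2 ⟨x, 1, one_ne_zero, by simp⟩
  set x : Fin q → E := fun y => algebraMap (AddMonoidAlgebra L P) E
      (AddMonoidAlgebra.single (p y) 1) with hx
  have hx0 : ∀ y, x y ≠ 0 := fun y h => by
    have := hEinj (h.trans (map_zero _).symm)
    simp at this
  obtain ⟨Φ, hΦ, hΦr⟩ := exists_mvPolynomial_ringHom_fixed (G := L ≃ₐ[k] L) F
    (by
      intro g e he
      obtain ⟨r, s, hs, h⟩ := (hmemF e).1 he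
      refine (hmemF _).2 ⟨g₀ g r, g₀ g s, fun h => hs ?_, ?_⟩
      · rw [← hg₁ s, ← inv_mul_cancel g, ← hg₀, h, map_zero]
      · rw [← hJEact, ← hJEact, ← smul_mul', h])
    (by
      intro g hg
      -- The constants `L` already lie in `F`, and an automorphism that is trivial on them is the
      -- identity.
      ext l
      have h1 := hg _ (hJEF (AddMonoidAlgebra.single 0 l))
      rw [hJEact] at h1
      have h2 := hJE h1
      rw [semilinearMap_single, map_zero] at h2
      simpa using congrArg (fun z : AddMonoidAlgebra L N => z.coeff 0) h2)
    j₀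
    (by
      intro e
      constructor
      · rintro ⟨w, rfl⟩
        obtain ⟨c, d, hd, rfl⟩ := IsFractionRing.div_surjective (A := C) w
        rw [map_div₀, hj₀C, hj₀C]
        refine ⟨F.div_mem (hJEF _) (hJEF _), fun g => ?_⟩
        rw [smul_div₀', hJEact, hJEact, hιfix, hιfix]
      · rintro ⟨he, hfix⟩
        obtain ⟨c, d, hd, hcd⟩ := exists_fixed_fraction_of_norm g₀ hg₀ hg₁ JE hJE hJEact ι hιsurj e
          hfix ((hmemF e).1 he)
        refine ⟨algebraMap C K₀ c / algebraMap C K₀ d, ?_⟩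
        rw [map_div₀, hj₀C, hj₀C, ← hcd, mul_div_cancel_right₀ _ hd])
    x
    (algebraicIndependent_single_of_injective j p hbij.1 F fun e he => (hmemF e).1 he)
    (by
      -- Each monomial of `P` is a monomial of `N` times integral powers of the `x y`, so these
      -- generate `E` over `F`.
      have hadj : IntermediateField.adjoin F (Set.range x) = ⊤ := by
        rw [eq_top_iff]
        intro e _
        set S := IntermediateField.adjoin F (Set.range x)
        have hxS : ∀ y, x y ∈ S := fun y => IntermediateField.subset_adjoin F _ ⟨y, rfl⟩
        have hFS : ∀ e ∈ F, e ∈ S := fun e he => S.algebraMap_mem (⟨e, he⟩ : F)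
        have hRS : ∀ w : AddMonoidAlgebra L P, algebraMap _ E w ∈ S := by
          intro w
          induction w using AddMonoidAlgebra.induction_linear with
          | zero => rw [map_zero]; exact S.zero_mem
          | add w₁ w₂ h₁ h₂ => rw [map_add]; exact S.add_mem h₁ h₂
          | single n l =>
            obtain ⟨⟨m, v⟩, rfl⟩ := hbij.2 n
            simp only
            rw [← mul_one l, ← AddMonoidAlgebra.single_mul_single, map_mul]
            refine S.mul_mem (hFS _ ?_) ?_
            · have := hJEF (AddMonoidAlgebra.single m l)
              rwa [show JE (AddMonoidAlgebra.single m l) = algebraMap _ E _ from rfl, hJs] at this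
            · have key : ∀ y (b : ℤ),
                  algebraMap _ E (AddMonoidAlgebra.single (b • p y) (1 : L)) ∈ S := by
                have hnat : ∀ y (b : ℕ),
                    algebraMap _ E (AddMonoidAlgebra.single (b • p y) (1 : L)) = x y ^ b := by
                  intro y b
                  simp only [hx]
                  rw [← map_pow, AddMonoidAlgebra.single_pow, one_pow]
                intro y b
                obtain ⟨b, rfl | rfl⟩ := b.eq_nat_or_neg
                · rw [natCast_zsmul, hnat]
                  exact S.toSubalgebra.pow_mem (hxS y) b
                · have : algebraMap _ E (AddMonoidAlgebra.single ((-(b : ℤ)) • p y) (1 : L)) =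
                      (x y ^ b)⁻¹ := by
                    refine eq_inv_of_mul_eq_one_left ?_
                    rw [← hnat, ← map_mul, AddMonoidAlgebra.single_mul_single, neg_smul, natCast_zsmul,
                      neg_add_cancel, mul_one]
                    exact map_one _
                  rw [this]
                  exact S.inv_mem (S.toSubalgebra.pow_mem (hxS y) b)
              induction (Finset.univ : Finset (Fin q)) using Finset.induction_on with
              | empty => 
                rw [Finset.sum_empty]
                exact (map_one (algebraMap (AddMonoidAlgebra L P) E)).symm ▸ S.one_mem
              | insert y t hy ih =>
                rw [Finset.sum_insert hy, ← mul_one (1 : L), ← AddMonoidAlgebra.single_mul_single,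
                  map_mul]
                exact S.mul_mem (key _ _) ih
        obtain ⟨w₁, w₂, _, rfl⟩ := IsFractionRing.div_surjective (A := AddMonoidAlgebra L P) e
        exact S.div_mem (hRS _) (hRS _)
      intro e
      obtain ⟨r, s, hrs⟩ := (IntermediateField.mem_adjoin_range_iff F x e).1
        (hadj ▸ IntermediateField.mem_top)
      by_cases h0 : aeval x s = 0
      · exact ⟨0, 1, by simp, by rw [hrs, h0]; simp⟩
      · exact ⟨r, s, h0, by rw [hrs, div_mul_cancel₀ _ h0]⟩)
    (by
      intro g y
      -- Only the classes of the `p y` modulo `N` are permuted. The correction is a monomial of `N`,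
      -- hence a scalar in `F`, which is all that semilinearity asks for.
      obtain ⟨y', n, h⟩ := hp g y
      have : g • x y = (⟨_, hJEF (AddMonoidAlgebra.single n 1)⟩ : F) • x y' := by
        change g • x y = JE (AddMonoidAlgebra.single n 1) * x y'
        rw [show JE (AddMonoidAlgebra.single n 1) = algebraMap _ E _ from rfl, hJs]
        simp only [hx]
        rw [hact, semilinearMap_single, h, map_one, ← map_mul, AddMonoidAlgebra.single_mul_single,
          one_mul, add_comm]
      rw [this]
      exact Submodule.smul_mem _ _ (Submodule.subset_span ⟨y', rfl⟩))
  refine ⟨Φ, fun c => ?_, hΦr⟩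
  rw [hΦ, IsScalarTower.algebraMap_apply k C K₀, hj₀C, hιk]
  change algebraMap _ E (J _) = _
  rw [hJs, map_zero]

end FixedField

/-! ### Stable rationality from permutation lattices. -/

section PositiveCriterion

theorem exists_mulSemiringAction_fractionRing {Γ A : Type*} [Group Γ] [CommRing A] [IsDomain A]
    [MulSemiringAction Γ A] : ∃ _ : MulSemiringAction Γ (FractionRing A), ∀ (s : Γ) (x : A),
      s • algebraMap A (FractionRing A) x = algebraMap A (FractionRing A) (s • x) :=
  ⟨IsFractionRing.mulSemiringAction Γ A (FractionRing A), fun s x => by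
    let := IsFractionRing.mulSemiringAction Γ A (FractionRing A)
    exact (algebraMap.coe_smul' s x (FractionRing A)).symm⟩

variable {k L : Type*} [Field k] [Field L] [Algebra k L]

/-- The trivial torus, with zero character lattice. It lets the no-name lemma be applied over `k`
itself. -/
theorem isSplitWith_base : IsSplitWith k L k (1 : (L ≃ₐ[k] L) →* AddMonoid.End Unit) := by
  refine ⟨(AddMonoidAlgebra.uniqueAlgEquiv (A := L) L Unit).trans
    (Algebra.TensorProduct.rid k L L).symm, fun s n => ?_⟩
  have : (1 : (L ≃ₐ[k] L) →* AddMonoid.End Unit) s n = n := Subsingleton.elim _ _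
  have h1 : (AddMonoidAlgebra.uniqueAlgEquiv (A := L) L Unit) (AddMonoidAlgebra.single n 1) = 1 :=
    map_one (AddMonoidAlgebra.uniqueAlgEquiv (A := L) L Unit)
  rw [this]
  simp [h1]

/-- A torus whose character lattice `N` sits in an exact sequence `0 → N → P → Q → 0` with
permutation lattices `P`, `Q` is stably rational. -/
theorem isStablyRational_of_isSplitWith [FiniteDimensional k L] [IsGalois k L]
    {C : Type*} [CommRing C] [Algebra k C] {N : Type*} [AddCommGroup N]
    {a : (L ≃ₐ[k] L) →* AddMonoid.End N} (hC : IsSplitWith k L C a) {m q : ℕ}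
    (aP : (L ≃ₐ[k] L) →* AddMonoid.End (Fin m → ℤ))
    (hperm : ∀ s i, ∃ i', aP s (Pi.single i 1) = Pi.single i' 1)
    (j : N →+ (Fin m → ℤ)) (p : Fin q → (Fin m → ℤ))
    (hbij : Function.Bijective fun nv : N × (Fin q → ℤ) => j nv.1 + ∑ y, nv.2 y • p y)
    (hj : ∀ s n, aP s (j n) = j (a s n)) (hp : ∀ s y, ∃ y' n, aP s (p y) = p y' + j n) :
    IsStablyRational k C := by
  obtain ⟨act, hact⟩ := @exists_mulSemiringAction_fractionRing (L ≃ₐ[k] L)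
    (AddMonoidAlgebra L (Fin m → ℤ)) _ _ _ (galoisActionGroupAlgebra aP)
  have hjinj : Function.Injective j := fun n n' h => by
    have := @hbij.1 (n, 0) (n', 0) (by simpa using h)
    exact congrArg Prod.fst this
  have hCdom : IsDomain C := by
    obtain ⟨u, -⟩ := hC
    have hN : IsDomain (AddMonoidAlgebra L N) := Function.Injective.isDomain
      (AddMonoidAlgebra.mapDomainRingHom L j) (AddMonoidAlgebra.mapDomain_injective hjinj)
    have : Function.Injective ((u.symm.toRingEquiv.toRingHom).comp
        (Algebra.TensorProduct.includeRight : C →ₐ[k] L ⊗[k] C).toRingHom) :=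
      u.symm.injective.comp (Algebra.TensorProduct.includeRight_injective
        (algebraMap k L).injective)
    exact this.isDomain _
  -- The invariant field of `L(P)` is described twice: as rational over the function field of the
  -- torus, through the quotient lattice, and as rational over `k`, through the permutation basis of
  -- `P`. Comparing the two images gives stable rationality.
  obtain ⟨Φ, hΦ, hΦr⟩ := exists_mvPolynomial_ringHom_fixed_of_isSplitWith hC (FractionRing C) aP j p
    hbij hj hp (FractionRing (AddMonoidAlgebra L (Fin m → ℤ))) (fun s x => hact s x)
  obtain ⟨Ψ, hΨ, hΨr⟩ := exists_mvPolynomial_ringHom_fixed_of_isSplitWith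
    (isSplitWith_base (k := k) (L := L)) k aP (0 : Unit →+ (Fin m → ℤ)) (fun i => Pi.single i 1)
    (by
      have : ∀ v : Fin m → ℤ, ∑ y, v y • Pi.single y (1 : ℤ) = v := fun v => by
        ext i; simp [Finset.sum_apply, Pi.single_apply]
      constructor
      · rintro ⟨⟨⟩, v⟩ ⟨⟨⟩, w⟩ h
        simp only [this, AddMonoidHom.zero_apply, zero_add] at h
        rw [h]
      · intro v
        exact ⟨(0, v), by simp only [this, AddMonoidHom.zero_apply, zero_add]⟩)
    (fun s n => by simp)
    (fun s y => by
      obtain ⟨i, hi⟩ := hperm s y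
      exact ⟨i, 0, by simp [hi]⟩)
    (FractionRing (AddMonoidAlgebra L (Fin m → ℤ))) (fun s x => hact s x)
  refine ⟨q, m, ⟨?_⟩⟩
  let f₁ := RingEquiv.ofBijective Φ.rangeRestrict
    ⟨fun x y h => Φ.injective (congrArg Subtype.val h), Φ.rangeRestrict_surjective⟩
  let f₂ := RingEquiv.ofBijective Ψ.rangeRestrict
    ⟨fun x y h => Ψ.injective (congrArg Subtype.val h), Ψ.rangeRestrict_surjective⟩
  have hrange : Φ.range = Ψ.range := SetLike.coe_injective (by
    rw [RingHom.coe_range, RingHom.coe_range, hΦr, hΨr])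
  refine AlgEquiv.ofRingEquiv (f := (f₁.trans (RingEquiv.subringCongr hrange)).trans f₂.symm) ?_
  intro c
  simp only [RingEquiv.trans_apply]
  rw [RingEquiv.symm_apply_eq]
  apply Subtype.ext
  change Φ _ = Ψ _
  rw [IsScalarTower.algebraMap_apply k (MvPolynomial (Fin q) (FractionRing C)),
    IsScalarTower.algebraMap_apply k (MvPolynomial (Fin m) k)
      (FractionRing (MvPolynomial (Fin m) k))]
  exact (hΦ c).trans (hΨ c).symm

end PositiveCriterion

/-! ### From character modules to split coordinate rings. -/

section CharacterModules

variable {k L : Type*} [Field k] [Field L] [Algebra k L]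

/-- The action of a group on row vectors attached to an antihomomorphism to `GL(n, ℤ)`. -/
def rowAction {Γ : Type*} [Group Γ] {n : ℕ} (ρ : Γ →* (GL (Fin n) ℤ)ᵐᵒᵖ) :
    Γ →* AddMonoid.End (Fin n → ℤ) where
  toFun s := (Matrix.vecMulLinear ((ρ s).unop : Matrix (Fin n) (Fin n) ℤ)).toAddMonoidHom
  map_one' := by
    ext v : 1
    change Matrix.vecMul v ((ρ 1).unop : Matrix (Fin n) (Fin n) ℤ) = v
    simp
  map_mul' s t := by
    ext v : 1
    change Matrix.vecMul v ((ρ (s * t)).unop : Matrix (Fin n) (Fin n) ℤ) =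
      Matrix.vecMul (Matrix.vecMul v ((ρ t).unop : Matrix (Fin n) (Fin n) ℤ))
        ((ρ s).unop : Matrix (Fin n) (Fin n) ℤ)
    simp

theorem rowAction_apply {Γ : Type*} [Group Γ] {n : ℕ} (ρ : Γ →* (GL (Fin n) ℤ)ᵐᵒᵖ) (s : Γ)
    (v : Fin n → ℤ) :
    rowAction ρ s v = Matrix.vecMul v ((ρ s).unop : Matrix (Fin n) (Fin n) ℤ) := rfl

/-- The antihomomorphism `Gal(L/k) → GL(n, ℤ)` attached to an identification with `G`. -/
def galoisRep {Γ : Type*} [Group Γ] {n : ℕ} {G : Subgroup (GL (Fin n) ℤ)}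
    (φ : Γ ≃* (G)ᵐᵒᵖ) : Γ →* (GL (Fin n) ℤ)ᵐᵒᵖ :=
  (MonoidHom.op G.subtype).comp φ.toMonoidHom

theorem galoisRep_apply {Γ : Type*} [Group Γ] {n : ℕ} {G : Subgroup (GL (Fin n) ℤ)}
    (φ : Γ ≃* (G)ᵐᵒᵖ) (s : Γ) : (galoisRep φ s).unop = ((φ s).unop : GL (Fin n) ℤ) := rfl

/-- Group-like elements are linearly independent, and they span `L ⊗ A` because they span a group
algebra. Hence the given basis of characters identifies `L ⊗ A` with the group algebra
equivariantly. The isomorphism `e` need not be equivariant; it is used only for the spanning. -/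
theorem isSplitWith_of_hasCharacterModule {A : Type*} [CommRing A] [HopfAlgebra k A] {n : ℕ}
    {G : Subgroup (GL (Fin n) ℤ)} {φ : (L ≃ₐ[k] L) ≃* (G)ᵐᵒᵖ}
    (h : HasCharacterModule k L A G φ) : IsSplitWith k L A (rowAction (galoisRep φ)) := by
  obtain ⟨⟨e⟩, u, hu⟩ := h
  let F : Multiplicative (Fin n → ℤ) →* L ⊗[k] A := (GroupLike.valMonoidHom L (L ⊗[k] A)).comp u.toMonoidHom
  have hF : ∀ v, F v = (u v).val := fun v => rfl
  let w : AddMonoidAlgebra L (Fin n → ℤ) →ₐ[L] L ⊗[k] A := AddMonoidAlgebra.lift L _ _ F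
  have hw : ∀ v, w (AddMonoidAlgebra.single v 1) = (u (Multiplicative.ofAdd v)).val := by
    intro v
    simp only [w, AddMonoidAlgebra.lift_single, one_smul]
    rfl
  have hinj : Function.Injective w := by
    have hli := (linearIndep_groupLikeVal (R := L) (A := L ⊗[k] A)).comp
      (fun v : Fin n → ℤ => u (Multiplicative.ofAdd v)) (fun v v' h => by simpa using h)
    intro x y hxy
    refine AddMonoidAlgebra.ext (hli ?_)
    have key : ∀ z : AddMonoidAlgebra L (Fin n → ℤ), w z = Finsupp.linearCombination L
        (GroupLike.val ∘ fun v : Fin n → ℤ => u (Multiplicative.ofAdd v)) z.coeff := by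
      intro z
      induction z using AddMonoidAlgebra.induction_linear with
      | zero => simp
      | add a b ha hb => rw [map_add, ha, hb, ← map_add]; rfl
      | single v l =>
        simp only [w, AddMonoidAlgebra.lift_single, hF]
        simp
    rw [← key, ← key, hxy]
  have hsurj : Function.Surjective w := by
    have h1 : Submodule.span L {a : L ⊗[k] A | IsGroupLikeElem L a} ≤
        LinearMap.range w.toLinearMap := by
      rw [Submodule.span_le]
      intro a ha
      obtain ⟨v, hv⟩ := u.surjective ⟨a, ha⟩
      exact ⟨AddMonoidAlgebra.single v.toAdd 1, by
        change w _ = a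
        rw [hw, ofAdd_toAdd, hv]⟩
    intro x
    have h2 : e x ∈ Submodule.span L
        {a : AddMonoidAlgebra L (Fin n → ℤ) | IsGroupLikeElem L a} := by
      rw [AddMonoidAlgebra.span_isGroupLikeElem]; trivial
    have h3 : x ∈ Submodule.span L {a : L ⊗[k] A | IsGroupLikeElem L a} := by
      have := Submodule.mem_map_of_mem
        (f := (e.symm : AddMonoidAlgebra L (Fin n → ℤ) ≃ₐ[L] L ⊗[k] A).toLinearMap) h2
      rw [Submodule.map_span] at this
      have hx : (e.symm : AddMonoidAlgebra L (Fin n → ℤ) ≃ₐ[L] L ⊗[k] A).toLinearMap (e x) = x :=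
        e.symm_apply_apply x
      rw [hx] at this
      refine Submodule.span_mono ?_ this
      rintro _ ⟨a, ha, rfl⟩
      exact IsGroupLikeElem.map e.symm ha
    exact h1 h3
  refine ⟨AlgEquiv.ofBijective w (And.intro hinj hsurj : Function.Bijective w), fun s v => ?_⟩
  change Algebra.TensorProduct.map (s : L →ₐ[k] L) (AlgHom.id k A) (w _) = w _
  rw [hw, hw]
  let f₁ : (Fin n → ℤ) →+ Additive (L ⊗[k] A) := MonoidHom.toAdditiveRight
    (((galoisConj k L A s : (L ⊗[k] A) →ₐ[k] (L ⊗[k] A)) : (L ⊗[k] A) →* (L ⊗[k] A)).comp F)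
  let f₂ : (Fin n → ℤ) →+ Additive (L ⊗[k] A) :=
    (MonoidHom.toAdditiveRight F).comp (rowAction (galoisRep φ) s)
  have h12 : f₁ = f₂ := by
    refine AddMonoidHom.functions_ext' _ _ _ fun i => AddMonoidHom.ext_int ?_
    refine (hu s i).trans ?_
    change _ = F (rowAction (galoisRep φ) s (Pi.single i 1))
    rw [rowAction_apply, Matrix.single_one_vecMul]
    rfl
  exact DFunLike.congr_fun h12 v

theorem IsSplitWith.congr {C : Type*} [CommRing C] [Algebra k C] {N N' : Type*} [AddCommGroup N]
    [AddCommGroup N'] {a : (L ≃ₐ[k] L) →* AddMonoid.End N} {a' : (L ≃ₐ[k] L) →* AddMonoid.End N'}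
    (e : N' ≃+ N) (he : ∀ s n, e (a' s n) = a s (e n)) (h : IsSplitWith k L C a) :
    IsSplitWith k L C a' := by
  obtain ⟨u, hu⟩ := h
  have h1 : ∀ n, AddMonoidAlgebra.domCongr L L e (AddMonoidAlgebra.single n 1) =
      AddMonoidAlgebra.single (e n) 1 := fun n => by simp
  refine ⟨(AddMonoidAlgebra.domCongr L L e).trans u, fun s n => ?_⟩
  rw [AlgEquiv.trans_apply, AlgEquiv.trans_apply, h1, h1, hu, he]

/-- Base change commutes with the tensor product. Products of characters of the two factors form an
`L`-basis, so the map from the group algebra of `N × N'` carries a basis to a basis. -/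
theorem IsSplitWith.tensor {C C' : Type*} [CommRing C] [Algebra k C] [CommRing C'] [Algebra k C']
    {N N' : Type*} [AddCommGroup N]
    [AddCommGroup N'] {a : (L ≃ₐ[k] L) →* AddMonoid.End N} {a' : (L ≃ₐ[k] L) →* AddMonoid.End N'}
    (h : IsSplitWith k L C a) (h' : IsSplitWith k L C' a')
    (b : (L ≃ₐ[k] L) →* AddMonoid.End (N × N')) (hb : ∀ s n n', b s (n, n') = (a s n, a' s n')) :
    IsSplitWith k L (C ⊗[k] C') b := by
  obtain ⟨u, hu⟩ := h
  obtain ⟨u', hu'⟩ := h'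
  let ι : L ⊗[k] C →ₐ[L] L ⊗[k] (C ⊗[k] C') :=
    Algebra.TensorProduct.map (AlgHom.id L L) Algebra.TensorProduct.includeLeft
  let ι' : L ⊗[k] C' →ₐ[L] L ⊗[k] (C ⊗[k] C') :=
    Algebra.TensorProduct.map (AlgHom.id L L) Algebra.TensorProduct.includeRight
  let ψ : (L ⊗[k] C) ⊗[L] (L ⊗[k] C') →ₐ[L] L ⊗[k] (C ⊗[k] C') :=
    Algebra.TensorProduct.lift ι ι' fun _ _ => Commute.all _ _
  let D := TensorProduct.AlgebraTensorModule.distribBaseChange k L C C'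
  have hψD : ∀ x, ψ (D x) = x := by
    intro x
    induction x using TensorProduct.induction_on with
    | zero => simp
    | add x y hx hy => rw [map_add, map_add, hx, hy]
    | tmul l y =>
      induction y using TensorProduct.induction_on with
      | zero => simp
      | add x y hx hy => rw [TensorProduct.tmul_add, map_add, map_add, hx, hy]
      | tmul c c' =>
        simp [D, ψ, ι, ι', TensorProduct.AlgebraTensorModule.distribBaseChange_tmul]
  have hψ : ∀ y, ψ y = D.symm y := fun y => by
    rw [← hψD (D.symm y), D.apply_symm_apply]
  let F : Multiplicative (N × N') →* L ⊗[k] (C ⊗[k] C') :=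
    { toFun := fun m => ι (u (AddMonoidAlgebra.single m.toAdd.1 1)) *
        ι' (u' (AddMonoidAlgebra.single m.toAdd.2 1))
      map_one' := by
        have h1 : u (AddMonoidAlgebra.single 0 1) = 1 := map_one u
        have h2 : u' (AddMonoidAlgebra.single 0 1) = 1 := map_one u'
        simp [h1, h2]
      map_mul' := fun x y => by
        have h1 : ∀ a b, u (AddMonoidAlgebra.single (a + b) 1) =
            u (AddMonoidAlgebra.single a 1) * u (AddMonoidAlgebra.single b 1) := fun a b => by
          rw [← map_mul, AddMonoidAlgebra.single_mul_single, one_mul]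
        have h2 : ∀ a b, u' (AddMonoidAlgebra.single (a + b) 1) =
            u' (AddMonoidAlgebra.single a 1) * u' (AddMonoidAlgebra.single b 1) := fun a b => by
          rw [← map_mul, AddMonoidAlgebra.single_mul_single, one_mul]
        simp only [toAdd_mul, Prod.fst_add, Prod.snd_add, h1, h2, map_mul]
        ring }
  let w : AddMonoidAlgebra L (N × N') →ₐ[L] L ⊗[k] (C ⊗[k] C') := AddMonoidAlgebra.lift L _ _ F
  have hw : ∀ n n', w (AddMonoidAlgebra.single (n, n') 1) =
      ι (u (AddMonoidAlgebra.single n 1)) * ι' (u' (AddMonoidAlgebra.single n' 1)) := by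
    intro n n'
    simp only [w, AddMonoidAlgebra.lift_single, one_smul]
    rfl
  let B := (((AddMonoidAlgebra.basis N L).map u.toLinearEquiv).tensorProduct
    ((AddMonoidAlgebra.basis N' L).map u'.toLinearEquiv)).map D.symm
  have hwB : w.toLinearMap = ((AddMonoidAlgebra.basis (N × N') L).equiv B (Equiv.refl _)).toLinearMap := by
    refine (AddMonoidAlgebra.basis (N × N') L).ext fun ⟨n, n'⟩ => ?_
    have h1 : (AddMonoidAlgebra.basis (N × N') L) (n, n') = AddMonoidAlgebra.single (n, n') 1 := rfl
    rw [LinearEquiv.coe_coe, Module.Basis.equiv_apply, h1, AlgHom.toLinearMap_apply, hw]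
    simp only [B, Equiv.refl_apply, Module.Basis.map_apply, Module.Basis.tensorProduct_apply]
    change _ = D.symm (u (AddMonoidAlgebra.single n 1) ⊗ₜ[L] u' (AddMonoidAlgebra.single n' 1))
    rw [← hψ, Algebra.TensorProduct.lift_tmul]
  have hbij : Function.Bijective w := by
    have : (w : _ → _) = (AddMonoidAlgebra.basis (N × N') L).equiv B (Equiv.refl _) :=
      funext fun x => LinearMap.congr_fun hwB x
    rw [this]
    exact LinearEquiv.bijective _
  refine ⟨AlgEquiv.ofBijective w hbij, fun s ⟨n, n'⟩ => ?_⟩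
  change Algebra.TensorProduct.map (s : L →ₐ[k] L) (AlgHom.id k (C ⊗[k] C')) (w _) = w _
  rw [hb, hw, hw, map_mul, ← hu, ← hu']
  have h1 : ∀ x, Algebra.TensorProduct.map (s : L →ₐ[k] L) (AlgHom.id k (C ⊗[k] C')) (ι x) =
      ι (Algebra.TensorProduct.map (s : L →ₐ[k] L) (AlgHom.id k C) x) := by
    intro x
    induction x using TensorProduct.induction_on with
    | zero => simp
    | add x y hx hy => simp only [map_add, hx, hy]
    | tmul l c => simp [ι]
  have h2 : ∀ x, Algebra.TensorProduct.map (s : L →ₐ[k] L) (AlgHom.id k (C ⊗[k] C')) (ι' x) =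
      ι' (Algebra.TensorProduct.map (s : L →ₐ[k] L) (AlgHom.id k C') x) := by
    intro x
    induction x using TensorProduct.induction_on with
    | zero => simp
    | add x y hx hy => simp only [map_add, hx, hy]
    | tmul l c => simp [ι']
  rw [h1, h2]

end CharacterModules

/-! ### Permutation lattices and invariant matrices. -/

section PermutationLattices

variable {k L : Type*} [Field k] [Field L] [Algebra k L]

/-- The permutation lattice of a `Γ`-set. -/
def permutationAction (Γ X : Type*) [Group Γ] [MulAction Γ X] :
    Γ →* AddMonoid.End (X → ℤ) where
  toFun g := { toFun := fun f x => f (g⁻¹ • x), map_zero' := rfl, map_add' := fun _ _ => rfl }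
  map_one' := by
    ext f : 1
    change (fun x => f ((1 : Γ)⁻¹ • x)) = f
    simp
  map_mul' g h := by
    ext f : 1
    change (fun x => f ((g * h)⁻¹ • x)) = fun x => f (h⁻¹ • g⁻¹ • x)
    simp only [mul_inv_rev, mul_smul]

theorem permutationAction_apply {Γ X : Type*} [Group Γ] [MulAction Γ X] (g : Γ) (f : X → ℤ) (x : X) :
    permutationAction Γ X g f x = f (g⁻¹ • x) := rfl

theorem permutationAction_single {Γ X : Type*} [Group Γ] [MulAction Γ X] [DecidableEq X] (g : Γ)
    (x : X) (c : ℤ) :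
    permutationAction Γ X g (Pi.single x c) = Pi.single (g • x) c := by
  ext y
  rw [permutationAction_apply, Pi.single_apply, Pi.single_apply]
  simp only [inv_smul_eq_iff]

/-- The criterion with arbitrary finite index types; enumerating them reduces it to
`isStablyRational_of_isSplitWith`. -/
theorem isStablyRational_of_permutationAction [FiniteDimensional k L] [IsGalois k L]
    {C : Type*} [CommRing C] [Algebra k C] {N : Type*} [AddCommGroup N]
    {a : (L ≃ₐ[k] L) →* AddMonoid.End N} (hC : IsSplitWith k L C a) {X Y : Type*} [Fintype X]
    [Fintype Y] [MulAction (L ≃ₐ[k] L) X] (j : N →+ (X → ℤ)) (p : Y → (X → ℤ))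
    (hbij : Function.Bijective fun nv : N × (Y → ℤ) => j nv.1 + ∑ y, nv.2 y • p y)
    (hj : ∀ s n, permutationAction (L ≃ₐ[k] L) X s (j n) = j (a s n))
    (hp : ∀ s y, ∃ y' n, permutationAction (L ≃ₐ[k] L) X s (p y) = p y' + j n) :
    IsStablyRational k C := by
  classical
  let eX := Fintype.equivFin X
  let eY := Fintype.equivFin Y
  let R : (X → ℤ) ≃+ (Fin (Fintype.card X) → ℤ) :=
    { Equiv.arrowCongr eX (Equiv.refl ℤ) with map_add' := fun _ _ => rfl }
  have hR : ∀ f i, R f i = f (eX.symm i) := fun _ _ => rfl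
  let aP : (L ≃ₐ[k] L) →* AddMonoid.End (Fin (Fintype.card X) → ℤ) :=
    { toFun := fun s => R.toAddMonoidHom.comp ((permutationAction (L ≃ₐ[k] L) X s).comp R.symm.toAddMonoidHom)
      map_one' := by
        rw [map_one]; ext v : 1
        exact R.apply_symm_apply v
      map_mul' := fun s t => by
        rw [map_mul]; ext v : 1
        change R (permutationAction (L ≃ₐ[k] L) X s (permutationAction (L ≃ₐ[k] L) X t (R.symm v))) =
          R (permutationAction (L ≃ₐ[k] L) X s (R.symm (R (permutationAction (L ≃ₐ[k] L) X t (R.symm v)))))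
        rw [R.symm_apply_apply] }
  have haP : ∀ s f, aP s (R f) = R (permutationAction (L ≃ₐ[k] L) X s f) := fun s f => by
    change R (permutationAction (L ≃ₐ[k] L) X s (R.symm (R f))) = _
    rw [R.symm_apply_apply]
  refine isStablyRational_of_isSplitWith hC aP (fun s i => ⟨eX (s • eX.symm i), ?_⟩)
    (R.toAddMonoidHom.comp j) (fun y : Fin (Fintype.card Y) => R (p (eY.symm y))) ?_
    (fun s n => ?_) fun s y => ?_
  · have hsingle : ∀ i, (Pi.single i 1 : Fin (Fintype.card X) → ℤ) =
        R (Pi.single (eX.symm i) 1) := by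
      intro i
      ext i'
      rw [hR, Pi.single_apply, Pi.single_apply]
      simp
    rw [hsingle, haP, permutationAction_single, hsingle, Equiv.symm_apply_apply]
  · have hcomp : (fun nv : N × (Fin (Fintype.card Y) → ℤ) =>
        (R.toAddMonoidHom.comp j) nv.1 + ∑ y, nv.2 y • R (p (eY.symm y))) =
        R ∘ (fun nv : N × (Y → ℤ) => j nv.1 + ∑ y, nv.2 y • p y) ∘
          (Equiv.prodCongr (Equiv.refl N) (Equiv.arrowCongr eY.symm (Equiv.refl ℤ))) := by
      funext nv
      simp only [Function.comp_apply, map_add, map_sum, map_zsmul]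
      congr 1
      exact Fintype.sum_equiv eY.symm _ _ fun y => by simp
    rw [hcomp]
    exact R.bijective.comp (hbij.comp (Equiv.bijective _))
  · change aP s (R (j n)) = R (j (a s n))
    rw [haP, hj]
  · obtain ⟨y', n, h⟩ := hp s (eY.symm y)
    refine ⟨eY y', n, ?_⟩
    rw [haP, h, map_add, Equiv.symm_apply_apply]
    rfl

/-- A torus is stably rational if its character lattice is the kernel of an equivariant surjection
of permutation lattices.  The surjection is given by its matrix `B`. -/
theorem isStablyRational_of_invariant_matrix [FiniteDimensional k L] [IsGalois k L]
    {C : Type*} [CommRing C] [Algebra k C] {N : Type*} [AddCommGroup N] [Module.Free ℤ N]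
    [Module.Finite ℤ N] {Γ : Type*} [Group Γ] (a : Γ →* AddMonoid.End N) (r : (L ≃ₐ[k] L) →* Γ)
    (hC : IsSplitWith k L C (a.comp r)) {X Y : Type*} [Fintype X] [Fintype Y] [DecidableEq Y]
    [MulAction Γ X] [MulAction Γ Y] (B : X → Y → ℤ)
    (hB : ∀ (g : Γ) x y, B (g • x) (g • y) = B x y) (j : N →+ (X → ℤ))
    (hj : ∀ (g : Γ) n x, j (a g n) (g • x) = j n x)
    (hjB : ∀ n y, ∑ x, j n x * B x y = 0) (δ : (X → ℤ) →+ N) (hδ : ∀ n, δ (j n) = n)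
    (hsurj : ∀ y, ∃ w : X → ℤ, ∀ y', ∑ x, w x * B x y' = if y' = y then 1 else 0)
    (hcard : Module.finrank ℤ N + Fintype.card Y = Fintype.card X) :
    IsStablyRational k C := by
  classical
  choose p hpB using hsurj
  let β : (X → ℤ) →ₗ[ℤ] (Y → ℤ) := Matrix.vecMulLinear (Matrix.of B)
  have hβ : ∀ w y, β w y = ∑ x, w x * B x y := fun w y => rfl
  have hβj : ∀ n, β (j n) = 0 := fun n => funext fun y => hjB n y
  have hβp : ∀ v : Y → ℤ, β (∑ y, v y • p y) = v := by
    intro v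
    ext y'
    rw [map_sum, Finset.sum_apply]
    have h1 : ∀ y, β (v y • p y) y' = v y * if y' = y then 1 else 0 := fun y => by
      rw [map_smul, Pi.smul_apply, hβ, hpB, smul_eq_mul]
    rw [Finset.sum_congr rfl fun y _ => h1 y]
    simp
  let ψ : (X → ℤ) →ₗ[ℤ] N × (Y → ℤ) := δ.toIntLinearMap.prod β
  have hψsurj : Function.Surjective ψ := by
    rintro ⟨n, v⟩
    refine ⟨j (n - δ (∑ y, v y • p y)) + ∑ y, v y • p y, ?_⟩
    refine Prod.ext ?_ ?_
    · change δ _ = n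
      rw [map_add, hδ, sub_add_cancel]
    · change β _ = v
      rw [map_add, hβj, hβp, zero_add]
  -- A surjection between free modules of equal finite rank is injective. This gives exactness in
  -- the middle from the rank count `hcard`, so the kernel of `B` never has to be computed.
  have hψinj : Function.Injective ψ := by
    have hrank : Module.finrank ℤ (X → ℤ) = Module.finrank ℤ (N × (Y → ℤ)) := by
      rw [Module.finrank_prod, Module.finrank_pi, Module.finrank_pi, hcard]
    exact OrzechProperty.injective_of_surjective_of_injective
      (LinearEquiv.ofFinrankEq _ _ hrank).toLinearMap ψ (LinearEquiv.injective _) hψsurj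
  have hker : ∀ w, β w = 0 → w = j (δ w) := by
    intro w hw
    refine hψinj (Prod.ext ?_ ?_)
    · exact (hδ _).symm
    · exact hw.trans (hβj _).symm
  let _ : MulAction (L ≃ₐ[k] L) X := MulAction.compHom X r
  have hact : ∀ s, permutationAction (L ≃ₐ[k] L) X s = permutationAction Γ X (r s) := by
    intro s
    ext f x
    rw [permutationAction_apply, permutationAction_apply, ← map_inv]
    rfl
  have hβact : ∀ g w y, β (permutationAction Γ X g w) (g • y) = β w y := by
    intro g w y
    rw [hβ, hβ]
    refine (Fintype.sum_equiv (MulAction.toPerm g) _ _ fun x => ?_).symm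
    rw [MulAction.toPerm_apply, permutationAction_apply, inv_smul_smul, hB]
  refine isStablyRational_of_permutationAction hC j p ⟨?_, ?_⟩ ?_ ?_
  · rintro ⟨n, v⟩ ⟨n', v'⟩ h
    simp only at h
    have h1 := congrArg β h
    rw [map_add, map_add, hβj, hβj, hβp, hβp, zero_add, zero_add] at h1
    subst h1
    have h2 := congrArg δ (add_right_cancel h)
    rw [hδ, hδ] at h2
    rw [h2]
  · intro w
    refine ⟨(δ (w - ∑ y, β w y • p y), β w), ?_⟩
    simp only
    rw [← hker _ (by rw [map_sub, hβp, sub_self]), sub_add_cancel]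
  · intro s n
    ext x
    rw [hact, permutationAction_apply, ← hj (r s), smul_inv_smul]
    rfl
  · intro s y
    -- The preimages `p` are not chosen equivariantly. The defect is killed by `β`, so it lies in
    -- the image of `j`.
    refine ⟨r s • y, δ (permutationAction Γ X (r s) (p y) - p (r s • y)), ?_⟩
    rw [hact, ← hker, add_sub_cancel]
    ext y'
    obtain ⟨y', rfl⟩ := MulAction.surjective (r s) y'
    rw [map_sub, Pi.sub_apply, hβact, hβ, hβ, hpB, hpB]
    simp only [(MulAction.injective (r s)).eq_iff, sub_self, Pi.zero_apply]

end PermutationLattices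

/-! ### Certificates by finite lists. -/

section ListCertificate

variable {k L : Type*} [Field k] [Field L] [Algebra k L]

theorem List.sum_subtype_mem {T : Type*} [DecidableEq T] {xs : List T} (h : xs.Nodup) (f : T → ℤ) :
    ∑ x : {x // x ∈ xs.toFinset}, f x = (xs.map f).sum := by
  rw [Finset.sum_coe_sort xs.toFinset f, List.sum_toFinset f h]

/-- A generator maps the finite list injectively into itself, hence permutes it. Stability therefore
passes to inverses as well as to products. -/
theorem smul_mem_iff_of_closure {Γ T : Type*} [Group Γ] [MulAction Γ T] [DecidableEq T]
    {xs : List T} {S : Set Γ} (hS : Subgroup.closure S = ⊤)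
    (hSx : ∀ g ∈ S, ∀ x ∈ xs, g • x ∈ xs) (g : Γ) : ∀ x, g • x ∈ xs ↔ x ∈ xs := by
  have hg : g ∈ Subgroup.closure S := hS ▸ Subgroup.mem_top g
  induction hg using Subgroup.closure_induction with
  | mem g hg =>
    have himg : xs.toFinset.image (fun x => g • x) = xs.toFinset := by
      refine Finset.eq_of_subset_of_card_le ?_ ?_
      · intro y hy
        obtain ⟨x, hx, rfl⟩ := Finset.mem_image.1 hy
        exact List.mem_toFinset.2 (hSx g hg x (List.mem_toFinset.1 hx))
      · rw [Finset.card_image_of_injective _ (MulAction.injective g)]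
    intro x
    refine ⟨fun hx => ?_, hSx g hg x⟩
    rw [← List.mem_toFinset, ← himg, Finset.mem_image] at hx
    obtain ⟨x', hx', h⟩ := hx
    rw [← MulAction.injective g h]
    exact List.mem_toFinset.1 hx'
  | one => intro x; rw [one_smul]
  | mul g h _ _ h1 h2 => intro x; rw [mul_smul, h1, h2]
  | inv g _ h1 => intro x; rw [← h1, smul_inv_smul]

/-- A finite list that is closed under generators of `Γ`, as a `Γ`-set. -/
@[reducible]
def mulActionList {Γ T : Type*} [Group Γ] [MulAction Γ T] [DecidableEq T] (xs : List T)
    (h : ∀ (g : Γ) x, g • x ∈ xs ↔ x ∈ xs) : MulAction Γ {x // x ∈ xs.toFinset} where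
  smul g x := ⟨g • x.1, List.mem_toFinset.2 ((h g x.1).2 (List.mem_toFinset.1 x.2))⟩
  one_smul x := Subtype.ext (one_smul Γ x.1)
  mul_smul g g' x := Subtype.ext (mul_smul g g' x.1)

/-- The product of two tori whose character lattices form the kernel of an equivariant surjection
`B` of permutation lattices is stably rational.  All conditions are imposed on generators of the
group and on representatives of the orbits. -/
theorem isStablyRational_tensor_of_lists [FiniteDimensional k L] [IsGalois k L]
    {A A' : Type*} [CommRing A] [Algebra k A] [CommRing A'] [Algebra k A']
    {Γ T U : Type*} [Group Γ] [MulAction Γ T] [MulAction Γ U] [DecidableEq T] [DecidableEq U] {n : ℕ}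
    (D D' : Γ →* (GL (Fin n) ℤ)ᵐᵒᵖ) (r : (L ≃ₐ[k] L) →* Γ)
    (hA : IsSplitWith k L A (rowAction (D.comp r)))
    (hA' : IsSplitWith k L A' (rowAction (D'.comp r)))
    (xs : List T) (ys : List U) (B : T → U → ℤ) (β β' γ γ' : T → Fin n → ℤ)
    (hxs : xs.Nodup) (hys : ys.Nodup) (hlen : n + n + ys.length = xs.length)
    (S : Set Γ) (hS : Subgroup.closure S = ⊤)
    (hSx : ∀ g ∈ S, ∀ x ∈ xs, g • x ∈ xs) (hSy : ∀ g ∈ S, ∀ y ∈ ys, g • y ∈ ys)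
    (hSB : ∀ g ∈ S, ∀ x ∈ xs, ∀ y ∈ ys, B (g • x) (g • y) = B x y)
    (hSβ : ∀ g ∈ S, ∀ x ∈ xs,
      Matrix.mulVec ((D g).unop : Matrix (Fin n) (Fin n) ℤ) (β (g • x)) = β x)
    (hSβ' : ∀ g ∈ S, ∀ x ∈ xs,
      Matrix.mulVec ((D' g).unop : Matrix (Fin n) (Fin n) ℤ) (β' (g • x)) = β' x)
    (hβγ : ∀ i l, (xs.map fun x => β x i * γ x l).sum = if i = l then 1 else 0)
    (hβγ' : ∀ i l, (xs.map fun x => β x i * γ' x l).sum = 0)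
    (hβ'γ : ∀ i l, (xs.map fun x => β' x i * γ x l).sum = 0)
    (hβ'γ' : ∀ i l, (xs.map fun x => β' x i * γ' x l).sum = if i = l then 1 else 0)
    (reps : List (U × List (T × ℤ)))
    (hβB : ∀ i, ∀ p ∈ reps, (xs.map fun x => β x i * B x p.1).sum = 0)
    (hβB' : ∀ i, ∀ p ∈ reps, (xs.map fun x => β' x i * B x p.1).sum = 0)
    (hrepsx : ∀ p ∈ reps, ∀ c ∈ p.2, c.1 ∈ xs)
    (hreps : ∀ p ∈ reps, ∀ y ∈ ys,
      (p.2.map fun c => c.2 * B c.1 y).sum = if y = p.1 then 1 else 0)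
    (htrans : ∀ y ∈ ys, ∃ p ∈ reps, ∃ g : Γ, g • p.1 = y) :
    IsStablyRational k (A ⊗[k] A') := by
  have hx := smul_mem_iff_of_closure hS hSx
  have hy := smul_mem_iff_of_closure hS hSy
  have hB : ∀ g : Γ, ∀ x ∈ xs, ∀ y ∈ ys, B (g • x) (g • y) = B x y := by
    intro g
    have hg : g ∈ Subgroup.closure S := hS ▸ Subgroup.mem_top g
    induction hg using Subgroup.closure_induction with
    | mem g hg => exact hSB g hg
    | one => intro x _ y _; rw [one_smul, one_smul]
    | mul g h _ _ h1 h2 =>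
      intro x hx' y hy'
      rw [mul_smul, mul_smul, h1 _ ((hx h x).2 hx') _ ((hy h y).2 hy'), h2 x hx' y hy']
    | inv g _ h1 =>
      intro x hx' y hy'
      have := h1 _ ((hx g⁻¹ x).2 hx') _ ((hy g⁻¹ y).2 hy')
      rw [← this, smul_inv_smul, smul_inv_smul]
  have hβeq : ∀ (D : Γ →* (GL (Fin n) ℤ)ᵐᵒᵖ) (β : T → Fin n → ℤ),
      (∀ g ∈ S, ∀ x ∈ xs, Matrix.mulVec ((D g).unop : Matrix (Fin n) (Fin n) ℤ) (β (g • x)) = β x) →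
      ∀ g : Γ, ∀ x ∈ xs,
        Matrix.mulVec ((D g).unop : Matrix (Fin n) (Fin n) ℤ) (β (g • x)) = β x := by
    intro D β hSβ g
    have hg : g ∈ Subgroup.closure S := hS ▸ Subgroup.mem_top g
    induction hg using Subgroup.closure_induction with
    | mem g hg => exact hSβ g hg
    | one => intro x _; rw [one_smul, map_one]; simp
    | mul g h _ _ h1 h2 =>
      intro x hx'
      rw [mul_smul, map_mul, MulOpposite.unop_mul, Units.val_mul, ← Matrix.mulVec_mulVec,
        h1 _ ((hx h x).2 hx'), h2 x hx']
    | inv g _ h1 =>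
      intro x hx'
      have := h1 _ ((hx g⁻¹ x).2 hx')
      rw [smul_inv_smul] at this
      rw [← this, Matrix.mulVec_mulVec, ← Units.val_mul, ← MulOpposite.unop_mul, ← map_mul,
        mul_inv_cancel, map_one]
      simp
  have hβg := hβeq D β hSβ
  have hβg' := hβeq D' β' hSβ'
  let _ := mulActionList xs hx
  let _ := mulActionList ys hy
  let a : Γ →* AddMonoid.End ((Fin n → ℤ) × (Fin n → ℤ)) :=
    { toFun := fun g => AddMonoidHom.prodMap (rowAction D g) (rowAction D' g)
      map_one' := by rw [map_one, map_one]; rfl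
      map_mul' := fun g h => by rw [map_mul, map_mul]; rfl }
  have ha : ∀ g v v', a g (v, v') = (rowAction D g v, rowAction D' g v') := fun _ _ _ => rfl
  let X := {x // x ∈ xs.toFinset}
  let j : (Fin n → ℤ) × (Fin n → ℤ) →+ (X → ℤ) :=
    { toFun := fun v x => v.1 ⬝ᵥ β x + v.2 ⬝ᵥ β' x
      map_zero' := by ext; simp
      map_add' := fun v w => by
        ext; simp only [Prod.fst_add, Prod.snd_add, add_dotProduct, Pi.add_apply]; ring }
  have hjv : ∀ v x, j v x = v.1 ⬝ᵥ β x + v.2 ⬝ᵥ β' x := fun _ _ => rfl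
  let δ : (X → ℤ) →+ (Fin n → ℤ) × (Fin n → ℤ) :=
    { toFun := fun w => (fun l => ∑ x : X, w x * γ x l, fun l => ∑ x : X, w x * γ' x l)
      map_zero' := by ext <;> simp
      map_add' := fun v w => by ext <;> simp [add_mul, Finset.sum_add_distrib] }
  have hlin : ∀ (v : Fin n → ℤ) (b : T → Fin n → ℤ) (c : T → ℤ),
      ∑ x : X, v ⬝ᵥ b x * c x = ∑ i, v i * (xs.map fun x => b x i * c x).sum := by
    intro v b c
    simp only [← List.sum_subtype_mem hxs, dotProduct, Finset.sum_mul, Finset.mul_sum, mul_assoc]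
    rw [Finset.sum_comm]
  have hjg : ∀ g v (x : X), j (a g v) (g • x) = j v x := by
    rintro g ⟨v, v'⟩ x
    have hx' := List.mem_toFinset.1 x.2
    rw [ha, hjv, hjv, ← hβg g x hx', ← hβg' g x hx', Matrix.dotProduct_mulVec,
      Matrix.dotProduct_mulVec]
    rfl
  have hlift : ∀ (ws : List (T × ℤ)), (∀ c ∈ ws, c.1 ∈ xs) → ∀ f : T → ℤ,
      ∑ x : X, (ws.map fun c => if c.1 = x.1 then c.2 else 0).sum * f x.1 =
        (ws.map fun c => c.2 * f c.1).sum := by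
    intro ws hws f
    induction ws with
    | nil => simp
    | cons c ws ih =>
      simp only [List.map_cons, List.sum_cons, add_mul, Finset.sum_add_distrib]
      rw [ih fun c' hc' => hws c' (List.mem_cons_of_mem _ hc')]
      congr 1
      have hc : c.1 ∈ xs.toFinset := List.mem_toFinset.2 (hws c List.mem_cons_self)
      rw [Finset.sum_eq_single (⟨c.1, hc⟩ : X)]
      · simp
      · intro x _ hne
        rw [if_neg fun h => hne (Subtype.ext h.symm), zero_mul]
      · simp
  refine isStablyRational_of_invariant_matrix (k := k) (L := L) a r ?_ (X := X)
    (Y := {y // y ∈ ys.toFinset}) (fun x y => B x y) ?_ j ?_ ?_ δ ?_ ?_ ?_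
  · exact hA.tensor hA' _ fun s v v' => rfl
  · exact fun g x y => hB g x (List.mem_toFinset.1 x.2) y (List.mem_toFinset.1 y.2)
  · exact hjg
  · rintro v ⟨y, hy'⟩
    obtain ⟨p, hp, g, rfl⟩ := htrans y (List.mem_toFinset.1 hy')
    have hp' : p.1 ∈ ys := (hy g p.1).1 (List.mem_toFinset.1 hy')
    -- Writing `v` as a translate by `g` allows the sum to be reindexed, so that the equation is
    -- needed only at the orbit representative `p.1`.
    obtain ⟨v, rfl⟩ : ∃ w, a g w = v := ⟨a g⁻¹ v, by
      change (a g * a g⁻¹) v = v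
      rw [← map_mul, mul_inv_cancel, map_one]; rfl⟩
    have h1 : ∑ x : X, j (a g v) x * B x (g • p.1) = ∑ x : X, j v x * B x p.1 := by
      refine (Fintype.sum_equiv (MulAction.toPerm g) _ _ fun x => ?_).symm
      rw [← hB g x.1 (List.mem_toFinset.1 x.2) p.1 hp', ← hjg]
      rfl
    refine h1.trans ?_
    simp only [hjv, add_mul, Finset.sum_add_distrib]
    rw [hlin v.1 β fun x => B x p.1, hlin v.2 β' fun x => B x p.1]
    simp [hβB _ p hp, hβB' _ p hp]
  · rintro ⟨v, v'⟩
    refine Prod.ext (funext fun l => ?_) (funext fun l => ?_)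
    · change ∑ x : X, (v ⬝ᵥ β x + v' ⬝ᵥ β' x) * γ x l = v l
      simp only [add_mul, Finset.sum_add_distrib]
      rw [hlin v β fun x => γ x l, hlin v' β' fun x => γ x l]
      simp [hβγ, hβ'γ]
    · change ∑ x : X, (v ⬝ᵥ β x + v' ⬝ᵥ β' x) * γ' x l = v' l
      simp only [add_mul, Finset.sum_add_distrib]
      rw [hlin v β fun x => γ' x l, hlin v' β' fun x => γ' x l]
      simp [hβγ', hβ'γ']
  · rintro ⟨y, hy'⟩
    obtain ⟨p, hp, g, rfl⟩ := htrans y (List.mem_toFinset.1 hy')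
    let w : T → ℤ := fun x => (p.2.map fun c => if c.1 = x then c.2 else 0).sum
    -- The preimage of the representative, translated by `g`.
    refine ⟨fun x => w (g⁻¹ • x.1), fun y' => ?_⟩
    obtain ⟨y', rfl⟩ := MulAction.surjective g y'
    have hy'' := List.mem_toFinset.1 y'.2
    have h1 : ∑ x : X, w (g⁻¹ • x.1) * B x (g • y').1 = ∑ x : X, w x * B x y' := by
      refine (Fintype.sum_equiv (MulAction.toPerm g) _ _ fun x => ?_).symm
      have := hB g x.1 (List.mem_toFinset.1 x.2) y' hy''
      rw [← this]
      change _ = w (g⁻¹ • g • x.1) * _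
      rw [inv_smul_smul]
      rfl
    rw [h1, hlift p.2 (hrepsx p hp) fun x => B x y', hreps p hp y' hy'']
    refine if_congr ?_ rfl rfl
    rw [Subtype.ext_iff]
    exact (MulAction.injective g).eq_iff.symm
  · rw [Module.finrank_prod, Module.finrank_pi, Fintype.card_coe, Fintype.card_coe,
      List.toFinset_card_of_nodup hxs, List.toFinset_card_of_nodup hys, Fintype.card_fin, hlen]

end ListCertificate

/-! ### The certificate for `S₅ × C₂`. -/

section FiveLetters

namespace FiveLetters

/-- The orbits of the first permutation lattice. -/
inductive Source
  | arc | pair | point₁ | point₂ | signs | fixed₁ | fixed₂ | point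
  deriving DecidableEq

/-- The orbits of the second permutation lattice. -/
inductive Target
  | cycle | edge | flag | sign₁ | sign₂ | vertex₁ | vertex₂ | sheet
  deriving DecidableEq

/-- A relation on five letters together with three signs; `Perm (Fin 5) × ℤˣ` permutes the letters,
`-1` transposes the relation, and the signs are multiplied by the three quadratic characters. -/
@[ext]
structure Cell (ι : Type) where
  /-- the orbit -/
  tag : ι
  /-- the relation -/
  rel : Fin 5 → Fin 5 → Bool
  /-- the sign on which the signature acts -/
  e : ℤ
  /-- the sign on which the second factor acts -/
  s₁ : ℤ
  /-- the sign on which the product character acts -/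
  s₂ : ℤ

variable {ι κ : Type}

instance [DecidableEq ι] : DecidableEq (Cell ι) := fun _ _ =>
  decidable_of_iff _ Cell.ext_iff.symm

/-- The action on cells in terms of the inverse `τ` of a permutation and of two signs. -/
def Cell.act (τ : Fin 5 → Fin 5) (e s : ℤ) (x : Cell ι) : Cell ι :=
  ⟨x.tag, if s = 1 then fun i j => x.rel (τ i) (τ j) else fun i j => x.rel (τ j) (τ i),
    e * x.e, s * x.s₁, s * e * x.s₂⟩

instance : MulAction (Equiv.Perm (Fin 5) × ℤˣ) (Cell ι) where
  smul g x := x.act (g.1.symm) (Equiv.Perm.sign g.1 : ℤˣ) (g.2 : ℤˣ)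
  one_smul x := by
    change Cell.act _ _ _ x = x
    ext <;> simp [Cell.act, Equiv.Perm.one_def]
  mul_smul g h x := by
    change Cell.act _ _ _ x = Cell.act _ _ _ (Cell.act _ _ _ x)
    rcases Int.units_eq_one_or g.2 with h1 | h1 <;> rcases Int.units_eq_one_or h.2 with h2 | h2 <;>
      ext <;> simp [Cell.act, h1, h2, mul_assoc, Equiv.Perm.mul_def]

theorem smul_def (g : Equiv.Perm (Fin 5) × ℤˣ) (x : Cell ι) :
    g • x = x.act (g.1.symm) (Equiv.Perm.sign g.1 : ℤˣ) (g.2 : ℤˣ) := rfl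

/-- The number of common pairs of the relations of two cells. -/
def overlap (x : Cell ι) (y : Cell κ) : ℤ :=
  ∑ i, ∑ j, if x.rel i j && y.rel i j then 1 else 0

/-- The group reindexes both relations in the same way. When the sign is `-1` both are transposed,
which interchanges the two sums. -/
theorem overlap_smul (g : Equiv.Perm (Fin 5) × ℤˣ) (x : Cell ι) (y : Cell κ) :
    overlap (g • x) (g • y) = overlap x y := by
  simp only [overlap, smul_def, Cell.act]
  rcases Int.units_eq_one_or g.2 with h | h
  · simp only [h, Units.val_one, if_true]
    exact Fintype.sum_equiv g.1.symm _ _ fun i => Fintype.sum_equiv g.1.symm _ _ fun j => rfl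
  · simp only [h, Units.val_neg, Units.val_one, show ((-1 : ℤ) = 1) = False by simp, if_false]
    rw [Finset.sum_comm]
    exact Fintype.sum_equiv g.1.symm _ _ fun i => Fintype.sum_equiv g.1.symm _ _ fun j => rfl

/-- The matrix of the surjection of permutation lattices. -/
def matrix (x : Cell Source) (y : Cell Target) : ℤ :=
  match x.tag, y.tag with
  | .arc, _ => if x.e * y.e = 1 then overlap x y else 0
  | .pair, .cycle => if x.e * y.e = 1 then if overlap x y = 5 then 2 else 1 else 0
  | .pair, _ => if x.e * y.e = 1 then if overlap x y = 0 then 0 else 1 else 0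
  | .point₁, .flag => if x.s₁ * y.s₁ = -1 then overlap x y else 0
  | .point₁, .sign₁ => if x.s₁ * y.s₁ = 1 then 1 else 0
  | .point₁, .vertex₁ => overlap x y
  | .point₂, .flag => if x.s₂ * y.s₂ = -1 then overlap x y else 0
  | .point₂, .sign₂ => if x.s₂ * y.s₂ = 1 then 1 else 0
  | .point₂, .vertex₂ => overlap x y
  | .signs, .flag => if x.e * y.e = 1 then if x.s₁ * y.s₁ = 1 then 1 else 0 else 0
  | .signs, .sign₁ => if x.s₁ * y.s₁ = 1 then -2 else 0
  | .signs, .sign₂ => if x.s₂ * y.s₂ = 1 then -2 else 0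
  | .signs, .sheet => if x.e * y.e = 1 then 1 else 0
  | .fixed₁, .flag => 1
  | .fixed₁, .vertex₁ => 1
  | .fixed₁, .sheet => 1
  | .fixed₁, .sign₂ => -2
  | .fixed₂, .flag => 1
  | .fixed₂, .vertex₂ => 1
  | .fixed₂, .sheet => 1
  | .fixed₂, .sign₁ => -2
  | .point, .cycle => if x.e * y.e = 1 then 1 else 0
  | .point, .edge => if x.e * y.e = 1 then overlap x y else 0
  | .point, .flag => if x.e * y.e = 1 then 1 + 3 * overlap x y else 2 * overlap x y
  | .point, .vertex₁ => 2 * overlap x y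
  | .point, .vertex₂ => 2 * overlap x y
  | .point, .sheet => if x.e * y.e = 1 then 1 else 0
  | _, _ => 0

/-- Entries depend only on the tags, on the overlap, and on products of corresponding signs of the
two cells. In such a product the character occurs twice and cancels. -/
theorem matrix_smul (g : Equiv.Perm (Fin 5) × ℤˣ) (x : Cell Source) (y : Cell Target) :
    matrix (g • x) (g • y) = matrix x y := by
  have hu : ∀ (u : ℤˣ) (a b : ℤ), (u : ℤ) * a * ((u : ℤ) * b) = a * b := by
    intro u a b
    rcases Int.units_eq_one_or u with rfl | rfl <;> simp
  have h1 : (g • x).e * (g • y).e = x.e * y.e := hu _ _ _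
  have h2 : (g • x).s₁ * (g • y).s₁ = x.s₁ * y.s₁ := hu _ _ _
  have h3 : (g • x).s₂ * (g • y).s₂ = x.s₂ * y.s₂ := by
    have := hu (g.2 * Equiv.Perm.sign g.1) x.s₂ y.s₂
    rwa [Units.val_mul] at this
  have h4 : (g • x).tag = x.tag := rfl
  have h5 : (g • y).tag = y.tag := rfl
  simp only [matrix, h1, h2, h3, h4, h5, overlap_smul]

/-- The graph of a map. -/
def graph (σ : Fin 5 → Fin 5) (i j : Fin 5) : Bool := σ i = j

/-- The transposition of the letters 1 and 2. -/
def swapLetters : Fin 5 → Fin 5 := ![0, 2, 1, 3, 4]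

/-- The 5-cycles conjugate to `(0 1 2 3 4)` in the alternating group, up to inversion. -/
def fiveCycles : List (Fin 5 → Fin 5) :=
  [![1, 2, 3, 4, 0], ![1, 3, 0, 4, 2], ![1, 4, 3, 0, 2], ![2, 4, 1, 0, 3], ![2, 4, 3, 1, 0],
    ![3, 2, 4, 1, 0]]

/-- A sign equal to 0, here and below, marks a character that the orbit does not see: multiplication
by a sign leaves it unchanged. -/
def arc (i j : Fin 5) (o : ℤ) : Cell Source := ⟨.arc, fun a b => a = i && b = j, o, 0, 0⟩
-- Symmetrizing the graph identifies a five-cycle with its inverse.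
def pair (σ : Fin 5 → Fin 5) (o : ℤ) : Cell Source :=
  ⟨.pair, fun a b => graph σ a b || graph σ b a, o, 0, 0⟩
def point₁ (i : Fin 5) (s : ℤ) : Cell Source := ⟨.point₁, fun a b => a = i && b = i, 0, s, 0⟩
def point₂ (i : Fin 5) (s : ℤ) : Cell Source := ⟨.point₂, fun a b => a = i && b = i, 0, 0, s⟩
-- The third sign is the product of the other two, matching the character by which it is acted on,
-- so the orbit has four elements.
def signs (o s : ℤ) : Cell Source := ⟨.signs, fun _ _ => false, o, s, o * s⟩
def fixed₁ : Cell Source := ⟨.fixed₁, fun _ _ => false, 0, 0, 0⟩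
def fixed₂ : Cell Source := ⟨.fixed₂, fun _ _ => false, 0, 0, 0⟩
def point (i : Fin 5) (o : ℤ) : Cell Source := ⟨.point, fun a b => a = i && b = i, o, 0, 0⟩

def cycle (σ : Fin 5 → Fin 5) (o : ℤ) : Cell Target := ⟨.cycle, graph σ, o, 0, 0⟩
def edge (i j : Fin 5) (o : ℤ) : Cell Target :=
  ⟨.edge, fun a b => (a = i || a = j) && (b = i || b = j), o, 0, 0⟩
-- Rows and columns correspond to the two values of `s`, because `-1` in the second factor
-- transposes relations.
def flag (i : Fin 5) (o s : ℤ) : Cell Target :=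
  ⟨.flag, if s = 1 then fun a _ => a = i else fun _ b => b = i, o, s, o * s⟩
def sign₁ (s : ℤ) : Cell Target := ⟨.sign₁, fun _ _ => false, 0, s, 0⟩
def sign₂ (s : ℤ) : Cell Target := ⟨.sign₂, fun _ _ => false, 0, 0, s⟩
def vertex₁ (i : Fin 5) : Cell Target := ⟨.vertex₁, fun a b => a = i && b = i, 0, 0, 0⟩
def vertex₂ (i : Fin 5) : Cell Target := ⟨.vertex₂, fun a b => a = i && b = i, 0, 0, 0⟩
def sheet (o : ℤ) : Cell Target := ⟨.sheet, fun _ _ => false, o, 0, 0⟩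

/-- The letters. -/
def letters : List (Fin 5) := [0, 1, 2, 3, 4]

/-- The two signs. -/
def plusMinus : List ℤ := [1, -1]

/-- The basis of the first permutation lattice. -/
def source : List (Cell Source) :=
  (plusMinus.flatMap fun o => letters.flatMap fun i =>
    (letters.filter fun j => j ≠ i).map fun j => arc i j o) ++
  (fiveCycles.flatMap fun σ => [pair σ 1, pair (swapLetters ∘ σ ∘ swapLetters) (-1)]) ++
  (plusMinus.flatMap fun s => letters.map fun i => point₁ i s) ++
  (plusMinus.flatMap fun s => letters.map fun i => point₂ i s) ++
  (plusMinus.flatMap fun o => plusMinus.map fun s => signs o s) ++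
  (plusMinus.flatMap fun o => letters.map fun i => point i o) ++ [fixed₁, fixed₂]

/-- The basis of the second permutation lattice. -/
def target : List (Cell Target) :=
  (fiveCycles.flatMap fun σ => [σ, fun i => (letters.find? fun j => σ j = i).getD 0].flatMap
    fun σ => [cycle σ 1, cycle (swapLetters ∘ σ ∘ swapLetters) (-1)]) ++
  (plusMinus.flatMap fun o => letters.flatMap fun i =>
    (letters.filter fun j => i < j).map fun j => edge i j o) ++
  (plusMinus.flatMap fun o => plusMinus.flatMap fun s => letters.map fun i => flag i o s) ++
  plusMinus.map sign₁ ++ plusMinus.map sign₂ ++ letters.map vertex₁ ++ letters.map vertex₂ ++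
  plusMinus.map sheet

/-- Preimages of representatives of the orbits on the second basis. -/
def lifts : List (Cell Target × List (Cell Source × ℤ)) :=
  [ (cycle ![1, 2, 3, 4, 0] 1,
      [arc 2 1 1, point₁ 2 1, point₁ 1 (-1), point₂ 2 1, point₂ 1 (-1)].map (·, 2) ++ [arc 0
        1 1, arc 2 0 1, arc 2 3 1, arc 2 4 1, arc 3 0 1, arc 3 1 1, arc 3 4 1, arc 4 0 1,
        arc 4 1 1, point₁ 3 1, point₁ 0 (-1), point₂ 3 1, point₂ 0 (-1)].map (·, 1) ++ [arc
        0 2 1, arc 0 3 1, arc 1 2 1, arc 1 3 1, arc 1 4 1, arc 4 2 1, pair ![1, 2, 3, 4, 0]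
        1, point₁ 0 1, point₁ 3 (-1), point₂ 0 1, point₂ 3 (-1)].map (·, -1) ++ [point₁ 1 1,
        point₁ 2 (-1), point₂ 1 1, point₂ 2 (-1)].map (·, -2)),
    (edge 0 1 1,
      [pair ![1, 2, 3, 4, 0] 1, pair ![1, 3, 0, 4, 2] 1, pair ![1, 4, 3, 0, 2] 1, point 0 1,
        point 1 1].map (·, 1) ++ [arc 0 2 1, arc 0 3 1, arc 0 4 1, arc 1 2 1, arc 1 3 1, arc
        1 4 1, arc 2 0 1, arc 2 1 1, arc 2 3 1, arc 2 4 1, arc 3 0 1, arc 3 1 1, arc 3 2 1,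
        arc 3 4 1, arc 4 0 1, arc 4 1 1, arc 4 2 1, arc 4 3 1, point₁ 0 1, point₁ 1 1,
        point₁ 0 (-1), point₁ 1 (-1), point₂ 0 1, point₂ 1 1, point₂ 0 (-1), point₂ 1 (-1),
        signs 1 1, signs 1 (-1)].map (·, -1) ++ [arc 0 1 1, arc 1 0 1].map (·, -2)),
    (flag 0 1 1,
      [point₁ 0 1, point₂ 0 1].map (·, 2) ++ [arc 0 1 1, arc 0 2 1, arc 0 3 1, arc 0 4 1,
        signs 1 1].map (·, 1) ++ [point 0 1].map (·, -1)),
    (sign₁ 1,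
      [point₁ 0 1, point₁ 1 1, point₁ 2 1, point₁ 3 1, point₁ 4 1, signs 1 1, signs (-1)
        1].map (·, 1) ++ [fixed₁].map (·, -1)),
    (sign₂ 1,
      [point₂ 0 1, point₂ 1 1, point₂ 2 1, point₂ 3 1, point₂ 4 1, signs 1 1, signs (-1)
        (-1)].map (·, 1) ++ [fixed₂].map (·, -1)),
    (vertex₁ 0,
      [point 0 1, point 0 (-1), fixed₁].map (·, 1) ++ [arc 0 1 1, arc 0 2 1, arc 0 3 1, arc
        0 4 1, arc 0 1 (-1), arc 0 2 (-1), arc 0 3 (-1), arc 0 4 (-1), point₁ 1 (-1), point₁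
        2 (-1), point₁ 3 (-1), point₁ 4 (-1), signs 1 1, signs 1 (-1), signs (-1) 1, signs
        (-1) (-1)].map (·, -1) ++ [point₂ 0 1, point₂ 0 (-1)].map (·, -2) ++ [point₁ 0
        1].map (·, -4)),
    (vertex₂ 0,
      [point 0 1, point 0 (-1), fixed₂].map (·, 1) ++ [arc 0 1 1, arc 0 2 1, arc 0 3 1, arc
        0 4 1, arc 1 0 (-1), arc 2 0 (-1), arc 3 0 (-1), arc 4 0 (-1), point₂ 1 (-1), point₂
        2 (-1), point₂ 3 (-1), point₂ 4 (-1), signs 1 1, signs 1 (-1), signs (-1) 1, signs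
        (-1) (-1)].map (·, -1) ++ [point₁ 0 1, point₁ 0 (-1)].map (·, -2) ++ [point₂ 0
        1].map (·, -4)),
    (sheet 1,
      [signs (-1) 1, signs (-1) (-1)].map (·, 2) ++ [point 0 1, point 1 1, point 2 1, point
        3 1, point 4 1].map (·, 1) ++ [arc 0 1 1, arc 0 2 1, arc 0 3 1, arc 0 4 1, arc 1 0
        1, arc 1 2 1, arc 1 3 1, arc 1 4 1, arc 2 0 1, arc 2 1 1, arc 2 3 1, arc 2 4 1, arc
        3 0 1, arc 3 1 1, arc 3 2 1, arc 3 4 1, arc 4 0 1, arc 4 1 1, arc 4 2 1, arc 4 3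
        1].map (·, -1) ++ [fixed₁, fixed₂].map (·, -2)) ]

/-- Out-degree minus in-degree. It changes sign under transposition, as the lattice does under `-1`,
and its sum over the five letters is zero. -/
def relDegree (x : Cell Source) (i : Fin 5) : ℤ :=
  ∑ j, ((if x.rel i j then 1 else 0) - if x.rel j i then 1 else 0)

/-- The coordinates of the embedding of the first lattice. -/
def coord (x : Cell Source) (i : Fin 4) : ℤ :=
  match x.tag with
  | .arc => relDegree x i.succ
  | .point₁ => x.s₁ * (if x.rel i.succ i.succ then 4 else -1)
  | _ => 0

/-- The coordinates of the embedding of the second lattice. -/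
def coord' (x : Cell Source) (i : Fin 4) : ℤ :=
  match x.tag with
  | .arc => x.e * relDegree x i.succ
  | .point₂ => x.s₂ * (if x.rel i.succ i.succ then 4 else -1)
  | _ => 0

/-- A left inverse of the embedding, on the first lattice. -/
def retraction (x : Cell Source) (i : Fin 4) : ℤ :=
  match x.tag with
  | .arc => if x.rel i.succ 0 then -2 else 0
  | .point₁ => if x.s₁ = 1 then if x.rel i.succ i.succ then 1 else if x.rel 0 0 then -1 else 0 else 0
  | _ => 0

/-- A left inverse of the embedding, on the second lattice. -/
def retraction' (x : Cell Source) (i : Fin 4) : ℤ :=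
  match x.tag with
  | .arc => if x.rel i.succ 0 then if x.e = 1 then 3 else 2 else 0
  | .point₁ => if x.s₁ = 1 then if x.rel i.succ i.succ then -1 else if x.rel 0 0 then 1 else 0 else 0
  | _ => 0

end FiveLetters
end FiveLetters

section FiveLetters

namespace FiveLetters

/-- The matrix of `(π, s)` on `ℤ⁵ / ℤ(1,1,1,1,1)`, where `s` acts by a sign. -/
def letterMatrix (g : Equiv.Perm (Fin 5) × ℤˣ) : Matrix (Fin 4) (Fin 4) ℤ := Matrix.of fun i j =>
  (g.2 : ℤ) * ((if g.1 i.succ = j.succ then 1 else 0) - if g.1 i.succ = 0 then 1 else 0)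

theorem letterMatrix_one : letterMatrix 1 = 1 := by
  ext i j
  simp [letterMatrix, Matrix.one_apply]

/-- The order is reversed because matrices act on rows. The classes of the five letters sum to zero
in the quotient lattice, so a sum over four basis letters can be completed by the letter 0. -/
theorem letterMatrix_mul (g h : Equiv.Perm (Fin 5) × ℤˣ) :
    letterMatrix (g * h) = letterMatrix h * letterMatrix g := by
  ext i l
  let b : Fin 5 → Fin 5 → ℤ := fun a l => (if g.1 a = l then 1 else 0) - if g.1 a = 0 then 1 else 0
  have hsum : ∑ a, b a l.succ = 0 := by
    simp only [b, Finset.sum_sub_distrib, ← Equiv.eq_symm_apply]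
    simp
  have h1 : ∑ a : Fin 5, ((if h.1 i.succ = a then 1 else 0) - if h.1 i.succ = 0 then 1 else 0) *
      b a l.succ = b (h.1 i.succ) l.succ := by
    simp only [sub_mul, Finset.sum_sub_distrib, ← Finset.mul_sum, hsum, mul_zero, sub_zero]
    simp
  rw [Fin.sum_univ_succ, sub_self, zero_mul, zero_add] at h1
  simp only [letterMatrix, Matrix.mul_apply, Matrix.of_apply, Prod.fst_mul, Prod.snd_mul,
    Equiv.Perm.mul_apply, Units.val_mul]
  change _ * b (h.1 i.succ) l.succ = _
  rw [← h1, Finset.mul_sum]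
  exact Finset.sum_congr rfl fun a _ => by simp only [b]; ring

/-- The lattice `ℤ⁵ / ℤ(1,1,1,1,1)` of `Perm (Fin 5) × ℤˣ`, as an antihomomorphism. -/
def letterRep : Equiv.Perm (Fin 5) × ℤˣ →* (GL (Fin 4) ℤ)ᵐᵒᵖ :=
  (Units.opEquiv : ((Matrix (Fin 4) (Fin 4) ℤ)ᵐᵒᵖ)ˣ ≃* _).toMonoidHom.comp
    (MonoidHom.toHomUnits
      { toFun := fun g => MulOpposite.op (letterMatrix g)
        map_one' := by rw [letterMatrix_one]; rfl
        map_mul' := fun g h => by rw [letterMatrix_mul]; rfl })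

/-- The outer automorphism of `Perm (Fin 5) × ℤˣ` that multiplies the sign by the signature. -/
def signTwist : Equiv.Perm (Fin 5) × ℤˣ →* Equiv.Perm (Fin 5) × ℤˣ where
  toFun g := (g.1, g.2 * Equiv.Perm.sign g.1)
  map_one' := by simp
  map_mul' g h := by
    ext
    · rfl
    · simp only [Prod.snd_mul, Prod.fst_mul, map_mul, mul_mul_mul_comm]

/-- The five-cycle `i ↦ i + 1`. -/
def shift : Equiv.Perm (Fin 5) where
  toFun := ![1, 2, 3, 4, 0]
  invFun := ![4, 0, 1, 2, 3]
  left_inv := by decide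
  right_inv := by decide

/-- The transposition of 1 and 2. -/
def transposition : Equiv.Perm (Fin 5) where
  toFun := ![0, 2, 1, 3, 4]
  invFun := ![0, 2, 1, 3, 4]
  left_inv := by decide
  right_inv := by decide

theorem sign_shift : Equiv.Perm.sign shift = 1 := by decide +kernel
theorem sign_transposition : Equiv.Perm.sign transposition = -1 := by decide +kernel

/-- Generators of `Perm (Fin 5) × ℤˣ`. -/
def generators : Set (Equiv.Perm (Fin 5) × ℤˣ) := {(shift, 1), (transposition, 1), (1, -1)}

theorem closure_shift_transposition : Subgroup.closure {shift, transposition} = ⊤ := by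
  have h1 : shift = finRotate 5 := by decide
  have h2 : transposition = Equiv.swap 1 (shift 1) := by decide
  have h3 := Equiv.Perm.closure_cycle_adjacent_swap (σ := shift) (h1 ▸ isCycle_finRotate)
    (h1 ▸ support_finRotate) 1
  rwa [h2]

theorem closure_generators : Subgroup.closure generators = ⊤ := by
  rw [eq_top_iff]
  have h1 : ∀ π : Equiv.Perm (Fin 5), (π, (1 : ℤˣ)) ∈ Subgroup.closure generators := by
    intro π
    have : Subgroup.closure {shift, transposition} ≤ (Subgroup.closure generators).comap
        (MonoidHom.inl (Equiv.Perm (Fin 5)) ℤˣ) := by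
      rw [Subgroup.closure_le]
      rintro _ (rfl | rfl) <;> exact Subgroup.subset_closure (by simp [generators])
    exact this (closure_shift_transposition ▸ Subgroup.mem_top π)
  rintro ⟨π, s⟩ -
  rcases Int.units_eq_one_or s with rfl | rfl
  · exact h1 π
  · have := mul_mem (h1 π) (Subgroup.subset_closure (by simp [generators]) :
      ((1 : Equiv.Perm (Fin 5)), (-1 : ℤˣ)) ∈ Subgroup.closure generators)
    simpa using this

variable {ι : Type}

/-- This lemma and the next two replace the signature by its value and the inverse permutation by an
explicit tuple, so that the checks on lists are plain evaluation. -/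
theorem shift_smul (x : Cell ι) :
    ((shift, 1) : Equiv.Perm (Fin 5) × ℤˣ) • x = x.act ![4, 0, 1, 2, 3] 1 1 := by
  rw [smul_def, sign_shift]; rfl

theorem transposition_smul (x : Cell ι) :
    ((transposition, 1) : Equiv.Perm (Fin 5) × ℤˣ) • x = x.act ![0, 2, 1, 3, 4] (-1) 1 := by
  rw [smul_def, sign_transposition]; rfl

theorem neg_smul_cell (x : Cell ι) :
    ((1, -1) : Equiv.Perm (Fin 5) × ℤˣ) • x = x.act id 1 (-1) := by
  rw [smul_def, Equiv.Perm.sign_one]; rfl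

set_option maxRecDepth 100000

theorem forall_generators {p : Equiv.Perm (Fin 5) × ℤˣ → Prop} (h1 : p (shift, 1))
    (h2 : p (transposition, 1)) (h3 : p (1, -1)) : ∀ g ∈ generators, p g := by
  rintro _ (rfl | rfl | rfl) <;> assumption

theorem smul_mem_source : ∀ g ∈ generators, ∀ x ∈ source, g • x ∈ source := by
  refine forall_generators ?_ ?_ ?_
  · simp only [shift_smul]; decide +kernel
  · simp only [transposition_smul]; decide +kernel
  · simp only [neg_smul_cell]; decide +kernel

theorem smul_mem_target : ∀ g ∈ generators, ∀ x ∈ target, g • x ∈ target := by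
  refine forall_generators ?_ ?_ ?_
  · simp only [shift_smul]; decide +kernel
  · simp only [transposition_smul]; decide +kernel
  · simp only [neg_smul_cell]; decide +kernel

/-- The dual of `ℤ⁵ / ℤ(1,1,1,1,1)` consists of the vectors of sum zero, of which the last four
coordinates are recorded. An arc from `i` to `j` carries `ε_i - ε_j`, and a signed point carries
`±(5 ε_i - (1,1,1,1,1))`. These assignments are equivariant by construction; `coord'` inserts the
signature. -/
theorem coord_smul : ∀ g ∈ generators, ∀ x ∈ source,
    Matrix.mulVec (letterMatrix g) (coord (g • x)) = coord x := by
  refine forall_generators ?_ ?_ ?_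
  · simp only [shift_smul]; decide +kernel
  · simp only [transposition_smul]; decide +kernel
  · simp only [neg_smul_cell]; decide +kernel

theorem coord_smul' : ∀ g ∈ generators, ∀ x ∈ source,
    Matrix.mulVec (letterMatrix (signTwist g)) (coord' (g • x)) = coord' x := by
  refine forall_generators ?_ ?_ ?_
  · simp only [shift_smul]; decide +kernel
  · simp only [transposition_smul]; decide +kernel
  · simp only [neg_smul_cell]; decide +kernel

end FiveLetters
end FiveLetters

section FiveLetters

namespace FiveLetters

set_option maxRecDepth 100000

theorem source_nodup : source.Nodup := by decide +kernel

theorem target_nodup : target.Nodup := by decide +kernel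

theorem length_target_add : 4 + 4 + target.length = source.length := by decide +kernel

/-- Testing the orbit representatives in `lifts` is enough, since both factors are equivariant. -/
theorem coord_matrix : ∀ i, ∀ p ∈ lifts,
    (source.map fun x => coord x i * matrix x p.1).sum = 0 := by decide +kernel

theorem coord'_matrix : ∀ i, ∀ p ∈ lifts,
    (source.map fun x => coord' x i * matrix x p.1).sum = 0 := by decide +kernel

theorem coord_retraction : ∀ i l,
    (source.map fun x => coord x i * retraction x l).sum = if i = l then 1 else 0 := by
  decide +kernel

theorem coord_retraction' : ∀ i l,
    (source.map fun x => coord x i * retraction' x l).sum = 0 := by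
  decide +kernel

theorem coord'_retraction : ∀ i l,
    (source.map fun x => coord' x i * retraction x l).sum = 0 := by
  decide +kernel

theorem coord'_retraction' : ∀ i l,
    (source.map fun x => coord' x i * retraction' x l).sum = if i = l then 1 else 0 := by
  decide +kernel

theorem mem_source_of_mem_lifts : ∀ p ∈ lifts, ∀ c ∈ p.2, c.1 ∈ source := by decide +kernel

theorem lifts_matrix : ∀ p ∈ lifts, ∀ y ∈ target,
    (p.2.map fun c => c.2 * matrix c.1 y).sum = if y = p.1 then 1 else 0 := by decide +kernel

/-- Short words in the generators already reach every cell from the representative of its orbit. The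
condition on tags restricts the search to the correct orbit. -/
theorem exists_word : ∀ y ∈ target, ∃ p ∈ lifts, p.1.tag = y.tag ∧
    ∃ (a b : Fin 5) (u v w z : Fin 2), (Cell.act ![0, 2, 1, 3, 4] (-1) 1)^[u]
      ((Cell.act ![4, 0, 1, 2, 3] 1 1)^[a] ((Cell.act ![0, 2, 1, 3, 4] (-1) 1)^[v]
      ((Cell.act ![4, 0, 1, 2, 3] 1 1)^[b] ((Cell.act ![0, 2, 1, 3, 4] (-1) 1)^[w]
      ((Cell.act id 1 (-1))^[z] p.1))))) = y := by decide +kernel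

theorem exists_smul_of_mem_target (y : Cell Target) (hy : y ∈ target) :
    ∃ p ∈ lifts, ∃ g : Equiv.Perm (Fin 5) × ℤˣ, g • p.1 = y := by
  obtain ⟨p, hp, -, a, b, u, v, w, z, h⟩ := exists_word y hy
  refine ⟨p, hp, (transposition, 1) ^ (u : ℕ) * (shift, 1) ^ (a : ℕ) *
    (transposition, 1) ^ (v : ℕ) * (shift, 1) ^ (b : ℕ) * (transposition, 1) ^ (w : ℕ) *
    (1, -1) ^ (z : ℕ), ?_⟩
  have key : ∀ (g : Equiv.Perm (Fin 5) × ℤˣ) (f : Cell Target → Cell Target) (n : ℕ) (x),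
      (∀ x, g • x = f x) → g ^ n • x = f^[n] x := by
    intro g f n x hf
    rw [show f = (g • ·) from funext fun x => (hf x).symm, smul_iterate_apply]
  simp only [mul_smul]
  rw [key _ _ z _ neg_smul_cell, key _ _ w _ transposition_smul, key _ _ b _ shift_smul,
    key _ _ v _ transposition_smul, key _ _ a _ shift_smul, key _ _ u _ transposition_smul, h]

end FiveLetters

variable {k L : Type*} [Field k] [Field L] [Algebra k L]

/-- The main case of stable rationality for `S₅ × C₂` and its subgroups. -/
theorem isStablyRational_tensor_letterRep [FiniteDimensional k L] [IsGalois k L]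
    {A A' : Type*} [CommRing A] [Algebra k A] [CommRing A'] [Algebra k A']
    (r : (L ≃ₐ[k] L) →* Equiv.Perm (Fin 5) × ℤˣ)
    (hA : IsSplitWith k L A (rowAction (FiveLetters.letterRep.comp r)))
    (hA' : IsSplitWith k L A'
      (rowAction ((FiveLetters.letterRep.comp FiveLetters.signTwist).comp r))) :
    IsStablyRational k (A ⊗[k] A') :=
  isStablyRational_tensor_of_lists _ _ r hA hA' FiveLetters.source FiveLetters.target
    FiveLetters.matrix FiveLetters.coord FiveLetters.coord' FiveLetters.retraction
    FiveLetters.retraction' FiveLetters.source_nodup FiveLetters.target_nodup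
    FiveLetters.length_target_add FiveLetters.generators FiveLetters.closure_generators
    FiveLetters.smul_mem_source FiveLetters.smul_mem_target
    (fun g _ x _ y _ => FiveLetters.matrix_smul g x y) FiveLetters.coord_smul
    FiveLetters.coord_smul' FiveLetters.coord_retraction FiveLetters.coord_retraction'
    FiveLetters.coord'_retraction FiveLetters.coord'_retraction' FiveLetters.lifts
    FiveLetters.coord_matrix FiveLetters.coord'_matrix FiveLetters.mem_source_of_mem_lifts
    FiveLetters.lifts_matrix FiveLetters.exists_smul_of_mem_target

end FiveLetters

/-! ### The certificate for `C₃ ⋊ C₈`. -/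

section Metacyclic

/-- The group `C₃ ⋊ C₈` in which the generator of `C₈` inverts `C₃`. -/
@[ext]
structure Metacyclic where
  /-- the component in `C₃` -/
  i : ZMod 3
  /-- the component in `C₈` -/
  j : ZMod 8

namespace Metacyclic

instance : DecidableEq Metacyclic := fun _ _ => decidable_of_iff _ Metacyclic.ext_iff.symm

/-- The underlying set of the group is a product. -/
def equivProd : ZMod 3 × ZMod 8 ≃ Metacyclic := ⟨fun p => ⟨p.1, p.2⟩, fun x => (x.i, x.j), fun _ => rfl,
  fun _ => rfl⟩

instance : Fintype Metacyclic := Fintype.ofEquiv _ equivProd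

/-- The action of `C₈` on `C₃`. -/
def parity (j : ZMod 8) : ZMod 3 := if j.val % 2 = 0 then 1 else -1

theorem parity_add : ∀ j l, parity (j + l) = parity j * parity l := by decide

theorem parity_neg : ∀ j, parity (-j) = parity j := by decide

theorem parity_zero : parity 0 = 1 := rfl

instance : Mul Metacyclic := ⟨fun x y => ⟨x.i + parity x.j * y.i, x.j + y.j⟩⟩
instance : One Metacyclic := ⟨⟨0, 0⟩⟩
instance : Inv Metacyclic := ⟨fun x => ⟨-(parity x.j * x.i), -x.j⟩⟩

theorem mul_def (x y : Metacyclic) : x * y = ⟨x.i + parity x.j * y.i, x.j + y.j⟩ := rfl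
theorem one_def : (1 : Metacyclic) = ⟨0, 0⟩ := rfl
theorem inv_def (x : Metacyclic) : x⁻¹ = ⟨-(parity x.j * x.i), -x.j⟩ := rfl

instance : Group Metacyclic :=
  Group.ofLeftAxioms
    (fun x y z => by
      simp only [mul_def, parity_add]
      ext
      · change _ = x.i + parity x.j * (y.i + parity y.j * z.i)
        ring
      · exact add_assoc _ _ _)
    (fun x => by simp [mul_def, one_def, parity_zero])
    (fun x => by simp [mul_def, one_def, inv_def, parity_neg])

/-- The matrix of order 3. -/
def cMat : GL (Fin 4) ℤ where
  val := !![-1, -1, -1, 1; 1, 0, 0, -1; 0, 0, -1, 1; 0, 0, -1, 0]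
  inv := !![0, 1, 1, -1; -1, -1, 0, 1; 0, 0, 0, -1; 0, 0, 1, -1]
  val_inv := by decide
  inv_val := by decide

theorem cMat_pow : cMat ^ 3 = 1 := by
  apply Units.ext
  simp only [pow_succ, pow_zero, one_mul, Units.val_mul, Units.val_one]
  decide

theorem l4_sq_sq : (I4.l4 ^ 2) ^ 2 = -1 := by
  apply Units.ext
  simp only [pow_succ, pow_zero, one_mul, Units.val_mul]
  decide

theorem l4_pow : I4.l4 ^ 8 = 1 := by
  rw [show 8 = 2 * 2 * 2 from rfl, pow_mul, pow_mul, l4_sq_sq, neg_one_sq]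

theorem l4_mul_cMat : I4.l4 * cMat = cMat ^ 2 * I4.l4 := by
  apply Units.ext
  simp only [pow_succ, pow_zero, one_mul, Units.val_mul]
  decide

/-- Consequently `λ₁` and `λ₄` generate the same group as `cMat` and `λ₄`, which satisfy the
standard relations of `C₃ ⋊ C₈`. -/
theorem l1_eq : I4.l1 = cMat * I4.l4 ^ 2 := by
  apply Units.ext
  simp only [pow_succ, pow_zero, one_mul, Units.val_mul]
  decide

/-- Conjugation by `λ₄` squares `cMat`, so passing `λ₄ ^ n` multiplies the exponent by `2 ^ n`. This
rule makes the normal form multiplicative in `rep`. -/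
theorem pow_mul_pow (n m : ℕ) : I4.l4 ^ n * cMat ^ m = cMat ^ (2 ^ n * m) * I4.l4 ^ n := by
  have h1 : ∀ m, I4.l4 * cMat ^ m = cMat ^ (2 * m) * I4.l4 := by
    intro m
    induction m with
    | zero => simp
    | succ m ih =>
      rw [pow_succ, ← mul_assoc, ih, mul_assoc, l4_mul_cMat, ← mul_assoc, ← pow_add, mul_add]
  induction n generalizing m with
  | zero => simp
  | succ n ih =>
    rw [pow_succ, mul_assoc, h1, ← mul_assoc, ih, mul_assoc, pow_succ (2 : ℕ), mul_assoc]

theorem pow_val_add {G : Type*} [Group G] {n : ℕ} [NeZero n] {x : G} (hx : x ^ n = 1)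
    (a b : ZMod n) : x ^ (a + b).val = x ^ a.val * x ^ b.val := by
  rw [ZMod.val_add, ← pow_add, ← pow_mod_orderOf, ← pow_mod_orderOf (n := a.val + b.val),
    Nat.mod_mod_of_dvd _ (orderOf_dvd_of_pow_eq_one hx)]

/-- The faithful representation of `C₃ ⋊ C₈` with image `⟨λ₁, λ₄⟩`. -/
def rep : Metacyclic →* GL (Fin 4) ℤ :=
  MonoidHom.mk' (fun x => cMat ^ x.i.val * I4.l4 ^ x.j.val) fun x y => by
    have h1 : ∀ (j : ZMod 8) (i : ZMod 3), (parity j * i).val = (2 ^ j.val * i.val) % 3 := by decide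
    have h2 : cMat ^ (parity x.j * y.i).val = cMat ^ (2 ^ x.j.val * y.i.val) := by
      rw [h1, ← pow_mod_orderOf, Nat.mod_mod_of_dvd _ (orderOf_dvd_of_pow_eq_one cMat_pow),
        pow_mod_orderOf]
    rw [mul_def]
    simp only
    rw [pow_val_add cMat_pow, pow_val_add l4_pow, h2]
    simp only [mul_assoc]
    rw [← mul_assoc (I4.l4 ^ x.j.val) (cMat ^ y.i.val), pow_mul_pow]
    simp only [mul_assoc]

theorem rep_apply (x : Metacyclic) : rep x = cMat ^ x.i.val * I4.l4 ^ x.j.val := rfl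

/-- The quadratic character of `C₃ ⋊ C₈`. -/
def quadratic : Metacyclic →* ℤˣ :=
  MonoidHom.mk' (fun x => if x.j.val % 2 = 0 then 1 else -1) fun x y => by
    have : ∀ j l : ZMod 8, (if (j + l).val % 2 = 0 then (1 : ℤˣ) else -1) =
        (if j.val % 2 = 0 then 1 else -1) * if l.val % 2 = 0 then 1 else -1 := by decide
    exact this x.j y.j

/-- The twist of the representation by the quadratic character. -/
def twistedRep : Metacyclic →* GL (Fin 4) ℤ :=
  MonoidHom.mk' (fun x => Units.map (algebraMap ℤ (Matrix (Fin 4) (Fin 4) ℤ)).toMonoidHom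
      (quadratic x) * rep x) fun x y => by
    have h : ∀ (u : ℤˣ) (M : GL (Fin 4) ℤ),
        M * Units.map (algebraMap ℤ (Matrix (Fin 4) (Fin 4) ℤ)).toMonoidHom u =
          Units.map (algebraMap ℤ (Matrix (Fin 4) (Fin 4) ℤ)).toMonoidHom u * M :=
      fun u M => Units.ext (Algebra.commutes _ _).symm
    rw [map_mul, map_mul, map_mul, mul_assoc, mul_assoc, ← mul_assoc (rep x), h, mul_assoc]

/-- The antihomomorphism attached to a homomorphism. -/
def antiHom {K H : Type*} [Group K] [Group H] (f : K →* H) : K →* Hᵐᵒᵖ :=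
  (MonoidHom.op f).comp (MulEquiv.inv' K).toMonoidHom

theorem antiHom_apply {K H : Type*} [Group K] [Group H] (f : K →* H) (x : K) :
    (antiHom f x).unop = f x⁻¹ := rfl

/-- Points and cosets of `C₃ ⋊ C₈`: the first component is translated if `w = 1` and fixed if
`w = 0`, and the second one is translated by `q` times the element of `C₈`. -/
@[ext]
structure Coset where
  /-- the component in `C₃` -/
  a : ZMod 3
  /-- the speed of the first component -/
  w : ZMod 3
  /-- the component in `C₈` -/
  j : ZMod 8
  /-- the speed of the second component -/
  q : ZMod 8

instance : DecidableEq Coset := fun _ _ => decidable_of_iff _ Coset.ext_iff.symm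

instance : MulAction Metacyclic Coset where
  smul x t := ⟨t.w * x.i + parity x.j * t.a, t.w, t.q * x.j + t.j, t.q⟩
  one_smul t := by
    change (⟨t.w * 0 + parity 0 * t.a, t.w, t.q * 0 + t.j, t.q⟩ : Coset) = t
    simp [parity_zero]
  mul_smul x y t := by
    change (⟨t.w * (x.i + parity x.j * y.i) + parity (x.j + y.j) * t.a, t.w,
      t.q * (x.j + y.j) + t.j, t.q⟩ : Coset) =
      ⟨t.w * x.i + parity x.j * (t.w * y.i + parity y.j * t.a), t.w,
        t.q * x.j + (t.q * y.j + t.j), t.q⟩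
    rw [parity_add]
    ext <;> simp only <;> ring

/-- Generators of `C₃ ⋊ C₈`. -/
def generators : Set Metacyclic := {⟨1, 0⟩, ⟨0, 1⟩}

theorem closure_generators : Subgroup.closure generators = ⊤ := by
  rw [eq_top_iff]
  rintro ⟨i, j⟩ -
  have h : (⟨i, j⟩ : Metacyclic) = ⟨1, 0⟩ ^ i.val * ⟨0, 1⟩ ^ j.val := by
    revert i j; decide
  rw [h]
  exact mul_mem (pow_mem (Subgroup.subset_closure (by simp [generators])) _)
    (pow_mem (Subgroup.subset_closure (by simp [generators])) _)

/-- The matrix of the surjection of permutation lattices. -/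
def matrix (x y : Coset) : ℤ :=
  if x.w = 1 then if y.q * x.j = y.j ∧ (y.w = 0 ∨ x.a = y.a) then 1 else 0
  else if y.q = 1 then if x.j = 2 * y.j then 1 else 0
  else if x.j = y.j then 1 else 0

/-- The elements of `C₈`. -/
def octic : List (ZMod 8) := [0, 1, 2, 3, 4, 5, 6, 7]

/-- The basis of the first permutation lattice. -/
def source : List Coset :=
  ([0, 1, 2].flatMap fun a => octic.map fun j => ⟨a, 1, j, 1⟩) ++
    [0, 2, 4, 6].map fun j => ⟨0, 0, j, 2⟩

/-- The basis of the second permutation lattice. -/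
def target : List Coset :=
  (octic.map fun j => ⟨0, 0, j, 1⟩) ++
    [0, 1, 2].flatMap fun a => [0, 2, 4, 6].map fun j => ⟨a, 1, j, 2⟩

/-- Preimages of representatives of the orbits on the second basis. -/
def lifts : List (Coset × List (Coset × ℤ)) :=
  [(⟨0, 0, 0, 1⟩, [(⟨0, 1, 0, 1⟩, 1), (⟨1, 1, 0, 1⟩, 1), (⟨2, 1, 4, 1⟩, 1), (⟨0, 0, 0, 2⟩, -1)]),
    (⟨0, 1, 0, 2⟩, [(⟨1, 1, 0, 1⟩, -1), (⟨2, 1, 4, 1⟩, -1), (⟨0, 0, 0, 2⟩, 1)])]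

/-- The orbit of the first dual basis vector. -/
def dualOrbit : Fin 3 → Fin 8 → Fin 4 → ℤ :=
  ![![![1, 0, 0, 0], ![0, -1, 1, 0], ![-1, 0, 0, -1], ![0, 1, 1, 1], ![-1, 0, 0, 0], ![0, 1, -1,
      0], ![1, 0, 0, 1], ![0, -1, -1, -1]],
    ![![-1, 1, 0, 0], ![0, 0, -1, -1], ![0, 0, -1, 0], ![-1, -1, 0, -1], ![1, -1, 0, 0], ![0, 0,
      1, 1], ![0, 0, 1, 0], ![1, 1, 0, 1]],
    ![![0, -1, 0, 0], ![0, 1, 0, 1], ![1, 0, 1, 1], ![1, 0, -1, 0], ![0, 1, 0, 0], ![0, -1, 0,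
      -1], ![-1, 0, -1, -1], ![-1, 0, 1, 0]]]

/-- The orbit of the second dual basis vector under the twisted representation. -/
def dualOrbit' : Fin 3 → Fin 8 → Fin 4 → ℤ :=
  ![![![0, 1, 0, 0], ![0, 0, -1, -1], ![-1, 0, -1, -1], ![-1, -1, 0, -1], ![0, -1, 0, 0], ![0,
      0, 1, 1], ![1, 0, 1, 1], ![1, 1, 0, 1]],
    ![![-1, 0, 0, 0], ![0, 1, 0, 1], ![1, 0, 0, 1], ![1, 0, -1, 0], ![1, 0, 0, 0], ![0, -1, 0,
      -1], ![-1, 0, 0, -1], ![-1, 0, 1, 0]],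
    ![![1, -1, 0, 0], ![0, -1, 1, 0], ![0, 0, 1, 0], ![0, 1, 1, 1], ![-1, 1, 0, 0], ![0, 1, -1,
      0], ![0, 0, -1, 0], ![0, -1, -1, -1]]]

/-- The coordinates of the embedding of the first lattice. -/
def coord (x : Coset) : Fin 4 → ℤ := if x.w = 1 then dualOrbit x.a x.j else 0

/-- The coordinates of the embedding of the second lattice. -/
def coord' (x : Coset) : Fin 4 → ℤ := if x.w = 1 then dualOrbit' x.a x.j else 0

/-- The value at `x` of a function given by a list. -/
def lookup (l : List (Coset × (Fin 4 → ℤ))) (x : Coset) : Fin 4 → ℤ :=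
  ((l.find? fun p => p.1 = x).map Prod.snd).getD 0

/-- A left inverse of the embedding, on the first lattice. -/
def retraction : Coset → Fin 4 → ℤ := lookup
  [(⟨2, 1, 1, 1⟩, ![0, 1, 0, -1]), (⟨1, 1, 5, 1⟩, ![-1, -1, -1, 2]), (⟨0, 1, 7, 1⟩, ![-1, 0, 0,
    0]), (⟨2, 1, 2, 1⟩, ![0, 0, 1, 0]), (⟨0, 1, 4, 1⟩, ![0, -1, 0, 0]), (⟨2, 1, 7, 1⟩, ![0, 1,
    1, -1]), (⟨1, 1, 6, 1⟩, ![0, 0, 0, -1]), (⟨1, 1, 4, 1⟩, ![1, 0, 0, -1])]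

/-- A left inverse of the embedding, on the second lattice. -/
def retraction' : Coset → Fin 4 → ℤ := lookup
  [(⟨2, 1, 1, 1⟩, ![1, 0, 1, -1]), (⟨1, 1, 5, 1⟩, ![0, 1, 0, -1]), (⟨0, 1, 7, 1⟩, ![1, 1, 1,
    -1]), (⟨2, 1, 2, 1⟩, ![0, 0, 0, 1]), (⟨0, 1, 4, 1⟩, ![-1, -1, 0, 1]), (⟨2, 1, 7, 1⟩, ![1, 0,
    0, 0]), (⟨1, 1, 6, 1⟩, ![0, 0, 1, -1]), (⟨1, 1, 4, 1⟩, ![0, -1, 0, 0])]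

end Metacyclic
end Metacyclic

section Metacyclic

namespace Metacyclic

theorem rep_c : rep ⟨1, 0⟩ = cMat := by
  rw [rep_apply]
  change cMat ^ 1 * I4.l4 ^ 0 = cMat
  simp

theorem rep_b : rep ⟨0, 1⟩ = I4.l4 := by
  rw [rep_apply]
  change cMat ^ 0 * I4.l4 ^ 1 = I4.l4
  simp

theorem twistedRep_apply (x : Metacyclic) : twistedRep x =
    Units.map (algebraMap ℤ (Matrix (Fin 4) (Fin 4) ℤ)).toMonoidHom (quadratic x) * rep x := rfl

theorem twistedRep_of_even {x : Metacyclic} (h : quadratic x = 1) : twistedRep x = rep x := by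
  rw [twistedRep_apply, h, map_one, one_mul]

theorem twistedRep_of_odd {x : Metacyclic} (h : quadratic x = -1) : twistedRep x = -rep x := by
  rw [twistedRep_apply, h]
  apply Units.ext
  change algebraMap ℤ (Matrix (Fin 4) (Fin 4) ℤ) (-1) * (rep x : Matrix (Fin 4) (Fin 4) ℤ) =
    -(rep x : Matrix (Fin 4) (Fin 4) ℤ)
  rw [map_neg, map_one, neg_one_mul]

theorem forall_generators {p : Metacyclic → Prop} (h1 : p ⟨1, 0⟩) (h2 : p ⟨0, 1⟩) :
    ∀ g ∈ generators, p g := by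
  rintro _ (rfl | rfl) <;> assumption

set_option maxRecDepth 100000

theorem coord_smul : ∀ g ∈ generators, ∀ x ∈ source, Matrix.mulVec
    ((antiHom rep g).unop : Matrix (Fin 4) (Fin 4) ℤ) (coord (g • x)) = coord x := by
  -- The matrices of the two generators are replaced by literal inverses, so that the remaining
  -- check is arithmetic.
  have h1 : ((antiHom rep ⟨1, 0⟩).unop : Matrix (Fin 4) (Fin 4) ℤ) = cMat.inv := by
    rw [antiHom_apply, map_inv, rep_c]; rfl
  have h2 : ((antiHom rep ⟨0, 1⟩).unop : Matrix (Fin 4) (Fin 4) ℤ) = I4.l4.inv := by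
    rw [antiHom_apply, map_inv, rep_b]; rfl
  refine forall_generators ?_ ?_
  · rw [h1]; decide +kernel
  · rw [h2]; decide +kernel

theorem coord'_smul : ∀ g ∈ generators, ∀ x ∈ source, Matrix.mulVec
    ((antiHom twistedRep g).unop : Matrix (Fin 4) (Fin 4) ℤ) (coord' (g • x)) = coord' x := by
  have h1 : ((antiHom twistedRep ⟨1, 0⟩).unop : Matrix (Fin 4) (Fin 4) ℤ) = cMat.inv := by
    rw [antiHom_apply, map_inv, twistedRep_of_even (by decide), rep_c]; rfl
  have h2 : ((antiHom twistedRep ⟨0, 1⟩).unop : Matrix (Fin 4) (Fin 4) ℤ) = -I4.l4.inv := by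
    rw [antiHom_apply, map_inv, twistedRep_of_odd (by decide), rep_b]; rfl
  refine forall_generators ?_ ?_
  · rw [h1]; decide +kernel
  · rw [h2]; decide +kernel

variable {k L : Type*} [Field k] [Field L] [Algebra k L]

/-- The main case of stable rationality for `C₃ ⋊ C₈`. -/
theorem isStablyRational_tensor_rep [FiniteDimensional k L] [IsGalois k L]
    {A A' : Type*} [CommRing A] [Algebra k A] [CommRing A'] [Algebra k A']
    (r : (L ≃ₐ[k] L) →* Metacyclic)
    (hA : IsSplitWith k L A (rowAction ((antiHom rep).comp r)))
    (hA' : IsSplitWith k L A' (rowAction ((antiHom twistedRep).comp r))) :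
    IsStablyRational k (A ⊗[k] A') :=
  isStablyRational_tensor_of_lists _ _ r hA hA' source target matrix coord coord' retraction
    retraction' (by decide +kernel) (by decide +kernel) (by decide +kernel) generators
    closure_generators (forall_generators (by decide +kernel) (by decide +kernel))
    (forall_generators (by decide +kernel) (by decide +kernel))
    (forall_generators (by decide +kernel) (by decide +kernel)) coord_smul coord'_smul
    (by decide +kernel) (by decide +kernel) (by decide +kernel) (by decide +kernel) lifts
    (by decide +kernel) (by decide +kernel) (by decide +kernel) (by decide +kernel)
    (by decide +kernel)

end Metacyclic
end Metacyclic

/-! ### Conjugate subgroups and identifications of the Galois group. -/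

section Parametrization

variable {K : Type*} [Group K] {n : ℕ}

/-- A conjugate of the image of a faithful representation is isomorphic to the source. -/
theorem IsConjSubgroup.exists_mulEquiv {P : K →* GL (Fin n) ℤ} (hP : Function.Injective P)
    {G : Subgroup (GL (Fin n) ℤ)} (hG : IsConjSubgroup G P.range) :
    ∃ (x : GL (Fin n) ℤ) (ψ : K ≃* G), ∀ g, (ψ g : GL (Fin n) ℤ) = x * P g * x⁻¹ := by
  obtain ⟨x, rfl⟩ := hG
  let f : K →* GL (Fin n) ℤ := (MulAut.conj x).toMonoidHom.comp P
  have hf : Function.Injective f := (MulAut.conj x).injective.comp hP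
  have hr : f.range = P.range.map (MulAut.conj x).toMonoidHom := MonoidHom.range_comp _ _
  exact ⟨x, (MonoidHom.ofInjective hf).trans (MulEquiv.subgroupCongr hr), fun g => rfl⟩

/-- The isomorphism between the Galois group and a group isomorphic to `G`. -/
def galoisParam {Γ : Type*} [Group Γ] {G : Subgroup (GL (Fin n) ℤ)} (φ : Γ ≃* (G)ᵐᵒᵖ)
    (ψ : K ≃* G) : Γ ≃* K :=
  (φ.trans (MulEquiv.op ψ.symm)).trans (MulEquiv.inv' K).symm

/-- The inverse appears because `φ` takes values in the opposite group, whereas `galoisParam`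
preserves the order of products. -/
theorem galoisParam_spec {Γ : Type*} [Group Γ] {G : Subgroup (GL (Fin n) ℤ)} (φ : Γ ≃* (G)ᵐᵒᵖ)
    (ψ : K ≃* G) (s : Γ) : (φ s).unop = ψ (galoisParam φ ψ s)⁻¹ := by
  change (φ s).unop = ψ ((ψ.symm (φ s).unop)⁻¹)⁻¹
  rw [inv_inv, MulEquiv.apply_symm_apply]

/-- Conjugation by `y` is a change of basis of the lattice. A representation may thus be replaced by
any integral conjugate without changing the torus. -/
theorem HasCharacterModule.isSplitWith_of_conj {k L : Type*} [Field k] [Field L] [Algebra k L]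
    {A : Type*} [CommRing A] [HopfAlgebra k A] {G : Subgroup (GL (Fin n) ℤ)}
    {φ : (L ≃ₐ[k] L) ≃* (G)ᵐᵒᵖ} (h : HasCharacterModule k L A G φ)
    (D : (L ≃ₐ[k] L) →* (GL (Fin n) ℤ)ᵐᵒᵖ) (y : GL (Fin n) ℤ)
    (hy : ∀ s, ((φ s).unop : GL (Fin n) ℤ) = y * (D s).unop * y⁻¹) :
    IsSplitWith k L A (rowAction D) := by
  let e : (Fin n → ℤ) ≃+ (Fin n → ℤ) :=
    { toFun := fun v => Matrix.vecMul v ((y⁻¹ : GL (Fin n) ℤ) : Matrix (Fin n) (Fin n) ℤ)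
      invFun := fun v => Matrix.vecMul v (y : Matrix (Fin n) (Fin n) ℤ)
      left_inv := fun v => by
        simp only
        rw [Matrix.vecMul_vecMul, ← Units.val_mul, inv_mul_cancel, Units.val_one, Matrix.vecMul_one]
      right_inv := fun v => by
        simp only
        rw [Matrix.vecMul_vecMul, ← Units.val_mul, mul_inv_cancel, Units.val_one, Matrix.vecMul_one]
      map_add' := fun v w => Matrix.add_vecMul _ _ _ }
  have he : ∀ v, e v = Matrix.vecMul v ((y⁻¹ : GL (Fin n) ℤ) : Matrix (Fin n) (Fin n) ℤ) :=
    fun _ => rfl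
  refine (isSplitWith_of_hasCharacterModule h).congr e fun s v => ?_
  rw [he, he, rowAction_apply, rowAction_apply, galoisRep_apply, hy, Matrix.vecMul_vecMul,
    Matrix.vecMul_vecMul, ← Units.val_mul, ← Units.val_mul, ← mul_assoc, ← mul_assoc,
    inv_mul_cancel, one_mul]

theorem innerAut_index_congr {K K' : Type*} [Group K] [Group K'] (e : K ≃* K') :
    (innerAut K').index = (innerAut K).index := by
  have h : (innerAut K').comap (MulAut.congr e).toMonoidHom = innerAut K := by
    ext σ
    constructor
    · rintro ⟨x, hx⟩
      refine ⟨e.symm x, MulEquiv.ext fun g => ?_⟩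
      have h1 := DFunLike.congr_fun hx (e g)
      change x * e g * x⁻¹ = e (σ (e.symm (e g))) at h1
      rw [MulEquiv.symm_apply_apply] at h1
      apply e.injective
      rw [← h1]
      simp
    · rintro ⟨x, rfl⟩
      refine ⟨e x, MulEquiv.ext fun g => ?_⟩
      change e x * g * (e x)⁻¹ = e (x * e.symm g * x⁻¹)
      simp
  rw [← h]
  exact (Subgroup.index_comap_of_surjective _ (MulAut.congr e).surjective).symm

theorem mem_innerAut_congr {K K' : Type*} [Group K] [Group K'] (e : K ≃* K') {σ : MulAut K'}
    (h : MulAut.congr e.symm σ ∈ innerAut K) : σ ∈ innerAut K' := by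
  obtain ⟨x, hx⟩ := h
  refine ⟨e x, MulEquiv.ext fun g => ?_⟩
  have h1 := DFunLike.congr_fun hx (e.symm g)
  change x * e.symm g * x⁻¹ = e.symm (σ (e (e.symm g))) at h1
  rw [MulEquiv.apply_symm_apply, MulEquiv.eq_symm_apply] at h1
  rw [← h1]
  simp

end Parametrization

/-! ### Automorphisms of `H × {±1}`. -/

section SignExtension

variable {H : Type*} [Group H]

/-- The automorphism `(g, s) ↦ (g, s ε(g))` of `H × {±1}`. -/
def characterTwist (ε : H →* ℤˣ) : MulAut (H × ℤˣ) where
  toFun x := (x.1, x.2 * ε x.1)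
  invFun x := (x.1, x.2 * ε x.1)
  left_inv x := by simp [mul_assoc, Int.units_mul_self]
  right_inv x := by simp [mul_assoc, Int.units_mul_self]
  map_mul' x y := by
    ext1
    · rfl
    · simp only [Prod.fst_mul, Prod.snd_mul, map_mul]
      exact mul_mul_mul_comm _ _ _ _

theorem characterTwist_apply (ε : H →* ℤˣ) (x : H × ℤˣ) :
    characterTwist ε x = (x.1, x.2 * ε x.1) := rfl

theorem characterTwist_mul_self (ε : H →* ℤˣ) : characterTwist ε * characterTwist ε = 1 := by
  ext1 x
  rw [MulAut.mul_apply, characterTwist_apply, characterTwist_apply, mul_assoc,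
    Int.units_mul_self, mul_one]
  rfl

/-- The second factor is commutative, so an inner automorphism leaves second components unchanged,
while the twist multiplies them by `ε`. -/
theorem characterTwist_notMem_innerAut {ε : H →* ℤˣ} (hε : ε ≠ 1) :
    characterTwist ε ∉ innerAut (H × ℤˣ) := by
  rintro ⟨x, hx⟩
  refine hε (MonoidHom.ext fun g => ?_)
  have h := congrArg Prod.snd (DFunLike.congr_fun hx (g, 1))
  change x.2 * 1 * x.2⁻¹ = 1 * ε g at h
  rw [mul_one, mul_inv_cancel, one_mul] at h
  exact h.symm

/-- If all automorphisms of the centreless finite group `H` are inner and if `H` has no quadratic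
characters besides `1` and `ε`, then up to inner automorphisms `H × {±1}` has no automorphisms
besides `1` and the twist by `ε`. -/
theorem MulAut.mem_innerAut_or_mul_characterTwist [Finite H] {ε : H →* ℤˣ}
    (haut : ∀ σ : MulAut H, σ ∈ innerAut H) (hchar : ∀ χ : H →* ℤˣ, χ = 1 ∨ χ = ε)
    (hcenter : ∀ z : H, (∀ g, z * g = g * z) → z = 1) (σ : MulAut (H × ℤˣ)) :
    σ ∈ innerAut (H × ℤˣ) ∨ σ * characterTwist ε ∈ innerAut (H × ℤˣ) := by
  -- The element `(1, -1)` is central, so its image is central too. As `H` has trivial centre, the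
  -- first component of the image is 1, and the second cannot be 1 by injectivity.
  have h1 : σ (1, -1) = (1, -1) := by
    have hz : (σ (1, -1)).1 = 1 := by
      refine hcenter _ fun g => ?_
      have h2 : σ ((1, -1) * σ.symm (g, 1)) = σ (σ.symm (g, 1) * (1, -1)) := by
        congr 1
        ext1
        · simp
        · exact mul_comm _ _
      rw [map_mul, map_mul, MulEquiv.apply_symm_apply] at h2
      exact congrArg Prod.fst h2
    rcases Int.units_eq_one_or (σ (1, -1)).2 with h2 | h2
    · have h3 : σ (1, -1) = σ 1 := by
        rw [map_one]; exact Prod.ext hz h2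
      have h4 : (-1 : ℤˣ) = 1 := congrArg Prod.snd (σ.injective h3)
      exact absurd h4 (by decide)
    · exact Prod.ext hz h2
  have h1' : ∀ s : ℤˣ, σ (1, s) = (1, s) := by
    intro s
    rcases Int.units_eq_one_or s with rfl | rfl
    · exact map_one σ
    · exact h1
  -- On `H` the automorphism consists of an endomorphism `p` and a character `χ`. If `p g = 1`, then
  -- `(g, 1)` has the same image as `(1, χ g)`, so `p` is injective and, by finiteness, bijective.
  let p : H →* H := (MonoidHom.fst H ℤˣ).comp (σ.toMonoidHom.comp (MonoidHom.inl H ℤˣ))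
  let χ : H →* ℤˣ := (MonoidHom.snd H ℤˣ).comp (σ.toMonoidHom.comp (MonoidHom.inl H ℤˣ))
  have hp : Function.Injective p := by
    rw [injective_iff_map_eq_one]
    intro g hg
    have h2 : σ (g, 1) = σ (1, χ g) := by
      rw [h1']; exact Prod.ext hg rfl
    exact congrArg Prod.fst (σ.injective h2)
  obtain ⟨h, hh⟩ := haut (MulEquiv.ofBijective p ⟨hp, Finite.surjective_of_injective hp⟩)
  have hh' : ∀ g, p g = h * g * h⁻¹ := fun g => (DFunLike.congr_fun hh g).symm
  have key : ∀ x : H × ℤˣ, σ x = (h * x.1 * h⁻¹, x.2 * χ x.1) := by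
    intro x
    have h2 : x = (1, x.2) * (x.1, 1) := by ext1 <;> simp
    conv_lhs => rw [h2, map_mul, h1']
    ext1
    · change 1 * p x.1 = _
      rw [one_mul, hh']
    · rfl
  rcases hchar χ with hχ | hχ
  · left
    refine ⟨(h, 1), MulEquiv.ext fun x => ?_⟩
    rw [key, hχ]
    ext1
    · rfl
    · change 1 * x.2 * 1⁻¹ = x.2 * 1
      simp
  · right
    refine ⟨(h, 1), MulEquiv.ext fun x => ?_⟩
    rw [MulAut.mul_apply, key, hχ, characterTwist_apply, mul_assoc x.2, Int.units_mul_self]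
    ext1
    · rfl
    · change 1 * x.2 * 1⁻¹ = x.2 * 1
      simp

theorem innerAut_prod_units_index [Finite H] {ε : H →* ℤˣ} (hε : ε ≠ 1)
    (haut : ∀ σ : MulAut H, σ ∈ innerAut H) (hchar : ∀ χ : H →* ℤˣ, χ = 1 ∨ χ = ε)
    (hcenter : ∀ z : H, (∀ g, z * g = g * z) → z = 1) : (innerAut (H × ℤˣ)).index = 2 := by
  rw [Subgroup.index_eq_two_iff]
  refine ⟨characterTwist ε, fun σ => ?_⟩
  rcases MulAut.mem_innerAut_or_mul_characterTwist haut hchar hcenter σ with h | h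
  · refine Or.inr ⟨h, fun h' => characterTwist_notMem_innerAut hε ?_⟩
    have := mul_mem (inv_mem h) h'
    rwa [inv_mul_cancel_left] at this
  · refine Or.inl ⟨h, fun h' => characterTwist_notMem_innerAut hε ?_⟩
    have := mul_mem (inv_mem h') h
    rwa [inv_mul_cancel_left] at this

end SignExtension

/-! ### Automorphisms of `S₅` and of its affine subgroup. -/

namespace FiveLetters

open Equiv

/-- The permutation `i ↦ 2 i` of the letters. -/
def double : Perm (Fin 5) where
  toFun := ![0, 2, 4, 1, 3]
  invFun := ![0, 3, 1, 4, 2]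
  left_inv := by decide
  right_inv := by decide

theorem sign_double : Perm.sign double = -1 := by decide +kernel

theorem exists_conj_shift : ∀ C : Perm (Fin 5), C ≠ 1 → C ^ 5 = 1 →
    ∃ h, C = h * shift * h⁻¹ := by
  decide +kernel

/-- The solutions form a coset of the centralizer `⟨shift⟩`, and the powers of `shift` permute its
five elements transitively by conjugation. -/
theorem exists_conj_double : ∀ F : Perm (Fin 5), F * shift * F⁻¹ = shift ^ 2 →
    ∃ a : Fin 5, F = shift ^ (a : ℕ) * double * (shift ^ (a : ℕ))⁻¹ := by
  decide +kernel

/-- Relations with `shift` and `double` that pin down the transposition, so an automorphism fixing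
those two elements fixes it as well. -/
theorem eq_transposition : ∀ T : Perm (Fin 5), T ^ 2 = 1 → (double * T) ^ 3 = 1 →
    (shift * double * T) ^ 2 = 1 → T = transposition := by
  decide +kernel

theorem transposition_relations : transposition ^ 2 = 1 ∧ (double * transposition) ^ 3 = 1 ∧
    (shift * double * transposition) ^ 2 = 1 := by
  decide +kernel

theorem double_relation : double * shift * double⁻¹ = shift ^ 2 := by decide +kernel

theorem shift_pow : shift ^ 5 = 1 := by decide +kernel

theorem shift_ne_one : shift ≠ 1 := by decide +kernel

theorem eq_one_of_commute : ∀ z : Perm (Fin 5), z * shift = shift * z → z * double = double * z →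
    z = 1 := by
  decide +kernel

/-- The affine permutations of the letters. -/
def IsAffine (π : Perm (Fin 5)) : Prop := ∀ i, π (i + 1) = π i + π 1 - π 0

instance : DecidablePred IsAffine := fun _ => inferInstanceAs (Decidable (∀ _, _))

/-- Affine permutations of order five are translations, and `double` permutes the nontrivial ones
cyclically. -/
theorem IsAffine.exists_conj_shift : ∀ C : Perm (Fin 5), IsAffine C → C ≠ 1 → C ^ 5 = 1 →
    ∃ a : Fin 4, C = double ^ (a : ℕ) * shift * (double ^ (a : ℕ))⁻¹ := by
  decide +kernel

theorem IsAffine.shift_mul : ∀ C : Perm (Fin 5), IsAffine C → IsAffine (shift * C) := by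
  decide +kernel

theorem IsAffine.double_mul : ∀ C : Perm (Fin 5), IsAffine C → IsAffine (double * C) := by
  decide +kernel

theorem IsAffine.shift_inv_mul : ∀ C : Perm (Fin 5), IsAffine C → IsAffine (shift⁻¹ * C) := by
  decide +kernel

theorem IsAffine.double_inv_mul : ∀ C : Perm (Fin 5), IsAffine C → IsAffine (double⁻¹ * C) := by
  decide +kernel

/-- The affine group of the five letters, which is the Frobenius group of order 20. -/
abbrev affine : Subgroup (Perm (Fin 5)) := Subgroup.closure {shift, double}

/-- Replaces membership in a generated subgroup by a decidable condition, so that facts about the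
affine group can be found by exhaustion. -/
theorem isAffine_of_mem {g : Perm (Fin 5)} (hg : g ∈ affine) : IsAffine g := by
  induction hg using Subgroup.closure_induction_left with
  | one => intro i; simp
  | mul_left x hx y _ h =>
    rcases hx with rfl | rfl
    · exact IsAffine.shift_mul _ h
    · exact IsAffine.double_mul _ h
  | inv_mul_cancel x hx y _ h =>
    rcases hx with rfl | rfl
    · exact IsAffine.shift_inv_mul _ h
    · exact IsAffine.double_inv_mul _ h

theorem mem_innerAut_of_conj_mul {H : Type*} [Group H] {σ : MulAut H} (h : H)
    (hσ : MulAut.conj h⁻¹ * σ ∈ innerAut H) : σ ∈ innerAut H := by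
  have h1 : MulAut.conj h ∈ innerAut H := ⟨h, rfl⟩
  have := mul_mem h1 hσ
  rwa [map_inv, mul_inv_cancel_left] at this

theorem conj_inv_mul_apply {H : Type*} [Group H] {σ : MulAut H} {h x y : H}
    (hx : σ x = h * y * h⁻¹) : (MulAut.conj h⁻¹ * σ) x = y := by
  rw [MulAut.mul_apply, hx, MulAut.conj_apply]
  group

/-- After inner corrections the automorphism fixes `shift`, since all elements of order five are
conjugate, and then also `double`. The relations of `eq_transposition` force it to fix the
transposition, and hence to be the identity. -/
theorem mem_innerAut_perm (σ : MulAut (Perm (Fin 5))) : σ ∈ innerAut (Perm (Fin 5)) := by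
  obtain ⟨h, hh⟩ := exists_conj_shift (σ shift)
    (fun h => shift_ne_one (σ.injective (h.trans (map_one σ).symm)))
    (by rw [← map_pow, shift_pow, map_one])
  apply mem_innerAut_of_conj_mul h
  have hs := conj_inv_mul_apply hh
  generalize MulAut.conj h⁻¹ * σ = τ at hs ⊢
  obtain ⟨a, ha⟩ := exists_conj_double (τ double) (by
    conv_lhs => rw [← hs]
    rw [← map_inv, ← map_mul, ← map_mul, double_relation, map_pow, hs])
  apply mem_innerAut_of_conj_mul (shift ^ (a : ℕ))
  have hd := conj_inv_mul_apply ha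
  have hs' : (MulAut.conj (shift ^ (a : ℕ))⁻¹ * τ) shift = shift :=
    conj_inv_mul_apply (by rw [hs]; group)
  generalize MulAut.conj (shift ^ (a : ℕ))⁻¹ * τ = υ at hd hs' ⊢
  have ht : υ transposition = transposition := by
    obtain ⟨h1, h2, h3⟩ := transposition_relations
    apply eq_transposition
    · rw [← map_pow, h1, map_one]
    · conv_lhs => rw [← hd]
      rw [← map_mul, ← map_pow, h2, map_one]
    · conv_lhs => rw [← hd, ← hs']
      rw [← map_mul, ← map_mul, ← map_pow, h3, map_one]
  have h1 : υ.toMonoidHom = MonoidHom.id _ := by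
    refine MonoidHom.eq_of_eqOn_dense closure_shift_transposition ?_
    rintro x (rfl | rfl)
    · exact hs'
    · exact ht
  have h2 : υ = 1 := MulEquiv.ext fun x => DFunLike.congr_fun h1 x
  rw [h2]
  exact one_mem _

theorem shift_mem_affine : shift ∈ affine := Subgroup.subset_closure (Or.inl rfl)

theorem double_mem_affine : double ∈ affine := Subgroup.subset_closure (Or.inr rfl)

theorem closure_affine_generators :
    Subgroup.closure {(⟨shift, shift_mem_affine⟩ : affine), ⟨double, double_mem_affine⟩} = ⊤ := by
  rw [← Subgroup.closure_closure_coe_preimage (k := {shift, double})]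
  congr 1
  ext x
  simp [Subtype.ext_iff]

/-- The corrections are as for `S₅`, made inside the affine group: powers of `double` normalize the
image of `shift`, and powers of `shift` then normalize that of `double`. These two elements already
generate the group. -/
theorem mem_innerAut_affine (σ : MulAut affine) : σ ∈ innerAut affine := by
  let x : affine := ⟨shift, shift_mem_affine⟩
  let y : affine := ⟨double, double_mem_affine⟩
  have hx5 : x ^ 5 = 1 := Subtype.ext shift_pow
  have hxy : y * x * y⁻¹ = x ^ 2 := Subtype.ext double_relation
  obtain ⟨a, ha⟩ := IsAffine.exists_conj_shift (σ x : Perm (Fin 5)) (isAffine_of_mem (σ x).2)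
    (fun h => by
      have h1 : σ x = σ 1 := by rw [map_one]; exact Subtype.ext h
      exact shift_ne_one (congrArg Subtype.val (σ.injective h1)))
    (by
      have h1 : σ x ^ 5 = 1 := by rw [← map_pow, hx5, map_one]
      exact congrArg Subtype.val h1)
  apply mem_innerAut_of_conj_mul (y ^ (a : ℕ))
  have hs : (MulAut.conj (y ^ (a : ℕ))⁻¹ * σ) x = x := conj_inv_mul_apply (Subtype.ext ha)
  generalize MulAut.conj (y ^ (a : ℕ))⁻¹ * σ = τ at hs ⊢
  have h1 : τ y * x * (τ y)⁻¹ = x ^ 2 := by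
    conv_lhs => rw [← hs]
    rw [← map_inv, ← map_mul, ← map_mul, hxy, map_pow, hs]
  obtain ⟨b, hb⟩ := exists_conj_double (τ y : Perm (Fin 5)) (congrArg Subtype.val h1)
  have hd : (MulAut.conj (x ^ (b : ℕ))⁻¹ * τ) y = y := conj_inv_mul_apply (Subtype.ext hb)
  have hs' : (MulAut.conj (x ^ (b : ℕ))⁻¹ * τ) x = x :=
    conj_inv_mul_apply (by rw [hs]; group)
  apply mem_innerAut_of_conj_mul (x ^ (b : ℕ))
  generalize MulAut.conj (x ^ (b : ℕ))⁻¹ * τ = υ at hd hs' ⊢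
  have h1 : υ.toMonoidHom = MonoidHom.id _ := by
    refine MonoidHom.eq_of_eqOn_dense closure_affine_generators ?_
    rintro z (rfl | rfl)
    · exact hs'
    · exact hd
  have h2 : υ = 1 := MulEquiv.ext fun x => DFunLike.congr_fun h1 x
  rw [h2]
  exact one_mem _

/-- An element whose fifth power is 1 has trivial image in `{±1}`, so a quadratic character is
determined by its value at `y`. -/
theorem eq_one_or_eq_of_generators {H : Type*} [Group H] {x y : H}
    (h : Subgroup.closure {x, y} = ⊤) (hx : x ^ 5 = 1) {ε : H →* ℤˣ} (hε : ε y = -1)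
    (χ : H →* ℤˣ) : χ = 1 ∨ χ = ε := by
  have h1 : ∀ χ : H →* ℤˣ, χ x = 1 := by
    intro χ
    have h2 : χ x ^ 5 = 1 := by rw [← map_pow, hx, map_one]
    rcases Int.units_eq_one_or (χ x) with h3 | h3
    · exact h3
    · rw [h3] at h2; exact absurd h2 (by decide)
  rcases Int.units_eq_one_or (χ y) with h3 | h3
  · left
    refine MonoidHom.eq_of_eqOn_dense h ?_
    rintro z (rfl | rfl)
    · exact h1 χ
    · exact h3
  · right
    refine MonoidHom.eq_of_eqOn_dense h ?_
    rintro z (rfl | rfl)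
    · exact (h1 χ).trans (h1 ε).symm
    · exact h3.trans hε.symm

end FiveLetters

/-! ### The six groups on five letters and their tori. -/

section FiveLettersGroups

namespace FiveLetters

open Equiv

/-- The left action on columns corresponding to `letterRep`. -/
def letterHom : Perm (Fin 5) × ℤˣ →* GL (Fin 4) ℤ where
  toFun g := (letterRep g⁻¹).unop
  map_one' := by rw [inv_one, map_one]; rfl
  map_mul' g h := by rw [mul_inv_rev, map_mul]; rfl

theorem letterHom_inv (g : Perm (Fin 5) × ℤˣ) : letterHom g⁻¹ = (letterRep g).unop := by
  change (letterRep g⁻¹⁻¹).unop = _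
  rw [inv_inv]

theorem letterHom_injective : Function.Injective letterHom := by
  rw [injective_iff_map_eq_one]
  rintro ⟨π, s⟩ h
  have h1 : letterMatrix (π, s)⁻¹ = 1 := congrArg Units.val h
  have key : ∀ (π : Perm (Fin 5)) (s : ℤˣ), letterMatrix (π, s) = 1 → (π, s) = 1 := by
    decide +kernel
  exact inv_eq_one.mp (key _ _ h1)

/-- The generators appear inverted because `letterHom` turns the antihomomorphism `letterRep` into a
homomorphism by inversion. The generated subgroups are unaffected. -/
theorem letterHom_shift : letterHom (shift, 1) = I4.c⁻¹ := by
  rw [← inv_inj, inv_inv, ← map_inv, letterHom_inv]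
  exact Units.ext (by decide +kernel)

theorem letterHom_double : letterHom (double, 1) = I4.f⁻¹ := by
  rw [← inv_inj, inv_inv, ← map_inv, letterHom_inv]
  exact Units.ext (by decide +kernel)

theorem letterHom_transposition : letterHom (transposition, 1) = I4.t⁻¹ := by
  rw [← inv_inj, inv_inv, ← map_inv, letterHom_inv]
  exact Units.ext (by decide +kernel)

theorem letterHom_neg_one : letterHom (1, -1) = -1 := by
  rw [← inv_inj, ← map_inv, letterHom_inv]
  exact Units.ext (by decide +kernel)

theorem signTwist_apply (g : Perm (Fin 5) × ℤˣ) : signTwist g = (g.1, g.2 * Perm.sign g.1) := rfl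

theorem signTwist_injective : Function.Injective signTwist := by
  intro g h hgh
  rw [signTwist_apply, signTwist_apply, Prod.mk.injEq] at hgh
  refine Prod.ext hgh.1 ?_
  have := hgh.2
  rw [hgh.1] at this
  exact mul_right_cancel this

theorem mk_neg_one (π : Perm (Fin 5)) : (π, (-1 : ℤˣ)) = (1, -1) * (π, 1) := by
  ext1 <;> simp

variable {H : Type*} [Group H] (ι : H →* Perm (Fin 5))

/-- The homomorphism to `S₅ × {±1}` that is trivial on the second component. -/
def inclusion : H →* Perm (Fin 5) × ℤˣ := ι.prod 1

/-- The homomorphism from `H × {±1}` to `S₅ × {±1}`. -/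
def inclusionUnits : H × ℤˣ →* Perm (Fin 5) × ℤˣ := ι.prodMap (MonoidHom.id _)

theorem inclusion_injective {ι : H →* Perm (Fin 5)} (hι : Function.Injective ι) :
    Function.Injective (inclusion ι) := fun _ _ h => hι (congrArg Prod.fst h)

theorem inclusionUnits_injective {ι : H →* Perm (Fin 5)} (hι : Function.Injective ι) :
    Function.Injective (inclusionUnits ι) := fun _ _ h =>
  Prod.ext (hι (congrArg Prod.fst h)) (congrArg Prod.snd h :)

variable {ι} {k L : Type*} [Field k] [Field L] [Algebra k L] [FiniteDimensional k L]
  [IsGalois k L]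

/-- Two tori whose characters are the lattice of `H ≤ S₅` and its twist by the sign. -/
theorem isStablyRational_tensor_of_range (hι : Function.Injective ι)
    (haut : ∀ σ : MulAut H, σ ∈ innerAut H) {G G' : Subgroup (GL (Fin 4) ℤ)}
    (hG : IsConjSubgroup G (letterHom.comp (inclusion ι)).range)
    (hG' : IsConjSubgroup G' (letterHom.comp (signTwist.comp (inclusion ι))).range)
    {φ : (L ≃ₐ[k] L) ≃* (G)ᵐᵒᵖ} {φ' : (L ≃ₐ[k] L) ≃* (G')ᵐᵒᵖ}
    {A : Type*} [CommRing A] [HopfAlgebra k A] {A' : Type*} [CommRing A'] [HopfAlgebra k A']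
    (hA : HasCharacterModule k L A G φ) (hA' : HasCharacterModule k L A' G' φ') :
    IsStablyRational k (A ⊗[k] A') := by
  obtain ⟨x, ψ, hψ⟩ := hG.exists_mulEquiv
    (by rw [MonoidHom.coe_comp]; exact letterHom_injective.comp (inclusion_injective hι))
  obtain ⟨x', ψ', hψ'⟩ := hG'.exists_mulEquiv
    (by
      rw [MonoidHom.coe_comp, MonoidHom.coe_comp]
      exact letterHom_injective.comp (signTwist_injective.comp (inclusion_injective hι)))
  let r := galoisParam φ ψ
  let r' := galoisParam φ' ψ'
  -- The identifications of the Galois group with `H` through the two tori are unrelated. They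
  -- differ by an automorphism of `H`, which is inner and is absorbed into the conjugating matrix of
  -- the second torus.
  obtain ⟨h, hh⟩ := haut (r.symm.trans r')
  have hh' : ∀ s, r' s = h * r s * h⁻¹ := fun s => by
    have := DFunLike.congr_fun hh (r s)
    change h * r s * h⁻¹ = r' (r.symm (r s)) at this
    rw [this, MulEquiv.symm_apply_apply]
  refine isStablyRational_tensor_letterRep ((inclusion ι).comp r.toMonoidHom)
    (hA.isSplitWith_of_conj _ x fun s => ?_)
    (hA'.isSplitWith_of_conj _ (x' * letterHom (signTwist (inclusion ι h))) fun s => ?_)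
  · rw [galoisParam_spec φ ψ s, hψ]
    congr 2
    rw [map_inv]
    change (letterHom (inclusion ι (r s)))⁻¹ = _
    rw [← map_inv, letterHom_inv]
    rfl
  · rw [galoisParam_spec φ' ψ' s, hψ']
    change x' * letterHom (signTwist (inclusion ι (r' s)⁻¹)) * x'⁻¹ =
      _ * (letterRep (signTwist (inclusion ι (r s)))).unop * _
    rw [hh', ← letterHom_inv]
    simp only [map_mul, map_inv]
    group

/-- An automorphism that is not inner is the sign twist followed by an inner one. The inner part
only changes the basis of the lattice, and the sign twist becomes `signTwist`, so the certificate
applies. -/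
theorem isStablyRational_tensor_twist_of_range [Finite H] (hι : Function.Injective ι)
    (haut : ∀ σ : MulAut H, σ ∈ innerAut H)
    (hchar : ∀ χ : H →* ℤˣ, χ = 1 ∨ χ = Perm.sign.comp ι)
    (hcenter : ∀ z : H, (∀ g, z * g = g * z) → z = 1) {G : Subgroup (GL (Fin 4) ℤ)}
    (hG : IsConjSubgroup G (letterHom.comp (inclusionUnits ι)).range)
    {φ : (L ≃ₐ[k] L) ≃* (G)ᵐᵒᵖ} {σ : MulAut G} (hσ : σ ∉ innerAut G)
    {A : Type*} [CommRing A] [HopfAlgebra k A] {A' : Type*} [CommRing A'] [HopfAlgebra k A']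
    (hA : HasCharacterModule k L A G φ) (hA' : HasCharacterModule k L A' G (twist φ σ)) :
    IsStablyRational k (A ⊗[k] A') := by
  obtain ⟨x, ψ, hψ⟩ := hG.exists_mulEquiv
    (by rw [MonoidHom.coe_comp]; exact letterHom_injective.comp (inclusionUnits_injective hι))
  let r := galoisParam φ ψ
  rcases MulAut.mem_innerAut_or_mul_characterTwist haut hchar hcenter
    (MulAut.congr ψ.symm σ) with h | ⟨h, hh⟩
  · exact absurd (mem_innerAut_congr ψ h) hσ
  have hh' : ∀ y, σ (ψ y) = ψ (h * characterTwist (Perm.sign.comp ι) y * h⁻¹) := fun y => by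
    have h1 := DFunLike.congr_fun hh (characterTwist (Perm.sign.comp ι) y)
    rw [MulAut.mul_apply, show ∀ z, characterTwist (Perm.sign.comp ι)
      (characterTwist (Perm.sign.comp ι) z) = z from
        DFunLike.congr_fun (characterTwist_mul_self (Perm.sign.comp ι))] at h1
    change h * _ * h⁻¹ = ψ.symm (σ (ψ y)) at h1
    rw [h1, MulEquiv.apply_symm_apply]
  have htw : ∀ y, inclusionUnits ι (characterTwist (Perm.sign.comp ι) y) =
      signTwist (inclusionUnits ι y) := fun _ => rfl
  refine isStablyRational_tensor_letterRep ((inclusionUnits ι).comp r.toMonoidHom)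
    (hA.isSplitWith_of_conj _ x fun s => ?_)
    (hA'.isSplitWith_of_conj _ (x * letterHom (inclusionUnits ι h)) fun s => ?_)
  · rw [galoisParam_spec φ ψ s, hψ]
    congr 2
    rw [map_inv]
    change (letterHom (inclusionUnits ι (r s)))⁻¹ = _
    rw [← map_inv, letterHom_inv]
    rfl
  · change ((σ (φ s).unop : G) : GL (Fin 4) ℤ) = _
    rw [galoisParam_spec φ ψ s, hh', hψ]
    change x * letterHom (inclusionUnits ι (h * characterTwist _ (r s)⁻¹ * h⁻¹)) * x⁻¹ =
      _ * (letterRep (signTwist (inclusionUnits ι (r s)))).unop * _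
    rw [← letterHom_inv]
    simp only [map_mul, map_inv, htw]
    group

theorem _root_.IsConjSubgroup.innerAut_index_of_range [Finite H] (hι : Function.Injective ι)
    (hε : Perm.sign.comp ι ≠ 1) (haut : ∀ σ : MulAut H, σ ∈ innerAut H)
    (hchar : ∀ χ : H →* ℤˣ, χ = 1 ∨ χ = Perm.sign.comp ι)
    (hcenter : ∀ z : H, (∀ g, z * g = g * z) → z = 1) {G : Subgroup (GL (Fin 4) ℤ)}
    (hG : IsConjSubgroup G (letterHom.comp (inclusionUnits ι)).range) :
    (innerAut G).index = 2 := by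
  obtain ⟨x, ψ, hψ⟩ := hG.exists_mulEquiv
    (by rw [MonoidHom.coe_comp]; exact letterHom_injective.comp (inclusionUnits_injective hι))
  rw [innerAut_index_congr ψ]
  exact innerAut_prod_units_index hε haut hchar hcenter

theorem closure_inv_pair {K : Type*} [Group K] (a b : K) :
    Subgroup.closure {a⁻¹, b⁻¹} = Subgroup.closure {a, b} := by
  rw [← Subgroup.closure_inv {a, b}]
  simp

theorem range_letterHom_inclusion {x y : H} (h : Subgroup.closure {x, y} = ⊤) :
    (letterHom.comp (inclusion ι)).range =
      Subgroup.closure {letterHom (ι x, 1), letterHom (ι y, 1)} := by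
  rw [MonoidHom.range_eq_map, ← h, MonoidHom.map_closure, Set.image_pair]
  rfl

theorem range_letterHom_signTwist {x y : H} (h : Subgroup.closure {x, y} = ⊤)
    (hx : Perm.sign (ι x) = 1) (hy : Perm.sign (ι y) = -1) :
    (letterHom.comp (signTwist.comp (inclusion ι))).range =
      Subgroup.closure {letterHom (ι x, 1), -letterHom (ι y, 1)} := by
  rw [MonoidHom.range_eq_map, ← h, MonoidHom.map_closure, Set.image_pair]
  have h1 : (letterHom.comp (signTwist.comp (inclusion ι))) x = letterHom (ι x, 1) := by
    change letterHom (ι x, 1 * Perm.sign (ι x)) = _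
    rw [hx, one_mul]
  have h2 : (letterHom.comp (signTwist.comp (inclusion ι))) y = -letterHom (ι y, 1) := by
    change letterHom (ι y, 1 * Perm.sign (ι y)) = _
    rw [hy, one_mul, mk_neg_one, map_mul, letterHom_neg_one, neg_one_mul]
  rw [h1, h2]

theorem range_letterHom_inclusionUnits {x y : H} (h : Subgroup.closure {x, y} = ⊤) :
    (letterHom.comp (inclusionUnits ι)).range =
      Subgroup.closure {letterHom (ι x, 1), letterHom (ι y, 1), -1} := by
  apply le_antisymm
  · rintro _ ⟨⟨g, s⟩, rfl⟩
    have h1 : letterHom (ι g, 1) ∈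
        Subgroup.closure {letterHom (ι x, 1), letterHom (ι y, 1), -1} := by
      have h2 : letterHom (ι g, 1) ∈ (letterHom.comp (inclusion ι)).range := ⟨g, rfl⟩
      rw [range_letterHom_inclusion h] at h2
      refine Subgroup.closure_mono ?_ h2
      rintro _ (rfl | rfl)
      · exact Or.inl rfl
      · exact Or.inr (Or.inl rfl)
    rcases Int.units_eq_one_or s with rfl | rfl
    · exact h1
    · change letterHom (ι g, -1) ∈ _
      rw [mk_neg_one, map_mul, letterHom_neg_one]
      exact mul_mem (Subgroup.subset_closure (Or.inr (Or.inr rfl))) h1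
  · rw [Subgroup.closure_le]
    rintro _ (rfl | rfl | rfl)
    · exact ⟨(x, 1), rfl⟩
    · exact ⟨(y, 1), rfl⟩
    · refine ⟨(1, -1), ?_⟩
      change letterHom (ι 1, -1) = -1
      rw [map_one, letterHom_neg_one]

theorem closure_inv_triple (a b : GL (Fin 4) ℤ) :
    Subgroup.closure {a⁻¹, b⁻¹, -1} = Subgroup.closure {a, b, -1} := by
  rw [← Subgroup.closure_inv {a, b, -1}]
  simp [Set.inv_insert]

theorem G1_eq_range : I4.G1 = (letterHom.comp (inclusion affine.subtype)).range := by
  rw [range_letterHom_inclusion closure_affine_generators]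
  change _ = Subgroup.closure {letterHom (shift, 1), letterHom (double, 1)}
  rw [letterHom_shift, letterHom_double, closure_inv_pair]
  rfl

theorem neg_inv_eq (a : GL (Fin 4) ℤ) : -a⁻¹ = (-a)⁻¹ := by
  rw [eq_inv_iff_mul_eq_one, neg_mul_neg, inv_mul_cancel]

theorem G2_eq_range :
    I4.G2 = (letterHom.comp (signTwist.comp (inclusion affine.subtype))).range := by
  rw [range_letterHom_signTwist closure_affine_generators sign_shift sign_double]
  change _ = Subgroup.closure {letterHom (shift, 1), -letterHom (double, 1)}
  rw [letterHom_shift, letterHom_double, neg_inv_eq, closure_inv_pair]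
  rfl

theorem G3_eq_range : I4.G3 = (letterHom.comp (inclusionUnits affine.subtype)).range := by
  rw [range_letterHom_inclusionUnits closure_affine_generators]
  change _ = Subgroup.closure {letterHom (shift, 1), letterHom (double, 1), -1}
  rw [letterHom_shift, letterHom_double, closure_inv_triple]
  rfl

theorem G4_eq_range : I4.G4 = (letterHom.comp (inclusion (MonoidHom.id _))).range := by
  rw [range_letterHom_inclusion closure_shift_transposition]
  change _ = Subgroup.closure {letterHom (shift, 1), letterHom (transposition, 1)}
  rw [letterHom_shift, letterHom_transposition, closure_inv_pair]
  rfl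

theorem G5_eq_range :
    I4.G5 = (letterHom.comp (signTwist.comp (inclusion (MonoidHom.id _)))).range := by
  rw [range_letterHom_signTwist closure_shift_transposition sign_shift sign_transposition]
  change _ = Subgroup.closure {letterHom (shift, 1), -letterHom (transposition, 1)}
  rw [letterHom_shift, letterHom_transposition, neg_inv_eq, closure_inv_pair]
  rfl

theorem G6_eq_range : I4.G6 = (letterHom.comp (inclusionUnits (MonoidHom.id _))).range := by
  rw [range_letterHom_inclusionUnits closure_shift_transposition]
  change _ = Subgroup.closure {letterHom (shift, 1), letterHom (transposition, 1), -1}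
  rw [letterHom_shift, letterHom_transposition, closure_inv_triple]
  rfl

theorem affine_character (χ : affine →* ℤˣ) : χ = 1 ∨ χ = Perm.sign.comp affine.subtype :=
  eq_one_or_eq_of_generators closure_affine_generators (Subtype.ext shift_pow)
    (ε := Perm.sign.comp affine.subtype) ((MonoidHom.comp_apply _ _ _).trans sign_double) χ

theorem perm_character (χ : Perm (Fin 5) →* ℤˣ) : χ = 1 ∨ χ = Perm.sign.comp (MonoidHom.id _) :=
  eq_one_or_eq_of_generators closure_shift_transposition shift_pow
    (ε := Perm.sign.comp (MonoidHom.id _))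
    ((MonoidHom.comp_apply _ _ _).trans sign_transposition) χ

theorem affine_center (z : affine) (h : ∀ g, z * g = g * z) : z = 1 :=
  Subtype.ext (eq_one_of_commute _ (congrArg Subtype.val (h ⟨shift, shift_mem_affine⟩))
    (congrArg Subtype.val (h ⟨double, double_mem_affine⟩)))

theorem perm_center (z : Perm (Fin 5)) (h : ∀ g, z * g = g * z) : z = 1 :=
  eq_one_of_commute _ (h shift) (h double)

theorem affine_sign_ne_one : Perm.sign.comp affine.subtype ≠ 1 := fun h => by
  have h1 : Perm.sign double = 1 := DFunLike.congr_fun h ⟨double, double_mem_affine⟩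
  rw [sign_double] at h1
  exact absurd h1 (by decide)

theorem perm_sign_ne_one : Perm.sign.comp (MonoidHom.id (Perm (Fin 5))) ≠ 1 := fun h => by
  have h1 : Perm.sign double = 1 := DFunLike.congr_fun h double
  rw [sign_double] at h1
  exact absurd h1 (by decide)

end FiveLetters

end FiveLettersGroups

/-! ### Automorphisms of `C₃ ⋊ C₈` and integral conjugacy. -/

section MetacyclicAut

namespace Metacyclic

/-- The generator of `C₃`. -/
abbrev gen₃ : Metacyclic := ⟨1, 0⟩

/-- The generator of `C₈`. -/
abbrev gen₈ : Metacyclic := ⟨0, 1⟩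

/-- The endomorphism that maps the generators to `⟨e, 0⟩` and `⟨m, k⟩`, for `k` odd. -/
def endo (e m : ZMod 3) (k : ZMod 8) (x : Metacyclic) : Metacyclic :=
  ⟨e * x.i + if x.j.val % 2 = 0 then 0 else m, k * x.j⟩

theorem endo_eq : ∀ (e m : ZMod 3) (k : ZMod 8), k.val % 2 = 1 → ∀ x : Metacyclic,
    (⟨e, 0⟩ : Metacyclic) ^ x.i.val * (⟨m, k⟩ : Metacyclic) ^ x.j.val = endo e m k x := by
  decide +kernel

theorem eq_of_pow_three : ∀ x : Metacyclic, x ^ 3 = 1 → x ≠ 1 → x = ⟨1, 0⟩ ∨ x = ⟨-1, 0⟩ := by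
  decide +kernel

theorem odd_of_pow_eight : ∀ x : Metacyclic, x ^ 8 = 1 → x ^ 4 ≠ 1 → x.j.val % 2 = 1 := by
  decide +kernel

theorem eq_gen_pow : ∀ x : Metacyclic, x = gen₃ ^ x.i.val * gen₈ ^ x.j.val := by
  decide +kernel

/-- Orders are preserved: the generator of `C₃` goes to a generator of `C₃`, and that of `C₈` to an
element with odd second component. Normal forms then determine every value. -/
theorem exists_endo (σ : MulAut Metacyclic) : ∃ (e m : ZMod 3) (k : ZMod 8),
    (e = 1 ∨ e = -1) ∧ k.val % 2 = 1 ∧ ∀ x, σ x = endo e m k x := by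
  have h1 := eq_of_pow_three (σ gen₃)
    (by rw [← map_pow, show gen₃ ^ 3 = 1 by decide +kernel, map_one])
    (fun h => absurd (σ.injective (h.trans (map_one σ).symm)) (by decide))
  have h2 := odd_of_pow_eight (σ gen₈)
    (by rw [← map_pow, show gen₈ ^ 8 = 1 by decide +kernel, map_one])
    (fun h => by
      rw [← map_pow] at h
      exact absurd (σ.injective (h.trans (map_one σ).symm)) (by decide +kernel))
  have h3 : σ gen₃ = ⟨(σ gen₃).i, 0⟩ := by
    rcases h1 with h | h <;> rw [h]
  refine ⟨(σ gen₃).i, (σ gen₈).i, (σ gen₈).j, ?_, h2, fun x => ?_⟩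
  · rcases h1 with h | h <;> rw [h] <;> simp
  · rw [← endo_eq _ _ _ h2, ← h3]
    change _ = _ * σ gen₈ ^ _
    rw [← map_pow, ← map_pow, ← map_mul, ← eq_gen_pow]

/-- The endomorphism attached to an element of `D₆`; it fixes the class of the representation. -/
def dihedralFun : DihedralGroup 6 → Metacyclic → Metacyclic
  | .r n => endo 1 (n.val : ZMod 3) (3 ^ n.val)
  | .sr n => endo (-1) (-(n.val : ZMod 3)) (3 ^ n.val)

/-- The automorphisms fixing the class of the representation, parametrized by `D₆`. -/
def dihedralAut : DihedralGroup 6 →* MulAut Metacyclic :=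
  have h1 : ∀ d x y, dihedralFun d (x * y) = dihedralFun d x * dihedralFun d y := by decide +kernel
  have h2 : ∀ d d' x, dihedralFun (d * d') x = dihedralFun d (dihedralFun d' x) := by
    decide +kernel
  have h3 : ∀ x, dihedralFun 1 x = x := by decide +kernel
  MonoidHom.mk' (fun d =>
    { toFun := dihedralFun d
      invFun := dihedralFun d⁻¹
      left_inv := fun x => by rw [← h2, inv_mul_cancel, h3]
      right_inv := fun x => by rw [← h2, mul_inv_cancel, h3]
      map_mul' := h1 d }) fun d d' => MulEquiv.ext (h2 d d')

theorem dihedralAut_apply (d : DihedralGroup 6) (x : Metacyclic) :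
    dihedralAut d x = dihedralFun d x := rfl

theorem dihedralAut_injective : Function.Injective dihedralAut := by
  rw [injective_iff_map_eq_one]
  intro d hd
  have h1 : ∀ d, dihedralFun d gen₃ = gen₃ → dihedralFun d gen₈ = gen₈ → d = 1 := by
    decide +kernel
  exact h1 d (DFunLike.congr_fun hd gen₃) (DFunLike.congr_fun hd gen₈)

/-- The automorphism twisting by the quadratic character. -/
def quadraticAut : MulAut Metacyclic :=
  have h1 : ∀ x, endo 1 0 5 (endo 1 0 5 x) = x := by decide +kernel
  { toFun := endo 1 0 5
    invFun := endo 1 0 5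
    left_inv := h1
    right_inv := h1
    map_mul' := by decide +kernel }

/-- The parameters `e`, `m` and odd `k` allow 24 possibilities. The dihedral automorphisms are those
with `k` equal to 1 or 3, and `quadraticAut` multiplies `k` by 5, which interchanges these values
with 5 and 7. -/
theorem exists_dihedralAut (σ : MulAut Metacyclic) :
    (∃ d, σ = dihedralAut d) ∨ ∃ d, σ * quadraticAut = dihedralAut d := by
  obtain ⟨e, m, k, he, hk, h⟩ := exists_endo σ
  have key : ∀ e m : ZMod 3, ∀ k : ZMod 8, (e = 1 ∨ e = -1) → k.val % 2 = 1 →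
      (∃ d, ∀ x, endo e m k x = dihedralFun d x) ∨
        ∃ d, ∀ x, endo e m k (endo 1 0 5 x) = dihedralFun d x := by decide +kernel
  rcases key e m k he hk with ⟨d, hd⟩ | ⟨d, hd⟩
  · exact Or.inl ⟨d, MulEquiv.ext fun x => (h x).trans (hd x)⟩
  · exact Or.inr ⟨d, MulEquiv.ext fun x => (h _).trans (hd x)⟩

/-- The automorphisms fixing the class of the representation. -/
def stabilizer : Subgroup (MulAut Metacyclic) where
  carrier := {σ | ∃ x : GL (Fin 4) ℤ, ∀ g, rep (σ g) = x * rep g * x⁻¹}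
  one_mem' := ⟨1, by simp⟩
  mul_mem' := by
    rintro σ τ ⟨x, hx⟩ ⟨y, hy⟩
    refine ⟨x * y, fun g => ?_⟩
    rw [MulAut.mul_apply, hx, hy]
    group
  inv_mem' := by
    rintro σ ⟨x, hx⟩
    refine ⟨x⁻¹, fun g => ?_⟩
    have h := hx (σ⁻¹ g)
    rw [MulAut.apply_inv_self] at h
    rw [h]
    group

theorem conj_mem_stabilizer (g : Metacyclic) : MulAut.conj g ∈ stabilizer :=
  ⟨rep g, fun x => by rw [MulAut.conj_apply, map_mul, map_mul, map_inv]⟩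

/-- A matrix that commutes with `cMat` and conjugates `λ₄` to its cube. -/
def cubing : GL (Fin 4) ℤ where
  val := !![0, 0, -1, 0; -1, -1, -1, 2; 1, 0, 0, 0; 0, -1, -1, 1]
  inv := !![0, 0, 1, 0; 1, 1, 1, -2; -1, 0, 0, 0; 0, 1, 1, -1]
  val_inv := by decide
  inv_val := by decide

theorem cubing_mul_cMat : cubing * cMat = cMat * cubing := Units.ext (by decide)

theorem cubing_mul_l4 : cubing * I4.l4 = I4.l4 ^ 3 * cubing := by
  apply Units.ext
  simp only [pow_succ, pow_zero, one_mul, Units.val_mul]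
  decide

theorem mem_stabilizer_of_generators {σ : MulAut Metacyclic} (x : GL (Fin 4) ℤ)
    (h₃ : rep (σ gen₃) = x * rep gen₃ * x⁻¹) (h₈ : rep (σ gen₈) = x * rep gen₈ * x⁻¹) :
    σ ∈ stabilizer := by
  have h : rep.comp σ.toMonoidHom = (MulAut.conj x).toMonoidHom.comp rep := by
    refine MonoidHom.eq_of_eqOn_dense closure_generators ?_
    exact forall_generators h₃ h₈
  exact ⟨x, fun g => DFunLike.congr_fun h g⟩

/-- It suffices to treat `sr 0` and `r 1`, which generate. The former is conjugation by the
generator of `C₈`. The latter cubes that generator up to conjugation by `C₃`, and is realized by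
`cubing`. -/
theorem dihedralAut_mem_stabilizer (d : DihedralGroup 6) : dihedralAut d ∈ stabilizer := by
  have h1 : dihedralAut (.sr 0) ∈ stabilizer := by
    have h : ∀ x, dihedralFun (.sr 0) x = gen₈ * x * gen₈⁻¹ := by decide +kernel
    rw [show dihedralAut (.sr 0) = MulAut.conj gen₈ from MulEquiv.ext h]
    exact conj_mem_stabilizer _
  have h2 : dihedralAut (.r 1) ∈ stabilizer := by
    refine mem_stabilizer_of_generators (rep (gen₃ ^ 2) * cubing) ?_ ?_
    · rw [dihedralAut_apply,
        show dihedralFun (.r 1) gen₃ = gen₃ ^ 2 * gen₃ * (gen₃ ^ 2)⁻¹ by decide +kernel, map_mul,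
        map_mul, map_inv, rep_c, mul_assoc (rep _) cubing, cubing_mul_cMat]
      group
    · rw [dihedralAut_apply,
        show dihedralFun (.r 1) gen₈ = gen₃ ^ 2 * gen₈ ^ 3 * (gen₃ ^ 2)⁻¹ by decide +kernel,
        map_mul, map_mul, map_inv, map_pow rep gen₈, rep_b, mul_assoc (rep _) cubing,
        cubing_mul_l4]
      group
  have h3 : ∀ n, dihedralAut (.r n) ∈ stabilizer := fun n => by
    rw [← ZMod.natCast_zmod_val n, ← DihedralGroup.r_one_pow, map_pow]
    exact pow_mem h2 _
  rcases d with n | n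
  · exact h3 n
  · have := mul_mem h1 (h3 n)
    rwa [← map_mul, DihedralGroup.sr_mul_r, zero_add] at this

/-- Reduction of integral matrices modulo 3. -/
abbrev red : Matrix (Fin 4) (Fin 4) ℤ →+* Matrix (Fin 4) (Fin 4) (ZMod 3) :=
  (Int.castRingHom (ZMod 3)).mapMatrix

/-- A basis of the vectors modulo 3 that are fixed by `cMat`. -/
def fixedBasis : Matrix (Fin 4) (Fin 2) (ZMod 3) := !![0, 1; 1, 1; 1, 0; 2, 0]

/-- The action of `λ₄` on the vectors modulo 3 that are fixed by `cMat`. -/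
def fixedAction : Matrix (Fin 2) (Fin 2) (ZMod 3) := !![1, 2; 2, 0]

/-- A retraction to the vectors modulo 3 that are fixed by `cMat`. -/
def fixedCoord : Matrix (Fin 2) (Fin 4) (ZMod 3) := !![0, 0, 1, 0; 1, 0, 0, 0]

/-- An explicit identity `1 = fixedBasis * fixedCoord + K * (c - 1)` modulo 3 exhibits the columns
of `fixedBasis` as spanning the fixed vectors of `cMat`. -/
theorem eq_fixedBasis_mul {Y : Matrix (Fin 4) (Fin 2) (ZMod 3)}
    (h : red (cMat : Matrix (Fin 4) (Fin 4) ℤ) * Y = Y) : Y = fixedBasis * (fixedCoord * Y) := by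
  have h1 : fixedBasis * fixedCoord + !![0, 0, 0, 0; 0, 2, 0, 1; 0, 0, 0, 0; 0, 0, 0, 2] *
      (red (cMat : Matrix (Fin 4) (Fin 4) ℤ) - 1) = 1 := by decide +kernel
  have h2 := congrArg (· * Y) h1
  simp only [Matrix.mul_assoc, Matrix.add_mul, Matrix.one_mul, Matrix.sub_mul, h,
    sub_self, Matrix.mul_zero, add_zero] at h2
  exact h2.symm

theorem red_rep_mul (g : Metacyclic) : red (rep g : Matrix (Fin 4) (Fin 4) ℤ) * fixedBasis =
    fixedBasis * fixedAction ^ g.j.val := by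
  have h1 : red (cMat : Matrix (Fin 4) (Fin 4) ℤ) * fixedBasis = fixedBasis := by decide +kernel
  have h2 : red (I4.l4 : Matrix (Fin 4) (Fin 4) ℤ) * fixedBasis = fixedBasis * fixedAction := by
    decide +kernel
  have h3 : ∀ n : ℕ, red (cMat : Matrix (Fin 4) (Fin 4) ℤ) ^ n * fixedBasis = fixedBasis := by
    intro n
    induction n with
    | zero => rw [pow_zero, Matrix.one_mul]
    | succ n ih => rw [pow_succ, Matrix.mul_assoc, h1, ih]
  have h4 : ∀ n : ℕ, red (I4.l4 : Matrix (Fin 4) (Fin 4) ℤ) ^ n * fixedBasis =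
      fixedBasis * fixedAction ^ n := by
    intro n
    induction n with
    | zero => rw [pow_zero, pow_zero, Matrix.one_mul, Matrix.mul_one]
    | succ n ih => rw [pow_succ, pow_succ', Matrix.mul_assoc, h2, ← Matrix.mul_assoc, ih,
        Matrix.mul_assoc, pow_mul_comm']
  rw [rep_apply, Units.val_mul, Units.val_pow_eq_pow_val, Units.val_pow_eq_pow_val, map_mul,
    map_pow, map_pow, Matrix.mul_assoc, h4, ← Matrix.mul_assoc, h3]

/-- An integral matrix realizing `σ` preserves, modulo 3, the plane fixed by the normal subgroup
`C₃`. On this plane it conjugates the action of `λ₄` into that of its image under `σ`, and conjugate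
matrices have equal traces. -/
theorem trace_eq_of_mem_stabilizer {σ : MulAut Metacyclic} (h : σ ∈ stabilizer) :
    (fixedAction ^ (σ gen₈).j.val).trace = fixedAction.trace := by
  obtain ⟨x, hx⟩ := h
  have hx' : ∀ g, red (x : Matrix (Fin 4) (Fin 4) ℤ) * red (rep g : Matrix (Fin 4) (Fin 4) ℤ) =
      red (rep (σ g) : Matrix (Fin 4) (Fin 4) ℤ) * red (x : Matrix (Fin 4) (Fin 4) ℤ) := by
    intro g
    rw [hx, ← map_mul, ← map_mul, ← Units.val_mul, ← Units.val_mul, inv_mul_cancel_right]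
  -- `σ gen₃` generates the same subgroup as `gen₃`, so whatever it fixes is fixed by `cMat`.
  have hfix : ∀ Y : Matrix (Fin 4) (Fin 2) (ZMod 3),
      red (rep (σ gen₃) : Matrix (Fin 4) (Fin 4) ℤ) * Y = Y →
        red (cMat : Matrix (Fin 4) (Fin 4) ℤ) * Y = Y := by
    intro Y hY
    obtain ⟨e, m, k, he, -, h⟩ := exists_endo σ
    have h1 : ∃ n : ℕ, gen₃ = σ gen₃ ^ n := by
      rw [h]
      have h2 : ∀ (m : ZMod 3) (k : ZMod 8), gen₃ = endo 1 m k gen₃ ^ 1 ∧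
          gen₃ = endo (-1) m k gen₃ ^ 2 := by decide +kernel
      rcases he with rfl | rfl
      · exact ⟨1, (h2 m k).1⟩
      · exact ⟨2, (h2 m k).2⟩
    obtain ⟨n, hn⟩ := h1
    rw [← rep_c, show (⟨1, 0⟩ : Metacyclic) = _ from hn, map_pow, Units.val_pow_eq_pow_val, map_pow]
    clear hn
    induction n with
    | zero => rw [pow_zero, Matrix.one_mul]
    | succ n ih => rw [pow_succ, Matrix.mul_assoc, hY, ih]
  have hxi : red (x : Matrix (Fin 4) (Fin 4) ℤ) * red ((x⁻¹ : GL (Fin 4) ℤ) : Matrix _ _ ℤ) = 1 := by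
    rw [← map_mul, ← Units.val_mul, mul_inv_cancel, Units.val_one, map_one]
  have hix : red ((x⁻¹ : GL (Fin 4) ℤ) : Matrix _ _ ℤ) * red (x : Matrix (Fin 4) (Fin 4) ℤ) = 1 := by
    rw [← map_mul, ← Units.val_mul, inv_mul_cancel, Units.val_one, map_one]
  generalize red (x : Matrix (Fin 4) (Fin 4) ℤ) = X at hx' hxi hix
  generalize red ((x⁻¹ : GL (Fin 4) ℤ) : Matrix _ _ ℤ) = Z at hxi hix
  have hc : red (cMat : Matrix (Fin 4) (Fin 4) ℤ) * fixedBasis = fixedBasis := by decide +kernel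
  have hj : (σ gen₃).j = 0 := by
    obtain ⟨e, m, k, -, -, h⟩ := exists_endo σ
    rw [h]
    exact mul_zero k
  have hc' : red (rep (σ gen₃) : Matrix (Fin 4) (Fin 4) ℤ) * fixedBasis = fixedBasis := by
    rw [red_rep_mul, hj]
    exact Matrix.mul_one _
  have h1 : X * fixedBasis = fixedBasis * (fixedCoord * (X * fixedBasis)) := by
    apply eq_fixedBasis_mul
    apply hfix
    rw [← Matrix.mul_assoc, ← hx', Matrix.mul_assoc, rep_c, hc]
  have h2 : Z * fixedBasis = fixedBasis * (fixedCoord * (Z * fixedBasis)) := by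
    apply eq_fixedBasis_mul
    have h3 : Z * red (rep (σ gen₃) : Matrix (Fin 4) (Fin 4) ℤ) =
        red (rep gen₃ : Matrix (Fin 4) (Fin 4) ℤ) * Z := by
      rw [← Matrix.mul_one (red (rep (σ gen₃) : Matrix (Fin 4) (Fin 4) ℤ)), ← hxi,
        ← Matrix.mul_assoc _ X, ← hx', Matrix.mul_assoc, ← Matrix.mul_assoc Z, hix, Matrix.one_mul]
    rw [← rep_c, ← Matrix.mul_assoc, ← h3, Matrix.mul_assoc, hc']
  generalize fixedCoord * (X * fixedBasis) = ξ at h1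
  generalize fixedCoord * (Z * fixedBasis) = η at h2
  have hPl : fixedCoord * fixedBasis = 1 := by decide +kernel
  have hcancel : ∀ U V : Matrix (Fin 2) (Fin 2) (ZMod 3), fixedBasis * U = fixedBasis * V → U = V := by
    intro U V h
    have := congrArg (fixedCoord * ·) h
    simpa only [← Matrix.mul_assoc, hPl, Matrix.one_mul] using this
  have h3 : ξ * η = 1 := by
    apply hcancel
    rw [← Matrix.mul_assoc, ← h1, Matrix.mul_assoc, ← h2, ← Matrix.mul_assoc, hxi, Matrix.one_mul,
      Matrix.mul_one]
  have h4 : ξ * fixedAction = fixedAction ^ (σ gen₈).j.val * ξ := by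
    apply hcancel
    have h5 := red_rep_mul gen₈
    rw [show (gen₈.j).val = 1 from rfl, pow_one] at h5
    rw [← Matrix.mul_assoc, ← h1, Matrix.mul_assoc, ← h5, ← Matrix.mul_assoc, hx',
      Matrix.mul_assoc, h1, ← Matrix.mul_assoc, red_rep_mul, Matrix.mul_assoc]
  calc (fixedAction ^ (σ gen₈).j.val).trace
      = (fixedAction ^ (σ gen₈).j.val * (ξ * η)).trace := by rw [h3, Matrix.mul_one]
    _ = (η * (ξ * fixedAction)).trace := by
        rw [← Matrix.mul_assoc, ← h4, Matrix.trace_mul_comm]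
    _ = fixedAction.trace := by
        rw [← Matrix.mul_assoc, mul_eq_one_comm.mp h3, Matrix.one_mul]

/-- The fifth power of `fixedAction` is its negative, and its trace 1 differs from `-1` modulo 3. -/
theorem quadraticAut_notMem_stabilizer : quadraticAut ∉ stabilizer := fun h => by
  have h1 := trace_eq_of_mem_stabilizer h
  have h2 : (quadraticAut gen₈).j.val = 5 := by decide +kernel
  rw [h2] at h1
  exact absurd h1 (by decide +kernel)

theorem mem_stabilizer_or (σ : MulAut Metacyclic) :
    σ ∈ stabilizer ∨ σ * quadraticAut ∈ stabilizer := by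
  rcases exists_dihedralAut σ with ⟨d, rfl⟩ | ⟨d, h⟩
  · exact Or.inl (dihedralAut_mem_stabilizer d)
  · exact Or.inr (h ▸ dihedralAut_mem_stabilizer d)

theorem stabilizer_index : stabilizer.index = 2 := by
  rw [Subgroup.index_eq_two_iff]
  refine ⟨quadraticAut, fun σ => ?_⟩
  rcases mem_stabilizer_or σ with h | h
  · refine Or.inr ⟨h, fun h' => quadraticAut_notMem_stabilizer ?_⟩
    have := mul_mem (inv_mem h) h'
    rwa [inv_mul_cancel_left] at this
  · refine Or.inl ⟨h, fun h' => quadraticAut_notMem_stabilizer ?_⟩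
    have := mul_mem (inv_mem h') h
    rwa [inv_mul_cancel_left] at this

theorem range_dihedralAut : dihedralAut.range = stabilizer := by
  apply le_antisymm
  · rintro _ ⟨d, rfl⟩
    exact dihedralAut_mem_stabilizer d
  · intro σ hσ
    rcases exists_dihedralAut σ with ⟨d, rfl⟩ | ⟨d, h⟩
    · exact ⟨d, rfl⟩
    · refine absurd ?_ quadraticAut_notMem_stabilizer
      have := mul_mem (inv_mem hσ) (h ▸ dihedralAut_mem_stabilizer d)
      rwa [inv_mul_cancel_left] at this

/-- Since `λ₄ ^ 4 = -1`, raising `λ₄` to the fifth power is the same as changing its sign. -/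
theorem rep_quadraticAut (g : Metacyclic) : rep (quadraticAut g) = twistedRep g := by
  have h : rep.comp quadraticAut.toMonoidHom = twistedRep := by
    refine MonoidHom.eq_of_eqOn_dense closure_generators ?_
    refine forall_generators ?_ ?_
    · change rep (quadraticAut gen₃) = _
      rw [twistedRep_of_even (by decide), show quadraticAut gen₃ = gen₃ by decide +kernel]
    · change rep (quadraticAut gen₈) = _
      rw [twistedRep_of_odd (by decide), show quadraticAut gen₈ = gen₈ ^ 4 * gen₈ by decide +kernel,
        map_mul, map_pow, rep_b, pow_mul _ 2 2, l4_sq_sq, neg_one_mul]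
  exact DFunLike.congr_fun h g

/-- Every nontrivial element has a power equal to the central involution or to the generator of
`C₃`, and neither acts trivially. -/
theorem rep_injective : Function.Injective rep := by
  rw [injective_iff_map_eq_one]
  intro g hg
  have h4 : rep (gen₈ ^ 4) ≠ 1 := fun h => by
    rw [map_pow, rep_b, pow_mul _ 2 2, l4_sq_sq] at h
    exact absurd (congrArg Units.val h) (by decide)
  have h3 : rep gen₃ ≠ 1 := fun h => by
    rw [rep_c] at h
    exact absurd (congrArg Units.val h) (by decide)
  have key : ∀ g : Metacyclic, g = 1 ∨ (∃ n : Fin 8, g ^ (n : ℕ) = gen₈ ^ 4) ∨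
      ∃ n : Fin 9, g ^ (n : ℕ) = gen₃ := by decide +kernel
  rcases key g with h | ⟨n, h⟩ | ⟨n, h⟩
  · exact h
  · rw [← h, map_pow, hg, one_pow] at h4
    exact absurd rfl h4
  · rw [← h, map_pow, hg, one_pow] at h3
    exact absurd rfl h3

theorem G7_eq_range : I4.G7 = rep.range := by
  rw [MonoidHom.range_eq_map, ← closure_generators, MonoidHom.map_closure]
  apply le_antisymm
  · rw [I4.G7, Subgroup.closure_le]
    have hb : I4.l4 ∈ Subgroup.closure (rep '' generators) :=
      Subgroup.subset_closure ⟨gen₈, by simp [generators], rep_b⟩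
    rintro _ (rfl | rfl)
    · rw [l1_eq]
      exact mul_mem (Subgroup.subset_closure ⟨gen₃, by simp [generators], rep_c⟩) (pow_mem hb 2)
    · exact hb
  · rw [Subgroup.closure_le]
    rintro _ ⟨g, hg, rfl⟩
    have hb : I4.l4 ∈ I4.G7 := Subgroup.subset_closure (Or.inr rfl)
    revert g
    refine forall_generators ?_ ?_
    · rw [rep_c, show cMat = I4.l1 * (I4.l4 ^ 2)⁻¹ by rw [l1_eq, mul_inv_cancel_right]]
      exact mul_mem (Subgroup.subset_closure (Or.inl rfl)) (inv_mem (pow_mem hb 2))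
    · rw [rep_b]
      exact hb

section Conjugate

variable {G : Subgroup (GL (Fin 4) ℤ)} (hG : IsConjSubgroup G rep.range)

include hG

/-- Carries the stabilizer computed in the abstract group to `autGL G` for an arbitrary conjugate,
the matrices `y` being conjugated by `x`. -/
theorem exists_param : ∃ (x : GL (Fin 4) ℤ) (ψ : Metacyclic ≃* G),
    (∀ g, (ψ g : GL (Fin 4) ℤ) = x * rep g * x⁻¹) ∧
      (autGL G).map (MulAut.congr ψ.symm).toMonoidHom = stabilizer := by
  obtain ⟨x, ψ, hψ⟩ := hG.exists_mulEquiv rep_injective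
  refine ⟨x, ψ, hψ, ?_⟩
  have h1 : ∀ g : G, (g : GL (Fin 4) ℤ) = x * rep (ψ.symm g) * x⁻¹ := fun g => by
    rw [← hψ, MulEquiv.apply_symm_apply]
  ext τ
  constructor
  · rintro ⟨σ, ⟨y, hy⟩, rfl⟩
    refine ⟨x⁻¹ * y * x, fun g => ?_⟩
    have h2 := hy (ψ g)
    rw [h1 (σ (ψ g)), hψ] at h2
    change rep (ψ.symm (σ (ψ g))) = _
    have h3 := congrArg (fun z => x⁻¹ * z * x) h2
    simp only [mul_assoc, inv_mul_cancel, mul_one, inv_mul_cancel_left] at h3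
    rw [h3]
    group
  · rintro ⟨y, hy⟩
    refine ⟨MulAut.congr ψ τ, ⟨x * y * x⁻¹, fun g => ?_⟩, ?_⟩
    · change (ψ (τ (ψ.symm g)) : GL (Fin 4) ℤ) = _
      rw [hψ, hy, h1 g]
      group
    · ext1 g
      change ψ.symm (ψ (τ (ψ.symm (ψ g)))) = τ g
      rw [MulEquiv.symm_apply_apply, MulEquiv.symm_apply_apply]

theorem autGL_index : (autGL G).index = 2 := by
  obtain ⟨x, ψ, -, h⟩ := exists_param hG
  rw [← stabilizer_index, ← h]
  exact (Subgroup.index_map_equiv _ (MulAut.congr ψ.symm)).symm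

theorem autGL_mulEquiv : Nonempty (autGL G ≃* DihedralGroup 6) := by
  obtain ⟨x, ψ, -, h⟩ := exists_param hG
  exact ⟨(((MulAut.congr ψ.symm).subgroupMap (autGL G)).trans
    (MulEquiv.subgroupCongr (h.trans range_dihedralAut.symm))).trans
    (MonoidHom.ofInjective dihedralAut_injective).symm⟩

/-- Outside `autGL G` the automorphism is, up to integral conjugation, the quadratic one, and
composing `rep` with it gives `twistedRep`. -/
theorem isStablyRational_tensor_twist {k L : Type*} [Field k] [Field L] [Algebra k L]
    [FiniteDimensional k L] [IsGalois k L] {φ : (L ≃ₐ[k] L) ≃* (G)ᵐᵒᵖ} {σ : MulAut G}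
    (hσ : σ ∉ autGL G) {A : Type*} [CommRing A] [HopfAlgebra k A] {A' : Type*} [CommRing A']
    [HopfAlgebra k A'] (hA : HasCharacterModule k L A G φ)
    (hA' : HasCharacterModule k L A' G (twist φ σ)) : IsStablyRational k (A ⊗[k] A') := by
  obtain ⟨x, ψ, hψ, h⟩ := exists_param hG
  have h1 : MulAut.congr ψ.symm σ * quadraticAut ∈ stabilizer := by
    refine (mem_stabilizer_or _).resolve_left fun h2 => hσ ?_
    rw [← h] at h2
    obtain ⟨σ', h3, h4⟩ := h2
    rwa [(MulAut.congr ψ.symm).injective h4] at h3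
  obtain ⟨y, hy⟩ := h1
  have h2 : ∀ g, (σ (ψ g) : GL (Fin 4) ℤ) = x * (y * twistedRep g * y⁻¹) * x⁻¹ := fun g => by
    have hq : quadraticAut (quadraticAut g) = g := quadraticAut.left_inv g
    have h3 := hy (quadraticAut g)
    rw [MulAut.mul_apply, hq, rep_quadraticAut] at h3
    rw [← h3, ← hψ]
    change _ = ((ψ (ψ.symm (σ (ψ g))) : G) : GL (Fin 4) ℤ)
    rw [MulEquiv.apply_symm_apply]
  refine isStablyRational_tensor_rep (galoisParam φ ψ).toMonoidHom
    (hA.isSplitWith_of_conj _ x fun s => ?_) (hA'.isSplitWith_of_conj _ (x * y) fun s => ?_)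
  · rw [galoisParam_spec φ ψ s, hψ]
    rfl
  · change ((σ (φ s).unop : G) : GL (Fin 4) ℤ) = _ * twistedRep (galoisParam φ ψ s)⁻¹ * _
    rw [galoisParam_spec φ ψ s, h2]
    group

end Conjugate

end Metacyclic

end MetacyclicAut

/-! ### Permutation modules of a cyclic group of prime order -/

section PermutationCohomology

open Finset

variable {X Y : Type*} {p : ℕ} [Fact p.Prime]

theorem Equiv.Perm.minimalPeriod_eq {c : Equiv.Perm X} (hc : c ^ p = 1) {x : X} (hx : c x ≠ x) :
    Function.minimalPeriod c x = p := by
  refine Function.minimalPeriod_eq_prime ?_ hx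
  rw [Function.IsPeriodicPt, Function.IsFixedPt, ← Equiv.Perm.coe_pow, hc]
  rfl

/-- A function whose norm is the indicator function of the points that are not fixed. -/
theorem Equiv.Perm.exists_norm_eq_indicator {c : Equiv.Perm X} (hc : c ^ p = 1) :
    ∃ e : X → ℤ, ∀ x, (c x = x → e x = 0) ∧ (c x ≠ x → ∑ i ∈ range p, e ((c ^ i) x) = 1) := by
  classical
  have := Fact.out (p := p.Prime)
  let S := Equiv.Perm.SameCycle.setoid c
  -- The function marks one chosen point in each nontrivial orbit.
  refine ⟨fun x => if c x ≠ x ∧ (Quotient.out (Quotient.mk S x)) = x then 1 else 0, fun x =>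
    ⟨fun h => by simp [h], fun h => ?_⟩⟩
  have hper := Equiv.Perm.minimalPeriod_eq hc h
  have hinj : ∀ i < p, ∀ l < p, (c ^ i) x = (c ^ l) x → i = l := by
    intro i hi l hl hil
    rw [Equiv.Perm.coe_pow, Equiv.Perm.coe_pow] at hil
    exact Function.iterate_injOn_Iio_minimalPeriod (f := c) (x := x)
      (by rw [hper]; exact hi) (by rw [hper]; exact hl) hil
  have hmk : ∀ i : ℕ, Quotient.mk S ((c ^ i) x) = Quotient.mk S x := fun i =>
    Quotient.sound (Equiv.Perm.SameCycle.symm ⟨i, by simp⟩)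
  obtain ⟨n, hn⟩ : ∃ n < p, (c ^ n) x = Quotient.out (Quotient.mk S x) := by
    obtain ⟨z, hz⟩ : c.SameCycle x (Quotient.out (Quotient.mk S x)) :=
      Equiv.Perm.SameCycle.symm (Quotient.exact (Quotient.out_eq (Quotient.mk S x)))
    have hp0 : (p : ℤ) ≠ 0 := by exact_mod_cast this.ne_zero
    refine ⟨(z % p).toNat, ?_, ?_⟩
    · have := Int.emod_lt_of_pos z (b := p) (by positivity)
      have := Int.emod_nonneg z hp0
      omega
    · rw [← hz, ← zpow_natCast, Int.toNat_of_nonneg (Int.emod_nonneg z hp0)]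
      conv_rhs => rw [← Int.emod_add_mul_ediv z p, zpow_add, zpow_mul, zpow_natCast, hc]
      simp
  rw [Finset.sum_eq_single n]
  · dsimp only
    rw [if_pos]
    refine ⟨fun h1 => h ?_, by rw [hmk, hn.2]⟩
    rw [← Equiv.Perm.mul_apply, ← pow_succ', pow_succ, Equiv.Perm.mul_apply] at h1
    exact (c ^ n).injective h1
  · intro i hi hin
    dsimp only
    rw [if_neg]
    rintro ⟨-, h1⟩
    rw [hmk, ← hn.2] at h1
    exact hin (hinj i (Finset.mem_range.mp hi) n hn.1 h1.symm)
  · intro h1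
    exact absurd (Finset.mem_range.mpr hn.1) h1

theorem Equiv.Perm.pow_apply_of_fixed {c : Equiv.Perm X} {x : X} (hx : c x = x) (i : ℕ) :
    (c ^ i) x = x := by
  induction i with
  | zero => rfl
  | succ i ih => rw [pow_succ, Equiv.Perm.mul_apply, hx, ih]

theorem Equiv.Perm.apply_pow_of_invariant {c : Equiv.Perm X} {φ : X → ℤ} (hφ : ∀ x, φ (c x) = φ x)
    (i : ℕ) (x : X) : φ ((c ^ i) x) = φ x := by
  induction i with
  | zero => rfl
  | succ i ih => rw [pow_succ', Equiv.Perm.mul_apply, hφ, ih]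

/-- An invariant function is a norm away from the fixed points. -/
theorem Equiv.Perm.exists_norm_of_invariant {c : Equiv.Perm X} (hc : c ^ p = 1) {φ : X → ℤ}
    (hφ : ∀ x, φ (c x) = φ x) :
    ∃ ψ : X → ℤ, ∀ x, (c x = x → ψ x = 0) ∧ (c x ≠ x → ∑ i ∈ range p, ψ ((c ^ i) x) = φ x) := by
  obtain ⟨e, he⟩ := Equiv.Perm.exists_norm_eq_indicator hc
  refine ⟨fun x => e x * φ x, fun x => ⟨fun h => by simp [(he x).1 h], fun h => ?_⟩⟩
  simp only [Equiv.Perm.apply_pow_of_invariant hφ]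
  rw [← Finset.sum_mul, (he x).2 h, one_mul]

/-- The first cohomology group of a permutation module vanishes. -/
theorem Equiv.Perm.exists_sub_eq_of_norm_eq_zero {c : Equiv.Perm X} (hc : c ^ p = 1) {φ : X → ℤ}
    (hφ : ∀ x, ∑ i ∈ range p, φ ((c ^ i) x) = 0) : ∃ n : X → ℤ, ∀ x, n (c x) - n x = φ x := by
  have := Fact.out (p := p.Prime)
  obtain ⟨e, he⟩ := Equiv.Perm.exists_norm_eq_indicator hc
  -- The partial sums of `φ` along the orbit, weighted by `e`, form an explicit primitive. The
  -- weights have norm 1 on nontrivial orbits. At fixed points `φ` vanishes because `p φ = 0`.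
  refine ⟨fun x => -∑ i ∈ range p, e ((c ^ i) x) * ∑ k ∈ range i, φ ((c ^ k) x), fun x => ?_⟩
  by_cases h : c x = x
  · have h1 := hφ x
    simp only [Equiv.Perm.pow_apply_of_fixed h, Finset.sum_const, Finset.card_range,
      nsmul_eq_mul, mul_eq_zero, Nat.cast_eq_zero, this.ne_zero, false_or] at h1
    rw [h, h1, sub_self]
  · have h1 : ∀ i, (c ^ i) (c x) = (c ^ (i + 1)) x := fun i => by
      rw [pow_succ, Equiv.Perm.mul_apply]
    have h2 : ∀ i, ∑ k ∈ range i, φ ((c ^ k) (c x)) = ∑ k ∈ range (i + 1), φ ((c ^ k) x) - φ x := by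
      intro i
      rw [Finset.sum_range_succ']
      simp [h1]
    have h3 := Finset.sum_range_succ' (fun i => e ((c ^ i) x) * ∑ k ∈ range i, φ ((c ^ k) x)) p
    rw [Finset.sum_range_succ, hφ, mul_zero, add_zero, Finset.sum_range_zero, mul_zero,
      add_zero] at h3
    have h4 := (he (c x)).2 fun h5 => h (c.injective h5)
    simp only [h1] at h4
    simp only [h2]
    simp only [h1, mul_sub, Finset.sum_sub_distrib, ← Finset.sum_mul, h4]
    rw [h3]
    ring

/-- The trace of an endomorphism is additive on an exact sequence. -/
theorem LinearMap.trace_eq_add_of_exact {K A B C : Type*} [Field K] [AddCommGroup A] [Module K A]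
    [AddCommGroup B] [Module K B] [AddCommGroup C] [Module K C] [FiniteDimensional K A]
    [FiniteDimensional K B] [FiniteDimensional K C] {α : A →ₗ[K] B} {δ : B →ₗ[K] C}
    (hα : Function.Injective α) (hδ : Function.Surjective δ)
    (hex : ∀ b, δ b = 0 ↔ ∃ a, α a = b) {fA : A →ₗ[K] A} {fB : B →ₗ[K] B} {fC : C →ₗ[K] C}
    (h1 : ∀ a, α (fA a) = fB (α a)) (h2 : ∀ b, δ (fB b) = fC (δ b)) :
    LinearMap.trace K B fB = LinearMap.trace K A fA + LinearMap.trace K C fC := by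
  obtain ⟨ρ, hρ⟩ := α.exists_leftInverse_of_injective (LinearMap.ker_eq_bot.mpr hα)
  obtain ⟨τ, hτ⟩ := δ.exists_rightInverse_of_surjective (LinearMap.range_eq_top.mpr hδ)
  have hρ' : ∀ a, ρ (α a) = a := fun a => LinearMap.congr_fun hρ a
  have hτ' : ∀ a, δ (τ a) = a := fun a => LinearMap.congr_fun hτ a
  have hδα : ∀ a, δ (α a) = 0 := fun a => (hex _).mpr ⟨a, rfl⟩
  -- The section is corrected so that `ρ` vanishes on its image. The identity is then the sum of `α
  -- ∘ ρ` and `υ ∘ δ`, and cyclicity of the trace splits the trace of `fB`.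
  let υ : C →ₗ[K] B := τ - α ∘ₗ ρ ∘ₗ τ
  have h3 : fB = fB ∘ₗ α ∘ₗ ρ + fB ∘ₗ υ ∘ₗ δ := by
    ext b
    obtain ⟨a, ha⟩ := (hex (b - τ (δ b))).mp (by rw [map_sub, hτ', sub_self])
    have hb : b = α a + τ (δ b) := by rw [ha]; abel
    simp only [υ, LinearMap.add_apply, LinearMap.comp_apply, LinearMap.sub_apply, ← map_add]
    congr 1
    have h4 : α (ρ b) = α a + α (ρ (τ (δ b))) := by
      conv_lhs => rw [hb, map_add, map_add, hρ']
    rw [h4]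
    conv_lhs => rw [hb]
    abel
  have h4 : ρ ∘ₗ fB ∘ₗ α = fA := by
    ext a
    simp only [LinearMap.comp_apply, ← h1, hρ']
  have h5 : δ ∘ₗ fB ∘ₗ υ = fC := by
    ext b
    simp only [υ, LinearMap.comp_apply, h2, LinearMap.sub_apply, map_sub, hδα, hτ', map_zero,
      sub_zero]
  conv_lhs => rw [h3]
  rw [map_add, ← LinearMap.comp_assoc, ← LinearMap.comp_assoc,
    LinearMap.trace_comp_comm' ρ (fB ∘ₗ α), LinearMap.trace_comp_comm' δ (fB ∘ₗ υ), h4, h5]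

theorem LinearMap.trace_funLeft {K : Type*} [Field K] [Fintype X] [DecidableEq X] (σ : X → X) :
    LinearMap.trace K (X → K) (LinearMap.funLeft K K σ) = ∑ x, if σ x = x then 1 else 0 := by
  rw [LinearMap.trace_eq_matrix_trace K (Pi.basisFun K X), Matrix.trace]
  refine Finset.sum_congr rfl fun x _ => ?_
  rw [Matrix.diag_apply, LinearMap.toMatrix_apply]
  simp [LinearMap.funLeft_apply, Pi.single_apply]

end PermutationCohomology

/-! ### Fixed points and traces in Tate cohomology. -/

section TraceRelation

open Finset

variable {X Y : Type*} {p : ℕ}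

theorem apply_eq_sum_single [Fintype X] [DecidableEq X] (q : (X → ℤ) →+ (Y → ℤ)) (n : X → ℤ) (y : Y) :
    q n y = ∑ x, n x * q (Pi.single x 1) y := by
  conv_lhs => rw [← Finset.univ_sum_single n, map_sum]
  rw [Finset.sum_apply]
  refine Finset.sum_congr rfl fun x _ => ?_
  have : (Pi.single x (n x) : X → ℤ) = n x • Pi.single x 1 := by
    rw [← Pi.single_smul, smul_eq_mul, mul_one]
  rw [this, map_zsmul, Pi.smul_apply, smul_eq_mul]

theorem map_norm (q : (X → ℤ) →+ (Y → ℤ)) (c : Equiv.Perm X) (c' : Equiv.Perm Y)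
    (hq : ∀ n y, q (fun x => n (c x)) y = q n (c' y)) (N : ℕ) (n : X → ℤ) (y : Y) :
    q (fun x => ∑ i ∈ range N, n ((c ^ i) x)) y = ∑ i ∈ range N, q n ((c' ^ i) y) := by
  have h1 : ∀ i : ℕ, ∀ n y, q (fun x => n ((c ^ i) x)) y = q n ((c' ^ i) y) := by
    intro i
    induction i with
    | zero => intro n y; rfl
    | succ i ih =>
      intro n y
      simp only [pow_succ', Equiv.Perm.mul_apply]
      rw [ih (fun x => n (c x)), hq]
  have h2 : (fun x => ∑ i ∈ range N, n ((c ^ i) x)) = ∑ i ∈ range N, fun x => n ((c ^ i) x) := by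
    ext x; rw [Finset.sum_apply]
  rw [h2, map_sum, Finset.sum_apply]
  exact Finset.sum_congr rfl fun i _ => h1 i n y

theorem norm_apply_cycle {c : Equiv.Perm X} (hc : c ^ p = 1) (n : X → ℤ) (x : X) :
    ∑ i ∈ range p, n ((c ^ i) (c x)) = ∑ i ∈ range p, n ((c ^ i) x) := by
  have h1 : ∀ i, (c ^ i) (c x) = (c ^ (i + 1)) x := fun i => by
    rw [pow_succ, Equiv.Perm.mul_apply]
  simp only [h1]
  have h2 := Finset.sum_range_succ' (fun i => n ((c ^ i) x)) p
  rw [Finset.sum_range_succ, hc, pow_zero] at h2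
  exact (add_right_cancel h2).symm

theorem norm_apply_fixed {c : Equiv.Perm X} (n : X → ℤ) {x : X} (hx : c x = x) :
    ∑ i ∈ range p, n ((c ^ i) x) = p * n x := by
  simp [Equiv.Perm.pow_apply_of_fixed hx]

/-- Let `0 → M → ℤ^X → ℤ^Y → 0` be an exact sequence with equivariant maps, where `c` has prime
order `p` and no invariants in `M`, and `f` normalizes `⟨c⟩`.  Then the numbers of fixed points of
`f` on `X^c` and on `Y^c` are related through the trace of `f` on `M / (c - 1) M`. -/
theorem card_fixed_eq_add_trace [Fintype X] [Fintype Y] [DecidableEq X] [DecidableEq Y]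
    [Fact p.Prime] {M : Type*} [AddCommGroup M]
    (cM fM : M → M) (cX fX : Equiv.Perm X) (cY fY : Equiv.Perm Y) (j : M →+ (X → ℤ))
    (q : (X → ℤ) →+ (Y → ℤ)) (hj : Function.Injective j) (hq : Function.Surjective q)
    (hex : ∀ n, q n = 0 ↔ ∃ m, j m = n) (hjc : ∀ m x, j (cM m) x = j m (cX x))
    (hjf : ∀ m x, j (fM m) x = j m (fX x)) (hqc : ∀ n y, q (fun x => n (cX x)) y = q n (cY y))
    (hqf : ∀ n y, q (fun x => n (fX x)) y = q n (fY y)) (hcX : cX ^ p = 1) (hcY : cY ^ p = 1)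
    {a : ℕ} (ha : fX * cX = cX ^ a * fX) (hfX : ∀ x, cX x = x → cX (fX x) = fX x)
    (hfY : ∀ y, cY y = y → cY (fY y) = fY y) (hM : ∀ m, cM m = m → m = 0) {V : Type*}
    [AddCommGroup V] [Module (ZMod p) V] [FiniteDimensional (ZMod p) V] (ℓ : M →+ V)
    (hℓ : Function.Surjective ℓ) (hker : ∀ m, ℓ m = 0 ↔ ∃ m', m = cM m' - m')
    (g : V →ₗ[ZMod p] V) (hg : ∀ m, ℓ (fM m) = g (ℓ m)) :
    (∑ y : {y // cY y = y}, if fY y = y then 1 else 0 : ZMod p) =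
      (∑ x : {x // cX x = x}, if fX x = x then 1 else 0) + a * LinearMap.trace (ZMod p) V g := by
  have hlift : ∀ n : Y → ℤ, ∃ n' : X → ℤ, q n' = n := hq
  -- chosen lifts of the fixed basis vectors
  have hd : ∀ y : {y // cY y = y}, ∃ (n : X → ℤ) (m : M), q n = Pi.single (y : Y) 1 ∧
      ∀ x, n (cX x) - n x = j m x := by
    intro y
    obtain ⟨n, hn⟩ := hq (Pi.single (y : Y) 1)
    have h1 : q (fun x => n (cX x) - n x) = 0 := by
      ext z
      have : (fun x => n (cX x) - n x) = (fun x => n (cX x)) - n := rfl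
      rw [this, map_sub, Pi.sub_apply, hqc, hn, Pi.zero_apply, Pi.single_apply, Pi.single_apply]
      have : cY z = y ↔ z = y :=
        ⟨fun h => cY.injective (h.trans y.2.symm), fun h => by rw [h, y.2]⟩
      simp only [this, sub_self]
    obtain ⟨m, hm⟩ := (hex _).mp h1
    exact ⟨n, m, hn, fun x => (congrFun hm x).symm⟩
  choose nn d hnn hd using hd
  -- The Tate cohomology of a permutation lattice in degree 0 has the fixed points as an
  -- `𝔽_p`-basis: free orbits contribute only norms, and fixed points are taken modulo `p`. Here `α`
  -- is the map induced by `q`, and `δ` below is the connecting map to `M / (c - 1) M`.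
  let α : ({x // cX x = x} → ZMod p) →ₗ[ZMod p] ({y // cY y = y} → ZMod p) :=
    Matrix.mulVecLin (Matrix.of fun (y : {y // cY y = y}) (x : {x // cX x = x}) =>
      ((q (Pi.single (x : X) 1) (y : Y) : ℤ) : ZMod p))
  let δ : ({y // cY y = y} → ZMod p) →ₗ[ZMod p] V :=
    Fintype.linearCombination (ZMod p) fun y => ℓ (d y)
  have hα : ∀ (Φ : X → ℤ), (∀ x, cX x ≠ x → Φ x = 0) → ∀ y : {y // cY y = y},
      α (fun x => (Φ x : ZMod p)) y = (q Φ y : ℤ) := by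
    intro Φ hΦ y
    rw [apply_eq_sum_single q]
    push_cast
    have h1 : ∀ x, ((Φ x : ZMod p) * (q (Pi.single x 1) y : ℤ)) ≠ 0 → cX x = x := by
      intro x hx
      by_contra h
      rw [hΦ x h] at hx
      simp at hx
    rw [← Finset.sum_filter_of_ne fun x _ => h1 x, ← Finset.sum_subtype_eq_sum_filter]
    simp only [α, Matrix.mulVecLin_apply, Matrix.mulVec, dotProduct, Matrix.of_apply]
    refine Finset.sum_bij' (fun x _ => x) (fun x _ => x) ?_ ?_ ?_ ?_ ?_ <;> simp [mul_comm]
  have hinv : ∀ n m, (∀ x, n (cX x) - n x = j m x) → ∀ y, q n (cY y) = q n y := by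
    intro n m h y
    have h1 : (fun x => n (cX x)) = n + j m := funext fun x => by
      rw [Pi.add_apply, ← h x]; ring
    rw [← hqc, h1, map_add, (hex (j m)).mpr ⟨m, rfl⟩, add_zero]
  have hsum : ∀ (Ψ : Y → ℤ) z, (∑ y : {y // cY y = y}, Ψ y * (Pi.single (y : Y) 1 : Y → ℤ) z) =
      if cY z = z then Ψ z else 0 := by
    intro Ψ z
    split_ifs with hz
    · rw [Finset.sum_eq_single ⟨z, hz⟩]
      · simp
      · intro y _ hy
        rw [Pi.single_apply, if_neg fun h => hy (Subtype.ext h.symm), mul_zero]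
      · simp
    · refine Finset.sum_eq_zero fun y _ => ?_
      rw [Pi.single_apply, if_neg fun h => hz (by rw [h, y.2]), mul_zero]
  have hqnn : ∀ (Ψ : Y → ℤ) z, q (∑ y : {y // cY y = y}, Ψ y • nn y) z =
      if cY z = z then Ψ z else 0 := by
    intro Ψ z
    simp only [map_sum, map_zsmul, hnn, Finset.sum_apply, Pi.smul_apply, smul_eq_mul, hsum]
  have hjd : ∀ (Ψ : Y → ℤ) x, (∑ y : {y // cY y = y}, Ψ y • nn y) (cX x) -
      (∑ y : {y // cY y = y}, Ψ y • nn y) x = j (∑ y : {y // cY y = y}, Ψ y • d y) x := by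
    intro Ψ x
    simp only [map_sum, map_zsmul, Finset.sum_apply, Pi.smul_apply, ← Finset.sum_sub_distrib,
      ← smul_sub, hd]
  have hδd : ∀ Ψ : Y → ℤ, ℓ (∑ y : {y // cY y = y}, Ψ y • d y) =
      δ (fun y => (Ψ y : ZMod p)) := by
    intro Ψ
    simp only [δ, Fintype.linearCombination_apply, map_sum, map_zsmul, Int.cast_smul_eq_zsmul]
  -- the characterization of `δ`
  have key : ∀ n m, (∀ x, n (cX x) - n x = j m x) → δ (fun y => (q n y : ZMod p)) = ℓ m := by
    intro n m h
    obtain ⟨ψ, hψ⟩ := Equiv.Perm.exists_norm_of_invariant hcY (hinv n m h)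
    obtain ⟨n', hn'⟩ := hlift ψ
    -- Subtracting a norm and the chosen lifts leaves an element of `M`. The norm does not affect
    -- the coboundary, and the element of `M` changes `m` only by `(c - 1) m'`.
    have h1 : q (n - (fun x => ∑ i ∈ range p, n' ((cX ^ i) x)) -
        ∑ y : {y // cY y = y}, q n y • nn y) = 0 := by
      ext z
      rw [map_sub, map_sub, Pi.sub_apply, Pi.sub_apply, map_norm q cX cY hqc, hqnn, hn',
        Pi.zero_apply]
      split_ifs with hz
      · rw [norm_apply_fixed _ hz, (hψ z).1 hz]; ring
      · rw [(hψ z).2 hz]; ring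
    obtain ⟨m', hm'⟩ := (hex _).mp h1
    have h2 : m = ∑ y : {y // cY y = y}, q n y • d y + (cM m' - m') := by
      apply hj
      ext x
      rw [map_add, map_sub, Pi.add_apply, Pi.sub_apply, hjc, hm', ← h, ← hjd]
      simp only [Pi.sub_apply, norm_apply_cycle hcX]
      ring
    rw [h2, map_add, (hker _).mpr ⟨m', rfl⟩, add_zero, hδd]
  have hrepY : ∀ ψ : {y // cY y = y} → ZMod p, ∃ n m, (∀ x, n (cX x) - n x = j m x) ∧
      (fun y : {y // cY y = y} => (q n y : ZMod p)) = ψ ∧ ℓ m = δ ψ := by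
    intro ψ
    let Ψ : Y → ℤ := fun y => if h : cY y = y then ((ψ ⟨y, h⟩).val : ℤ) else 0
    have hΨ : (fun y : {y // cY y = y} => (Ψ y : ZMod p)) = ψ := by
      ext y
      simp only [Ψ, dif_pos y.2]
      simp
    refine ⟨_, _, hjd Ψ, ?_, ?_⟩
    · conv_rhs => rw [← hΨ]
      ext y
      rw [hqnn, if_pos y.2]
    · rw [hδd, hΨ]
  have hrepX : ∀ φ : {x // cX x = x} → ZMod p, ∃ Φ : X → ℤ, (∀ x, cX x ≠ x → Φ x = 0) ∧
      (∀ x, Φ (cX x) = Φ x) ∧ (fun x : {x // cX x = x} => (Φ x : ZMod p)) = φ := by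
    intro φ
    refine ⟨fun x => if h : cX x = x then ((φ ⟨x, h⟩).val : ℤ) else 0, fun x hx => dif_neg hx,
      fun x => ?_, ?_⟩
    · by_cases h : cX x = x
      · rw [h]
      · dsimp only
        rw [dif_neg h, dif_neg fun h1 => h (cX.injective h1)]
    · ext x
      dsimp only
      rw [dif_pos x.2]
      simp
  have hα_inj : Function.Injective α := by
    rw [injective_iff_map_eq_zero]
    intro φ hφ
    obtain ⟨Φ, hΦ, hΦc, rfl⟩ := hrepX φ
    have h1 : ∀ y, q Φ (cY y) = q Φ y := fun y => by
      rw [← hqc]; simp only [hΦc]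
    obtain ⟨ψ, hψ⟩ := Equiv.Perm.exists_norm_of_invariant hcY h1
    -- The kernel condition makes `q Φ` divisible by `p` at the fixed points, so `q Φ` is a norm
    -- everywhere. Thus `Φ` minus a norm is an invariant of `M`, and so vanishes.
    obtain ⟨n', hn'⟩ := hlift (fun y => if cY y = y then q Φ y / p else ψ y)
    have h2 : q (Φ - fun x => ∑ i ∈ range p, n' ((cX ^ i) x)) = 0 := by
      ext z
      rw [map_sub, Pi.sub_apply, map_norm q cX cY hqc, hn', Pi.zero_apply]
      by_cases hz : cY z = z
      · rw [norm_apply_fixed (fun y => if cY y = y then q Φ y / p else ψ y) hz]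
        rw [if_pos hz]
        have h3 : ((q Φ z : ℤ) : ZMod p) = 0 := by
          rw [← hα Φ hΦ ⟨z, hz⟩, hφ]; rfl
        rw [ZMod.intCast_zmod_eq_zero_iff_dvd] at h3
        rw [Int.mul_ediv_cancel' h3, sub_self]
      · have h3 : ∀ i, cY ((cY ^ i) z) ≠ (cY ^ i) z := fun i h => hz <| by
          rw [← Equiv.Perm.mul_apply, ← pow_succ', pow_succ, Equiv.Perm.mul_apply] at h
          exact (cY ^ i).injective h
        simp only [if_neg (h3 _)]
        rw [(hψ z).2 hz, sub_self]
    obtain ⟨m, hm⟩ := (hex _).mp h2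
    have h3 : m = 0 := by
      apply hM
      apply hj
      ext x
      rw [hjc, hm]
      simp only [Pi.sub_apply, hΦc, norm_apply_cycle hcX]
    ext x
    have h4 := congrFun hm x
    rw [h3, map_zero, Pi.zero_apply, Pi.sub_apply, norm_apply_fixed _ x.2] at h4
    rw [sub_eq_zero.mp h4.symm]
    simp
  have hδ_surj : Function.Surjective δ := by
    intro v
    obtain ⟨m, rfl⟩ := hℓ v
    -- The norm of `m` is an invariant of `M`, hence zero. Vanishing of the first cohomology of
    -- `ℤ^X` then writes `j m` as a coboundary.
    have h1 : q (fun x => ∑ i ∈ range p, j m ((cX ^ i) x)) = 0 := by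
      ext y
      rw [map_norm q cX cY hqc, (hex (j m)).mpr ⟨m, rfl⟩]
      simp
    obtain ⟨μ, hμ⟩ := (hex _).mp h1
    have h2 : μ = 0 := by
      apply hM
      apply hj
      ext x
      rw [hjc, hμ]
      exact norm_apply_cycle hcX _ _
    rw [h2, map_zero] at hμ
    obtain ⟨n, hn⟩ := Equiv.Perm.exists_sub_eq_of_norm_eq_zero hcX
      (φ := j m) fun x => (congrFun hμ x).symm
    exact ⟨_, key n m hn⟩
  have hexact : ∀ ψ, δ ψ = 0 ↔ ∃ φ, α φ = ψ := by
    intro ψ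
    constructor
    · intro hψ
      obtain ⟨n, m, h1, h2, h3⟩ := hrepY ψ
      obtain ⟨m', hm'⟩ := (hker m).mp (h3.trans hψ)
      have h4 : ∀ x, (n - j m') (cX x) = (n - j m') x := by
        intro x
        have h5 := h1 x
        rw [hm', map_sub, Pi.sub_apply, hjc] at h5
        rw [Pi.sub_apply, Pi.sub_apply]
        linarith
      obtain ⟨n', hn'⟩ := Equiv.Perm.exists_norm_of_invariant hcX h4
      let Φ : X → ℤ := fun x => if cX x = x then (n - j m') x else 0
      have h5 : n = Φ + (fun x => ∑ i ∈ range p, n' ((cX ^ i) x)) + j m' := by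
        ext x
        simp only [Pi.add_apply, Φ]
        split_ifs with hx
        · rw [norm_apply_fixed _ hx, (hn' x).1 hx, Pi.sub_apply]; ring
        · rw [(hn' x).2 hx, Pi.sub_apply]; ring
      refine ⟨fun x => (Φ x : ZMod p), ?_⟩
      rw [← h2]
      ext y
      rw [hα Φ fun x hx => if_neg hx]
      conv_rhs => rw [h5, map_add, map_add, Pi.add_apply, Pi.add_apply, map_norm q cX cY hqc,
        norm_apply_fixed _ y.2, (hex (j m')).mpr ⟨m', rfl⟩]
      simp
    · rintro ⟨φ, rfl⟩
      obtain ⟨Φ, hΦ, hΦc, rfl⟩ := hrepX φ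
      rw [show α (fun x => (Φ x : ZMod p)) = _ from funext (hα Φ hΦ), key Φ 0, map_zero]
      intro x
      rw [hΦc, sub_self, map_zero, Pi.zero_apply]
  let FX : ({x // cX x = x} → ZMod p) →ₗ[ZMod p] ({x // cX x = x} → ZMod p) :=
    LinearMap.funLeft _ _ fun x => ⟨fX x, hfX x x.2⟩
  let FY : ({y // cY y = y} → ZMod p) →ₗ[ZMod p] ({y // cY y = y} → ZMod p) :=
    LinearMap.funLeft _ _ fun y => ⟨fY y, hfY y y.2⟩
  have hαF : ∀ φ, α (FX φ) = FY (α φ) := by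
    intro φ
    obtain ⟨Φ, hΦ, hΦc, rfl⟩ := hrepX φ
    ext y
    rw [show FY (α fun x => (Φ x : ZMod p)) y = α (fun x => (Φ x : ZMod p)) ⟨fY y, hfY y y.2⟩
      from rfl, hα Φ hΦ]
    refine (hα (fun x => Φ (fX x)) (fun x hx => hΦ _ fun h => hx ?_) y).trans ?_
    · apply fX.injective
      rw [← Equiv.Perm.mul_apply, ha, Equiv.Perm.mul_apply, Equiv.Perm.pow_apply_of_fixed h]
    · rw [hqf]
  have hδF : ∀ ψ, δ (FY ψ) = ((a : ZMod p) • g) (δ ψ) := by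
    intro ψ
    obtain ⟨n, m, h1, h2, h3⟩ := hrepY ψ
    have hcm : ∀ m, ℓ (cM m) = ℓ m := fun m => by
      rw [← sub_eq_zero, ← map_sub]
      exact (hker _).mpr ⟨m, rfl⟩
    have h4 : ∀ i : ℕ, ℓ (fM (cM^[i] m)) = g (ℓ m) := fun i => by
      rw [hg]
      congr 1
      induction i with
      | zero => rfl
      | succ i ih => rw [Function.iterate_succ_apply', hcm, ih]
    have h5 : ∀ (i : ℕ) x, j (cM^[i] m) x = j m ((cX ^ i) x) := fun i => by
      induction i with
      | zero => intro x; rfl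
      | succ i ih =>
        intro x
        rw [Function.iterate_succ_apply', hjc, ih, pow_succ, Equiv.Perm.mul_apply]
    -- Moving `fX` past `cX` produces `cX ^ a`, whose difference telescopes into `a` terms. All have
    -- the same class modulo `c - 1`, which is the source of the factor `a`.
    have h6 := key (fun x => n (fX x)) (∑ i ∈ range a, fM (cM^[i] m)) fun x => by
      rw [← Equiv.Perm.mul_apply, ha, Equiv.Perm.mul_apply, map_sum, Finset.sum_apply]
      simp only [hjf, h5, ← h1, ← Equiv.Perm.mul_apply]
      simp only [← mul_assoc, ← pow_succ']
      simp only [Equiv.Perm.mul_apply]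
      rw [Finset.sum_range_sub (fun i => n ((cX ^ i) (fX x)))]
      rfl
    have h7 : (fun y : {y // cY y = y} => (q (fun x => n (fX x)) y : ZMod p)) = FY ψ := by
      rw [← h2]
      ext y
      rw [hqf]
      rfl
    rw [← h7, h6, map_sum, LinearMap.smul_apply, ← h3]
    simp only [h4, Finset.sum_const, Finset.card_range, Nat.cast_smul_eq_nsmul]
  have h := LinearMap.trace_eq_add_of_exact hα_inj hδ_surj hexact hαF hδF
  rw [LinearMap.trace_funLeft, LinearMap.trace_funLeft, map_smul, smul_eq_mul] at h
  simpa only [Subtype.ext_iff] using h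

end TraceRelation

/-! ### Permutation resolutions and their obstruction. -/

section QuasiPermutation

/-- There is an equivariant exact sequence `0 → M → ℤ^X → ℤ^Y → 0` with finite `Γ`-sets `X` and
`Y`, where `Γ` acts on `M` through `a`. -/
def HasPermutationResolution {Γ M : Type*} [Group Γ] [AddCommGroup M] (a : Γ → M → M) : Prop :=
  ∃ (X Y : Type) (_ : Finite X) (_ : Finite Y) (_ : MulAction Γ X) (_ : MulAction Γ Y)
    (j : M →+ (X → ℤ)) (q : (X → ℤ) →+ (Y → ℤ)), Function.Injective j ∧ Function.Surjective q ∧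
      (∀ n, q n = 0 ↔ ∃ m, j m = n) ∧ (∀ γ m x, j (a γ m) x = j m (γ⁻¹ • x)) ∧
        ∀ (γ : Γ) n y, q (fun x => n (γ⁻¹ • x)) y = q n (γ⁻¹ • y)

/-- The obstruction to the existence of a permutation resolution. -/
theorem HasPermutationResolution.trace_eq {Γ M : Type*} [Group Γ] [AddCommGroup M] {α : Γ → M → M}
    (h : HasPermutationResolution α) {p : ℕ} [Fact p.Prime] {c f : Γ} (hc : c ^ p = 1) {a b : ℕ}
    (ha : c * f = f * c ^ a) (hb : f * c = c ^ b * f) (hM : ∀ m, α c m = m → m = 0) {V : Type*}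
    [AddCommGroup V] [Module (ZMod p) V] [FiniteDimensional (ZMod p) V] (ℓ : M →+ V)
    (hℓ : Function.Surjective ℓ) (hker : ∀ m, ℓ m = 0 ↔ ∃ m', m = α c m' - m')
    (g g' : V →ₗ[ZMod p] V) (hg : ∀ m, ℓ (α f m) = g (ℓ m)) (hg' : ∀ m, ℓ (α f⁻¹ m) = g' (ℓ m)) :
    a * LinearMap.trace (ZMod p) V g = b * LinearMap.trace (ZMod p) V g' := by
  classical
  obtain ⟨X, Y, hX, hY, _, _, j, q, hj, hq, hex, hja, hqa⟩ := h
  have := Fintype.ofFinite X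
  have := Fintype.ofFinite Y
  have ha' : f⁻¹ * c⁻¹ = (c⁻¹) ^ a * f⁻¹ := by
    rw [inv_pow, ← mul_inv_rev, ← mul_inv_rev, ha]
  have hb' : f⁻¹⁻¹ * c⁻¹ = (c⁻¹) ^ b * f⁻¹⁻¹ := by
    rw [inv_pow, inv_inv, eq_inv_mul_iff_mul_eq, ← mul_assoc, ← hb, mul_inv_cancel_right]
  have hc' : c⁻¹ ^ p = 1 := by rw [inv_pow, hc, inv_one]
  have hpow : ∀ {Z : Type} [MulAction Γ Z] (z : Z) (n : ℕ), c⁻¹ • z = z → (c⁻¹) ^ n • z = z := by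
    intro Z _ z n hz
    induction n with
    | zero => rw [pow_zero, one_smul]
    | succ n ih => rw [pow_succ, mul_smul, hz, ih]
  have hfix : ∀ {Z : Type} [MulAction Γ Z] (z : Z), c⁻¹ • z = z → c⁻¹ • f⁻¹ • z = f⁻¹ • z := by
    intro Z _ z hz
    have h1 : f⁻¹ * c⁻¹ ^ b = c⁻¹ * f⁻¹ := by
      rw [inv_inv] at hb'
      rw [inv_mul_eq_iff_eq_mul, ← mul_assoc, hb', mul_inv_cancel_right]
    rw [← mul_smul, ← h1, mul_smul, hpow z b hz]
  have hfix' : ∀ {Z : Type} [MulAction Γ Z] (z : Z), c⁻¹ • z = z →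
      c⁻¹ • f⁻¹⁻¹ • z = f⁻¹⁻¹ • z := by
    intro Z _ z hz
    have h1 : f⁻¹⁻¹ * c⁻¹ ^ a = c⁻¹ * f⁻¹⁻¹ := by
      rw [inv_mul_eq_iff_eq_mul, ← mul_assoc, ha', inv_inv, inv_mul_cancel_right]
    rw [← mul_smul, ← h1, mul_smul, hpow z a hz]
  have key := card_fixed_eq_add_trace (p := p) (α c) (α f) (MulAction.toPerm c⁻¹)
    (MulAction.toPerm f⁻¹) (MulAction.toPerm c⁻¹) (MulAction.toPerm f⁻¹) j q hj hq hex (hja c)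
    (hja f) (hqa c) (hqa f)
    (by rw [← MulAction.toPermHom_apply, ← map_pow, hc', map_one])
    (by rw [← MulAction.toPermHom_apply, ← map_pow, hc', map_one]) (a := a)
    (by simp only [← MulAction.toPermHom_apply, ← map_pow, ← map_mul, ha']) hfix hfix hM ℓ hℓ hker
    g hg
  have key' := card_fixed_eq_add_trace (p := p) (α c) (α f⁻¹) (MulAction.toPerm c⁻¹)
    (MulAction.toPerm f⁻¹⁻¹) (MulAction.toPerm c⁻¹) (MulAction.toPerm f⁻¹⁻¹) j q hj hq hex (hja c)
    (hja f⁻¹) (hqa c) (hqa f⁻¹)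
    (by rw [← MulAction.toPermHom_apply, ← map_pow, hc', map_one])
    (by rw [← MulAction.toPermHom_apply, ← map_pow, hc', map_one]) (a := b)
    (by simp only [← MulAction.toPermHom_apply, ← map_pow, ← map_mul, hb']) hfix' hfix' hM ℓ hℓ
    hker g' hg'
  -- An element and its inverse have the same fixed points, so the counts in the two relations agree
  -- and cancel.
  have hinv : ∀ {Z : Type} [MulAction Γ Z] (z : Z), f⁻¹⁻¹ • z = z ↔ f⁻¹ • z = z := by
    intro Z _ z
    rw [inv_smul_eq_iff, eq_comm]
  simp only [MulAction.toPerm_apply, hinv] at key key'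
  have := key.symm.trans key'
  exact add_left_cancel this

end QuasiPermutation

/-! ### Divisors of units -/

section UnitDivisor

/-- If `W` is obtained from the unique factorization domain `R` by inverting an invariant element,
then `Wˣ / Rˣ` is a permutation module with a finite basis. -/
theorem exists_divisor_hom {Γ : Type*} [Group Γ] {R W : Type*} [CommRing R] [IsDomain R]
    [UniqueFactorizationMonoid R] [CommRing W] (i : R →+* W) (hi : Function.Injective i)
    (ρR : Γ →* (R ≃+* R)) (ρW : Γ →* (W ≃+* W)) (hρ : ∀ γ a, i (ρR γ a) = ρW γ (i a)) (r : R)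
    (hr₀ : r ≠ 0) (hr : IsUnit (i r)) (hW : ∀ w, ∃ n a, w * i r ^ n = i a)
    (hρr : ∀ γ, ρR γ r = r) :
    ∃ (X : Type) (_ : Finite X) (_ : MulAction Γ X) (D : Additive Wˣ →+ (X → ℤ)),
      Function.Surjective D ∧ (∀ u : Wˣ, D (Additive.ofMul u) = 0 ↔ ∃ v : Rˣ, i v = u) ∧
        ∀ γ (u : Wˣ) x, D (Additive.ofMul (Units.map (ρW γ : W →* W) u)) x =
          D (Additive.ofMul u) (γ⁻¹ • x) := by
  classical
  -- The primes of `R` that become units in `W`, up to association; there are finitely many because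
  -- they divide `r`.
  let X := {x : Associates R // Prime x ∧ x ∣ Associates.mk r}
  have hXfin : Finite X := by
    refine Set.Finite.subset (Multiset.finite_toSet
      ((UniqueFactorizationMonoid.factors r).map Associates.mk)) ?_
    rintro x ⟨hx, hxr⟩
    obtain ⟨p, rfl⟩ := Associates.mk_surjective x
    obtain ⟨q, hq, hpq⟩ := UniqueFactorizationMonoid.exists_mem_factors_of_dvd hr₀
      (Associates.prime_mk.mp hx).irreducible (Associates.mk_dvd_mk.mp hxr)
    exact Multiset.mem_map.mpr ⟨q, hq, (Associates.mk_eq_mk_iff_associated.mpr hpq).symm⟩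
  have := Fintype.ofFinite X
  let P : X → R := fun x => Quotient.out x.1
  have hmkP : ∀ x, Associates.mk (P x) = x.1 := fun x => Associates.quot_out _
  have hP : ∀ x, Prime (P x) := fun x => by
    rw [← Associates.prime_mk, hmkP]; exact x.2.1
  have hPr : ∀ x, P x ∣ r := fun x => by
    rw [← Associates.mk_dvd_mk, hmkP]; exact x.2.2
  have hρP : ∀ γ x, Prime (ρR γ (P x)) ∧ ρR γ (P x) ∣ r := by
    refine fun γ x => ⟨(MulEquiv.prime_iff (ρR γ)).mpr (hP x), ?_⟩
    have := map_dvd (ρR γ) (hPr x)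
    rwa [hρr] at this
  have hXext : ∀ (x y : X), Associated (P x) (P y) → x = y := fun x y h => by
    apply Subtype.ext
    rw [← hmkP, ← hmkP, Associates.mk_eq_mk_iff_associated]
    exact h
  have hX : ∀ p : R, Prime p → p ∣ r → ∃ x : X, Associated p (P x) := by
    intro p hp hpr
    refine ⟨⟨Associates.mk p, Associates.prime_mk.mpr hp, Associates.mk_dvd_mk.mpr hpr⟩, ?_⟩
    rw [← Associates.mk_eq_mk_iff_associated, hmkP]
  choose act hact using fun (γ : Γ) (x : X) => hX _ (hρP γ x).1 (hρP γ x).2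
  let _ : MulAction Γ X :=
    { smul := act
      one_smul := fun x => by
        refine (hXext _ _ ?_).symm
        have := hact 1 x
        rwa [map_one] at this
      mul_smul := fun γ δ x => by
        apply hXext
        refine (hact (γ * δ) x).symm.trans ?_
        rw [map_mul]
        exact ((hact δ x).map (ρR γ)).trans (hact γ _) }
  have hact : ∀ (γ : Γ) x, Associated (ρR γ (P x)) (P (γ • x)) := hact
  have hPu : ∀ x, IsUnit (i (P x)) := fun x => isUnit_of_dvd_unit (map_dvd i (hPr x)) hr
  choose π hπ using hPu
  let Ξ : (X → ℤ) → Wˣ := fun n => ∏ x, π x ^ n x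
  have hΞ_add : ∀ n n', Ξ (n + n') = Ξ n * Ξ n' := fun n n' => by
    simp only [Ξ, Pi.add_apply, zpow_add, Finset.prod_mul_distrib]
  have hΞ_zero : Ξ 0 = 1 := by simp [Ξ]
  let I : Rˣ →* Wˣ := Units.map (i : R →* W)
  have hIval : ∀ u, (I u : W) = i u := fun u => rfl
  have hdvd_pow : ∀ a, IsUnit (i a) → ∃ n, a ∣ r ^ n := by
    rintro a ⟨u, hu⟩
    obtain ⟨n, b, hb⟩ := hW (u⁻¹ : Wˣ)
    refine ⟨n, b, hi ?_⟩
    rw [map_pow, map_mul, ← hb, ← hu, Units.mul_inv_cancel_left]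
  -- every unit has a factorization
  have hfact : ∀ a, IsUnit (i a) → ∃ (u : Rˣ) (n : X → ℤ), i a = (I u * Ξ n : Wˣ) := by
    intro a
    induction a using UniqueFactorizationMonoid.induction_on_prime with
    | h₁ =>
      intro h
      obtain ⟨n, hn⟩ := hdvd_pow 0 h
      exact absurd (zero_dvd_iff.mp hn) (pow_ne_zero n hr₀)
    | h₂ a ha => exact fun _ => ⟨ha.unit, 0, by rw [hΞ_zero, mul_one]; rfl⟩
    | h₃ a p _ hp ih =>
      intro h
      rw [map_mul] at h
      obtain ⟨u, n, hn⟩ := ih (isUnit_of_mul_isUnit_right h)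
      obtain ⟨N, hN⟩ := hdvd_pow p (isUnit_of_mul_isUnit_left h)
      obtain ⟨x, v, hv⟩ := hX p hp (hp.dvd_of_dvd_pow hN)
      refine ⟨v⁻¹ * u, Pi.single x 1 + n, ?_⟩
      have h1 : Ξ (Pi.single x 1) = π x := by
        rw [show Ξ (Pi.single x 1) = ∏ y, π y ^ (Pi.single x 1 : X → ℤ) y from rfl,
          Finset.prod_eq_single x]
        · simp
        · intro y _ hy; simp [Pi.single_eq_of_ne hy]
        · simp
      have h2 : i p = (I v⁻¹ * π x : Wˣ) := by
        rw [Units.val_mul, hπ, hIval, ← map_mul, ← hv, mul_comm p, Units.inv_mul_cancel_left]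
      rw [map_mul, hn, h2, hΞ_add, h1, map_mul, ← Units.val_mul]
      congr 1
      exact mul_mul_mul_comm _ _ _ _
  have hfact' : ∀ w : Wˣ, ∃ (n : X → ℤ) (u : Rˣ), w = I u * Ξ n := by
    intro w
    obtain ⟨N, a, ha⟩ := hW w
    have h1 : IsUnit (i a) := ha ▸ w.isUnit.mul (hr.pow N)
    obtain ⟨u, n, hn⟩ := hfact a h1
    obtain ⟨u', n', hn'⟩ := hfact (r ^ N) (by rw [map_pow]; exact hr.pow N)
    refine ⟨n - n', u * u'⁻¹, ?_⟩
    have h2 : w * (I u' * Ξ n') = I u * Ξ n := Units.ext <| by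
      rw [← hn, ← ha, Units.val_mul, ← hn', map_pow]
    have h3 : Ξ n = Ξ (n - n') * Ξ n' := by rw [← hΞ_add, sub_add_cancel]
    rw [h3, ← eq_div_iff_mul_eq'] at h2
    rw [h2, div_eq_mul_inv, map_mul, map_inv, mul_inv]
    rw [mul_mul_mul_comm, mul_assoc (Ξ _), mul_inv_cancel, mul_one, mul_right_comm]
  -- the factorization is unique
  have hpos : ∀ (n : X → ℤ) (u : Rˣ), I u * Ξ n = 1 → ∀ x, n x ≤ 0 := by
    intro n u h x
    by_contra hx
    push Not at hx
    have h1 : Ξ n = Ξ (fun y => ((n y).toNat : ℤ)) * (Ξ fun y => ((-n y).toNat : ℤ))⁻¹ := by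
      rw [eq_mul_inv_iff_mul_eq, ← hΞ_add]
      congr 1
      ext y
      simp only [Pi.add_apply]
      omega
    have h2 : ∀ e : X → ℕ, (Ξ (fun y => (e y : ℤ)) : W) = i (∏ y, P y ^ e y) := by
      intro e
      simp only [Ξ, zpow_natCast, Units.coe_prod, Units.val_pow_eq_pow_val, hπ, map_prod, map_pow]
    rw [h1, ← mul_assoc, mul_inv_eq_one] at h
    have h3 := congrArg Units.val h
    rw [Units.val_mul, h2, h2, hIval, ← map_mul] at h3
    have h4 : P x ∣ ∏ y, P y ^ (-n y).toNat := by
      rw [← hi h3]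
      refine Dvd.dvd.mul_left ((dvd_pow_self _ ?_).trans
        (Finset.dvd_prod_of_mem (fun y => P y ^ (n y).toNat) (Finset.mem_univ x))) _
      omega
    obtain ⟨y, -, hy⟩ := (hP x).exists_mem_finset_dvd h4
    have hxy := hXext x y ((hP x).associated_of_dvd (hP y) ((hP x).dvd_of_dvd_pow hy))
    subst hxy
    rw [show (-n x).toNat = 0 by omega, pow_zero] at hy
    exact (hP x).not_dvd_one hy
  have huniq : ∀ (n n' : X → ℤ) (u u' : Rˣ), I u * Ξ n = I u' * Ξ n' → n = n' := by
    intro n n' u u' h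
    have key : ∀ (n n' : X → ℤ) (u u' : Rˣ), I u * Ξ n = I u' * Ξ n' → ∀ x, n x ≤ n' x := by
      intro n n' u u' h x
      have h1 := hpos (n - n') (u * u'⁻¹) ?_ x
      · simpa using h1
      · have h3 : Ξ n = Ξ (n - n') * Ξ n' := by rw [← hΞ_add, sub_add_cancel]
        rw [h3, ← mul_assoc] at h
        have h4 := mul_right_cancel h
        rw [map_mul, map_inv, mul_right_comm, h4, mul_inv_cancel]
    exact funext fun x => le_antisymm (key n n' u u' h x) (key n' n u' u h.symm x)
  choose D hD using hfact'
  have hDeq : ∀ (w : Wˣ) (n : X → ℤ) (u : Rˣ), w = I u * Ξ n → D w = n := by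
    intro w n u h
    obtain ⟨u', hu'⟩ := hD w
    exact huniq _ _ u' u (hu'.symm.trans h)
  -- `X` lives in the universe of `R`. Numbering its elements gives an index set in `Type`.
  let E : X ≃ Fin (Fintype.card X) := Fintype.equivFin X
  let Ψ : (X → ℤ) ≃+ (Fin (Fintype.card X) → ℤ) :=
    (LinearEquiv.funCongrLeft ℤ ℤ E.symm).toAddEquiv
  have hΨ : ∀ n x, Ψ n x = n (E.symm x) := fun _ _ => rfl
  let D' : Additive Wˣ →+ (X → ℤ) :=
    { toFun := fun w => D w.toMul
      map_zero' := hDeq 1 0 1 (by rw [map_one, hΞ_zero, mul_one])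
      map_add' := fun w w' => by
        obtain ⟨u, hu⟩ := hD w.toMul
        obtain ⟨u', hu'⟩ := hD w'.toMul
        refine hDeq _ _ (u * u') ?_
        rw [toMul_add]
        conv_lhs => rw [hu, hu']
        rw [hΞ_add, map_mul]
        exact mul_mul_mul_comm _ _ _ _ }
  refine ⟨Fin (Fintype.card X), inferInstance, E.symm.mulAction Γ, Ψ.toAddMonoidHom.comp D',
    Ψ.surjective.comp ?_, ?_, ?_⟩
  · intro n
    exact ⟨Additive.ofMul (Ξ n), hDeq _ _ 1 (by rw [map_one, one_mul]; rfl)⟩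
  · intro w
    change Ψ (D w) = 0 ↔ _
    rw [EmbeddingLike.map_eq_zero_iff]
    constructor
    · intro h
      obtain ⟨u, hu⟩ := hD w
      refine ⟨u, ?_⟩
      rw [h, hΞ_zero, mul_one] at hu
      rw [hu]; rfl
    · rintro ⟨u, hu⟩
      exact hDeq _ _ u (Units.ext (by rw [hΞ_zero, mul_one, ← hu]; rfl))
  · intro γ w x
    change D (Units.map (ρW γ : W →* W) w) (E.symm x) = D w (E.symm (E (γ⁻¹ • E.symm x)))
    rw [Equiv.symm_apply_apply]
    generalize E.symm x = x
    obtain ⟨u, hu⟩ := hD w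
    choose v hv using hact γ
    have h1 : ∀ x, Units.map (ρW γ : W →* W) (π x) = I (v x)⁻¹ * π (γ • x) := by
      intro x
      apply Units.ext
      rw [Units.val_mul, hπ, ← hv, map_mul, hIval, mul_comm (i _), mul_assoc, ← map_mul,
        Units.mul_inv, map_one, mul_one, hρ, ← hπ]
      rfl
    have h2 : Units.map (ρW γ : W →* W) w =
        I (Units.map (ρR γ : R →* R) u * ∏ x, ((v x)⁻¹) ^ D w x) * Ξ fun x => D w (γ⁻¹ • x) := by
      conv_lhs => rw [hu, map_mul]
      rw [map_mul, mul_assoc]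
      congr 1
      · apply Units.ext
        exact (hρ γ u).symm
      · simp only [Ξ, map_prod, map_zpow, h1, mul_zpow, Finset.prod_mul_distrib]
        congr 1
        refine Fintype.prod_equiv (MulAction.toPerm γ) _ _ fun x => ?_
        rw [MulAction.toPerm_apply, inv_smul_smul]
    rw [hDeq _ _ _ h2]

end UnitDivisor

/-! ### The group algebra of a lattice -/

section LatticeAlgebra

variable {L : Type*} [Field L] {n : ℕ}

/-- If the support of `z` had two elements, two sums of exponents of `z` and its inverse would be
attained uniquely. Both would survive in the product 1, so both sums would be zero, against
uniqueness. -/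
theorem AddMonoidAlgebra.exists_single_of_isUnit {M : Type*} [AddCommGroup M] [TwoUniqueSums M]
    {z : AddMonoidAlgebra L M} (hz : IsUnit z) : ∃ m l, l ≠ 0 ∧ z = single m l := by
  obtain ⟨w, hzw⟩ := hz.exists_right_inv
  have hz0 : z ≠ 0 := fun h => by simp [h] at hzw
  have hw0 : w ≠ 0 := fun h => by simp [h] at hzw
  have hz1 : 0 < z.coeff.support.card := by
    rw [Finset.card_pos, Finsupp.support_nonempty_iff]
    exact fun h => hz0 (AddMonoidAlgebra.coeff_eq_zero.mp h)
  have hw1 : 0 < w.coeff.support.card := by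
    rw [Finset.card_pos, Finsupp.support_nonempty_iff]
    exact fun h => hw0 (AddMonoidAlgebra.coeff_eq_zero.mp h)
  have hcard : z.coeff.support.card ≤ 1 := by
    by_contra hcard
    push Not at hcard
    obtain ⟨p₁, h₁, p₂, h₂, hne, hu₁, hu₂⟩ := TwoUniqueSums.uniqueAdd_of_one_lt_card
      (A := z.coeff.support) (B := w.coeff.support) (by nlinarith)
    rw [Finset.mem_product] at h₁ h₂
    have key : ∀ p : M × M, p.1 ∈ z.coeff.support ∧ p.2 ∈ w.coeff.support →
        UniqueAdd z.coeff.support w.coeff.support p.1 p.2 → p.1 + p.2 = 0 := by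
      intro p hp hu
      by_contra h0
      have h := AddMonoidAlgebra.coeff_mul_add_of_uniqueAdd hu
      rw [hzw, AddMonoidAlgebra.one_def, AddMonoidAlgebra.coeff_single,
        Finsupp.single_eq_of_ne h0] at h
      exact mul_ne_zero (Finsupp.mem_support_iff.mp hp.1) (Finsupp.mem_support_iff.mp hp.2) h.symm
    have h := hu₁ h₂.1 h₂.2 ((key p₂ h₂ hu₂).trans (key p₁ h₁ hu₁).symm)
    exact hne (Prod.ext h.1.symm h.2.symm)
  obtain ⟨m, l, hl, h⟩ := Finsupp.card_support_eq_one'.mp (le_antisymm hcard hz1)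
  refine ⟨m, l, hl, AddMonoidAlgebra.coeff_injective ?_⟩
  rw [h, AddMonoidAlgebra.coeff_single]

/-- The inclusion of the exponents of polynomials in those of Laurent polynomials. -/
def exponentHom (n : ℕ) : (Fin n →₀ ℕ) →+ (Fin n → ℤ) where
  toFun s i := s i
  map_zero' := rfl
  map_add' s t := by ext i; simp

theorem exponentHom_injective : Function.Injective (exponentHom n) := fun s t h => by
  ext i
  have h1 : (s i : ℤ) = t i := congrFun h i
  exact_mod_cast h1

theorem exists_add_exponentHom (v : Fin n → ℤ) : ∃ s t : Fin n →₀ ℕ,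
    v + exponentHom n s = exponentHom n t := by
  refine ⟨Finsupp.equivFunOnFinite.symm fun i => (-v i).toNat,
    Finsupp.equivFunOnFinite.symm fun i => (v i).toNat, ?_⟩
  ext i
  simp only [exponentHom, Pi.add_apply]
  change v i + ((-v i).toNat : ℤ) = ((v i).toNat : ℤ)
  omega

/-- Laurent polynomials are the localization of polynomials at the monomials, and localization
preserves unique factorization. -/
instance uniqueFactorizationMonoid_laurent :
    UniqueFactorizationMonoid (AddMonoidAlgebra L (Fin n → ℤ)) := by
  let φ : AddMonoidAlgebra L (Fin n →₀ ℕ) →+* AddMonoidAlgebra L (Fin n → ℤ) :=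
    AddMonoidAlgebra.mapDomainRingHom L (exponentHom n)
  have hφ : Function.Injective φ := AddMonoidAlgebra.mapDomain_injective exponentHom_injective
  have hφs : ∀ s l, φ (AddMonoidAlgebra.single s l) =
      AddMonoidAlgebra.single (exponentHom n s) l := fun s l => AddMonoidAlgebra.mapDomain_single
  let _ := φ.toAlgebra
  have : UniqueFactorizationMonoid (AddMonoidAlgebra L (Fin n →₀ ℕ)) :=
    inferInstanceAs (UniqueFactorizationMonoid (MvPolynomial (Fin n) L))
  have : IsLocalization (MonoidHom.mrange (AddMonoidAlgebra.of L (Fin n →₀ ℕ)))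
      (AddMonoidAlgebra L (Fin n → ℤ)) :=
    { map_units := by
        rintro ⟨_, s, rfl⟩
        refine IsUnit.of_mul_eq_one (AddMonoidAlgebra.single (-exponentHom n s.toAdd) 1) ?_
        change φ (AddMonoidAlgebra.single s.toAdd 1) * _ = 1
        rw [hφs, AddMonoidAlgebra.single_mul_single, add_neg_cancel, one_mul]
        rfl
      surj := by
        have key : ∀ z : AddMonoidAlgebra L (Fin n → ℤ), ∃ (s : Fin n →₀ ℕ) (a : _),
            z * φ (AddMonoidAlgebra.single s 1) = φ a := by
          intro z
          induction z using AddMonoidAlgebra.induction_linear with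
          | zero => exact ⟨0, 0, by simp⟩
          | add z w hz hw =>
            obtain ⟨s, a, ha⟩ := hz
            obtain ⟨t, b, hb⟩ := hw
            refine ⟨s + t, a * AddMonoidAlgebra.single t 1 + b * AddMonoidAlgebra.single s 1, ?_⟩
            rw [map_add, map_mul φ a, map_mul φ b, ← ha, ← hb,
              show AddMonoidAlgebra.single (s + t) (1 : L) =
                AddMonoidAlgebra.single s 1 * AddMonoidAlgebra.single t 1 by
                  rw [AddMonoidAlgebra.single_mul_single, one_mul], map_mul]
            ring
          | single v l =>
            obtain ⟨s, t, h⟩ := exists_add_exponentHom v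
            exact ⟨s, AddMonoidAlgebra.single t l, by
              rw [hφs, hφs, AddMonoidAlgebra.single_mul_single, h, mul_one]⟩
        intro z
        obtain ⟨s, a, h⟩ := key z
        exact ⟨(a, ⟨_, Multiplicative.ofAdd s, rfl⟩), h⟩
      exists_of_eq := fun h => ⟨1, by rw [hφ h]⟩ }
  exact UniqueFactorizationMonoid.of_isLocalization
    (S := MonoidHom.mrange (AddMonoidAlgebra.of L (Fin n →₀ ℕ))) _

end LatticeAlgebra

/-! ### Common localizations of algebras with the same fraction field -/

section CommonLocalization

variable {k F A B : Type*} [Field k] [Field F] [Algebra k F] [CommRing A] [Algebra k A] [CommRing B]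
  [Algebra k B]

/-- The elements of `F` of the form `a / r ^ n` with `a ∈ A`. -/
def fractionSubalgebra (i : A →ₐ[k] F) (r : A) : Subalgebra k F where
  carrier := {z | ∃ (n : ℕ) (a : A), z * i r ^ n = i a}
  mul_mem' := by
    rintro z w ⟨n, a, h⟩ ⟨m, b, h'⟩
    exact ⟨n + m, a * b, by rw [map_mul, ← h, ← h']; ring⟩
  add_mem' := by
    rintro z w ⟨n, a, h⟩ ⟨m, b, h'⟩
    exact ⟨n + m, a * r ^ m + b * r ^ n, by
      rw [map_add, map_mul, map_mul, map_pow, map_pow, ← h, ← h']; ring⟩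
  algebraMap_mem' c := ⟨0, algebraMap k A c, by simp⟩

theorem apply_mem_fractionSubalgebra (i : A →ₐ[k] F) (r a : A) : i a ∈ fractionSubalgebra i r :=
  ⟨0, a, by simp⟩

theorem fractionSubalgebra_le_mul (i : A →ₐ[k] F) (r b : A) :
    fractionSubalgebra i r ≤ fractionSubalgebra i (r * b) := by
  rintro z ⟨n, a, h⟩
  exact ⟨n, a * b ^ n, by rw [map_mul, map_mul, mul_pow, ← mul_assoc, h, map_pow]⟩

/-- Finitely many generators have a common denominator. -/
theorem exists_range_le_fractionSubalgebra [Algebra.FiniteType k B] {i : A →ₐ[k] F}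
    (hi : ∀ z, ∃ a b, i b ≠ 0 ∧ z * i b = i a) (j : B →ₐ[k] F) :
    ∃ r, i r ≠ 0 ∧ ∀ b, j b ∈ fractionSubalgebra i r := by
  classical
  obtain ⟨s, hs⟩ := Algebra.FiniteType.out (R := k) (A := B)
  have h1 : ∀ s : Finset B, ∃ r, i r ≠ 0 ∧ ∀ b ∈ s, j b ∈ fractionSubalgebra i r := by
    intro s
    induction s using Finset.induction_on with
    | empty => exact ⟨1, by simp, by simp⟩
    | insert b s _ ih =>
      obtain ⟨r, hr, h⟩ := ih
      obtain ⟨a, c, hc, h'⟩ := hi (j b)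
      refine ⟨r * c, by rw [map_mul]; exact mul_ne_zero hr hc, fun x hx => ?_⟩
      rcases Finset.mem_insert.mp hx with rfl | hx
      · exact ⟨1, r * a, by rw [pow_one, map_mul, map_mul, ← h']; ring⟩
      · exact fractionSubalgebra_le_mul i r c (h x hx)
  obtain ⟨r, hr, h⟩ := h1 s
  refine ⟨r, hr, fun b => ?_⟩
  have h2 : Algebra.adjoin k (s : Set B) ≤ (fractionSubalgebra i r).comap j :=
    Algebra.adjoin_le h
  rw [hs] at h2
  exact h2 Algebra.mem_top

/-- Both new denominators are products of powers of `i r` and `j s` in which each factor occurs.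
Inverting either one therefore inverts both factors. -/
theorem fractionSubalgebra_le_of_mul_pow {i : A →ₐ[k] F} {j : B →ₐ[k] F} {r a : A} {s b : B}
    {n m : ℕ} (hr : i r ≠ 0) (hs : j s ≠ 0) (h : ∀ x, i x ∈ fractionSubalgebra j s)
    (ha : j s * i r ^ n = i a) (hb : i r * j s ^ m = j b) :
    fractionSubalgebra i (r * a) ≤ fractionSubalgebra j (s * b) := by
  rintro z ⟨N, x, hz⟩
  have h1 : (i r)⁻¹ ∈ fractionSubalgebra j (s * b) :=
    ⟨1, s * s ^ m, by rw [pow_one, map_mul, map_mul, ← hb, map_pow]; field_simp⟩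
  have h2 : (j s)⁻¹ ∈ fractionSubalgebra j (s * b) :=
    ⟨1, b, by rw [pow_one, map_mul]; field_simp⟩
  have h3 : z = i x * ((i r)⁻¹ * ((j s)⁻¹ * (i r)⁻¹ ^ n)) ^ N := by
    rw [← hz, map_mul, ← ha, mul_assoc, ← mul_pow]
    rw [show i r * (j s * i r ^ n) * ((i r)⁻¹ * ((j s)⁻¹ * (i r)⁻¹ ^ n)) = 1 by
      rw [inv_pow]; field_simp, one_pow,
      mul_one]
  rw [h3]
  exact mul_mem (fractionSubalgebra_le_mul j s b (h x))
    (pow_mem (mul_mem h1 (mul_mem h2 (pow_mem h1 n))) N)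

/-- Each algebra lies in a localization of the other; enlarging the two denominators makes the
localizations coincide. Geometrically, birational models share an open subset. -/
theorem exists_fractionSubalgebra_eq [Algebra.FiniteType k A] [Algebra.FiniteType k B]
    {i : A →ₐ[k] F} (hi : ∀ z, ∃ a b, i b ≠ 0 ∧ z * i b = i a) {j : B →ₐ[k] F}
    (hj : ∀ z, ∃ a b, j b ≠ 0 ∧ z * j b = j a) :
    ∃ r s, i r ≠ 0 ∧ j s ≠ 0 ∧ fractionSubalgebra i r = fractionSubalgebra j s := by
  obtain ⟨r, hr, h⟩ := exists_range_le_fractionSubalgebra hi j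
  obtain ⟨s, hs, h'⟩ := exists_range_le_fractionSubalgebra hj i
  obtain ⟨n, a, ha⟩ := h s
  obtain ⟨m, b, hb⟩ := h' r
  refine ⟨r * a, s * b, ?_, ?_, le_antisymm (fractionSubalgebra_le_of_mul_pow hr hs h' ha hb)
    (fractionSubalgebra_le_of_mul_pow hs hr h hb ha)⟩
  · rw [map_mul, ← ha]
    exact mul_ne_zero hr (mul_ne_zero hs (pow_ne_zero n hr))
  · rw [map_mul, ← hb]
    exact mul_ne_zero hs (mul_ne_zero hr (pow_ne_zero m hs))

end CommonLocalization

/-! ### Permutation resolutions of character lattices of stably rational tori -/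

section StablyRational

variable {k L : Type*} [Field k] [Field L] [Algebra k L]

/-- The action of the automorphisms of `L` on `L ⊗ B`. -/
noncomputable def galoisTensor (k L B : Type*) [Field k] [Field L] [Algebra k L] [CommRing B]
    [Algebra k B] : (L ≃ₐ[k] L) →* ((L ⊗[k] B) ≃+* (L ⊗[k] B)) :=
  MonoidHom.mk' (fun γ => (Algebra.TensorProduct.congr γ (AlgEquiv.refl : B ≃ₐ[k] B)).toRingEquiv)
    fun γ δ => by
      ext x
      induction x using TensorProduct.induction_on with
      | zero => rw [map_zero, map_zero]
      | add x y hx hy => rw [map_add, map_add, hx, hy]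
      | tmul l b => rfl

theorem galoisTensor_tmul {B : Type*} [CommRing B] [Algebra k B] (γ : L ≃ₐ[k] L) (l : L) (b : B) :
    galoisTensor k L B γ (l ⊗ₜ b) = γ l ⊗ₜ b := rfl

theorem galoisTensor_apply {B : Type*} [CommRing B] [Algebra k B] (γ : L ≃ₐ[k] L) (x : L ⊗[k] B) :
    galoisTensor k L B γ x = Algebra.TensorProduct.map (γ : L →ₐ[k] L) (AlgHom.id k B) x := rfl

/-- The base change of a homomorphism. -/
noncomputable abbrev baseChange (L : Type*) [Field L] [Algebra k L] {B B' : Type*} [CommRing B]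
    [Algebra k B] [CommRing B'] [Algebra k B'] (i : B →ₐ[k] B') : L ⊗[k] B →ₐ[L] L ⊗[k] B' :=
  Algebra.TensorProduct.map (AlgHom.id L L) i

theorem galoisTensor_baseChange {B B' : Type*} [CommRing B] [Algebra k B] [CommRing B']
    [Algebra k B'] (i : B →ₐ[k] B') (γ : L ≃ₐ[k] L) (x : L ⊗[k] B) :
    baseChange L i (galoisTensor k L B γ x) = galoisTensor k L B' γ (baseChange L i x) := by
  induction x using TensorProduct.induction_on with
  | zero => simp
  | add x y hx hy => simp only [map_add, hx, hy]
  | tmul l b => simp only [galoisTensor_tmul, Algebra.TensorProduct.map_tmul, AlgHom.id_apply]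

theorem baseChange_injective {B B' : Type*} [CommRing B] [Algebra k B] [CommRing B'] [Algebra k B']
    {i : B →ₐ[k] B'} (hi : Function.Injective i) : Function.Injective (baseChange L i) :=
  Module.Flat.lTensor_preserves_injective_linearMap (M := L) i.toLinearMap hi

/-- The inverted element is defined over `k`, hence invariant, so the removed divisors are permuted
by the Galois group. -/
theorem exists_divisor_hom_tensor {A D : Type*} [CommRing A] [Algebra k A] [CommRing D]
    [Algebra k D] [IsDomain (L ⊗[k] A)] [UniqueFactorizationMonoid (L ⊗[k] A)] (i : A →ₐ[k] D)
    (hi : Function.Injective i) {r : A} (hr₀ : r ≠ 0) (hr : IsUnit (i r))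
    (hD : ∀ z, ∃ n a, z * i r ^ n = i a) :
    ∃ (X : Type) (_ : Finite X) (_ : MulAction (L ≃ₐ[k] L) X)
      (Δ : Additive (L ⊗[k] D)ˣ →+ (X → ℤ)), Function.Surjective Δ ∧
        (∀ u : (L ⊗[k] D)ˣ, Δ (Additive.ofMul u) = 0 ↔
          ∃ v : (L ⊗[k] A)ˣ, baseChange L i v = u) ∧
        ∀ γ (u : (L ⊗[k] D)ˣ) x, Δ (Additive.ofMul
          (Units.map (galoisTensor k L D γ : L ⊗[k] D →* L ⊗[k] D) u)) x =
            Δ (Additive.ofMul u) (γ⁻¹ • x) := by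
  have hinj := baseChange_injective (L := L) hi
  have h1 : baseChange L i (1 ⊗ₜ r) = 1 ⊗ₜ i r := by
    rw [Algebra.TensorProduct.map_tmul, map_one]
  refine exists_divisor_hom (baseChange L i).toRingHom hinj (galoisTensor k L A)
    (galoisTensor k L D) (fun γ a => galoisTensor_baseChange i γ a) (1 ⊗ₜ r) ?_ ?_ ?_ ?_
  · intro h
    apply hr₀
    have h2 : Function.Injective (Algebra.TensorProduct.includeRight : A →ₐ[k] L ⊗[k] A) :=
      Algebra.TensorProduct.includeRight_injective (algebraMap k L).injective
    exact h2 (h.trans (map_zero _).symm)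
  · change IsUnit (baseChange L i (1 ⊗ₜ r))
    rw [h1]
    exact hr.map (Algebra.TensorProduct.includeRight : D →ₐ[k] L ⊗[k] D)
  · intro w
    change ∃ n a, w * baseChange L i (1 ⊗ₜ r) ^ n = baseChange L i a
    rw [h1]
    induction w using TensorProduct.induction_on with
    | zero => exact ⟨0, 0, by simp⟩
    | add w w' h h' =>
      obtain ⟨n, a, ha⟩ := h
      obtain ⟨m, b, hb⟩ := h'
      refine ⟨n + m, a * (1 ⊗ₜ r) ^ m + b * (1 ⊗ₜ r) ^ n, ?_⟩
      rw [map_add, map_mul, map_mul, map_pow, map_pow, h1, ← ha, ← hb]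
      ring
    | tmul l d =>
      obtain ⟨n, a, ha⟩ := hD d
      refine ⟨n, l ⊗ₜ a, ?_⟩
      rw [Algebra.TensorProduct.tmul_pow, one_pow, Algebra.TensorProduct.tmul_mul_tmul, mul_one, ha,
        Algebra.TensorProduct.map_tmul]
      rfl
  · intro γ
    rw [galoisTensor_tmul, map_one]

/-- The character lattice of a stably rational torus has a permutation resolution, if there are
models of the function field that are unique factorization domains over `L`. -/
theorem hasPermutationResolution_of_models {N A B D : Type*} [AddCommGroup N] [CommRing A]
    [Algebra k A] [CommRing B] [Algebra k B] [CommRing D] [Algebra k D] [IsDomain (L ⊗[k] A)]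
    [UniqueFactorizationMonoid (L ⊗[k] A)] [IsDomain (L ⊗[k] B)]
    [UniqueFactorizationMonoid (L ⊗[k] B)] (i : A →ₐ[k] D) (j : B →ₐ[k] D)
    (hi : Function.Injective i) (hj : Function.Injective j) {r : A} (hr₀ : r ≠ 0)
    (hr : IsUnit (i r)) (hiD : ∀ z, ∃ n a, z * i r ^ n = i a) {s : B} (hs₀ : s ≠ 0)
    (hs : IsUnit (j s)) (hjD : ∀ z, ∃ n a, z * j s ^ n = j a)
    (hA : ∀ v : (L ⊗[k] A)ˣ, ∃ l : L, v = algebraMap L (L ⊗[k] A) l)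
    (χ : Multiplicative N →* (L ⊗[k] B)ˣ)
    (hB : ∀ v : (L ⊗[k] B)ˣ, ∃ (l : L) (n : N), v = algebraMap L (L ⊗[k] B) l * χ (.ofAdd n))
    (hχ : ∀ (l : L) (n : N), algebraMap L (L ⊗[k] B) l = χ (.ofAdd n) → n = 0)
    (a : (L ≃ₐ[k] L) →* AddMonoid.End N)
    (ha : ∀ γ n, galoisTensor k L B γ (χ (.ofAdd n)) = χ (.ofAdd (a γ n))) :
    HasPermutationResolution fun γ n => a γ n := by
  obtain ⟨X, hX, _, Δ, hΔ, hΔ₀, hΔγ⟩ := exists_divisor_hom_tensor (L := L) i hi hr₀ hr hiD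
  obtain ⟨Y, hY, _, Ε, hΕ, hΕ₀, hΕγ⟩ := exists_divisor_hom_tensor (L := L) j hj hs₀ hs hjD
  let J : (L ⊗[k] B)ˣ →* (L ⊗[k] D)ˣ := Units.map (baseChange L j : L ⊗[k] B →* L ⊗[k] D)
  have hJ : ∀ v, (J v : L ⊗[k] D) = baseChange L j v := fun v => rfl
  -- The kernel of `Δ` consists of constants, as `L ⊗ A` has no other units. Constants are also
  -- units of `L ⊗ B`, so `Ε` factors through `Δ`. The kernel of the induced map `q` is the
  -- characters.
  have hker : Δ.ker ≤ Ε.ker := by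
    intro w hw
    obtain ⟨v, hv⟩ := (hΔ₀ w.toMul).mp hw
    obtain ⟨l, hl⟩ := hA v
    have hl0 : l ≠ 0 := by
      rintro rfl
      rw [map_zero] at hl
      exact v.ne_zero hl
    refine (hΕ₀ w.toMul).mpr ⟨Units.map (algebraMap L (L ⊗[k] B)).toMonoidHom (Units.mk0 l hl0), ?_⟩
    rw [← hv, hl]
    change baseChange L j (algebraMap L _ l) = _
    rw [AlgHom.commutes, AlgHom.commutes]
  let q : (X → ℤ) →+ (Y → ℤ) := Δ.liftOfSurjective hΔ ⟨Ε, hker⟩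
  have hq : ∀ w, q (Δ w) = Ε w := fun w =>
    AddMonoidHom.liftOfRightInverse_comp_apply Δ _ _ ⟨Ε, hker⟩ w
  let κ : N →+ Additive (L ⊗[k] D)ˣ := MonoidHom.toAdditiveRight (J.comp χ)
  have hκ : ∀ n, κ n = Additive.ofMul (J (χ (.ofAdd n))) := fun _ => rfl
  have hΕκ : ∀ n, Ε (κ n) = 0 := fun n => (hΕ₀ _).mpr ⟨χ (.ofAdd n), rfl⟩
  have hscalar : ∀ (w : (L ⊗[k] D)ˣ) (l : L), l ≠ 0 → (w : L ⊗[k] D) = algebraMap L _ l →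
      Δ (Additive.ofMul w) = 0 := by
    intro w l hl hw
    refine (hΔ₀ w).mpr ⟨Units.map (algebraMap L (L ⊗[k] A)).toMonoidHom (Units.mk0 l hl), ?_⟩
    rw [hw]
    exact AlgHom.commutes _ _
  refine ⟨X, Y, hX, hY, inferInstance, inferInstance, Δ.comp κ, q, ?_, ?_, ?_, ?_, ?_⟩
  · rw [injective_iff_map_eq_zero]
    intro n hn
    obtain ⟨v, hv⟩ := (hΔ₀ (J (χ (.ofAdd n)))).mp hn
    obtain ⟨l, hl⟩ := hA v
    apply hχ l n
    apply baseChange_injective hj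
    rw [← hJ, ← hv, hl, AlgHom.commutes, AlgHom.commutes]
  · intro n
    obtain ⟨w, rfl⟩ := hΕ n
    exact ⟨Δ w, hq w⟩
  · intro n
    constructor
    · intro h
      obtain ⟨w, rfl⟩ := hΔ n
      rw [hq] at h
      obtain ⟨v, hv⟩ := (hΕ₀ w.toMul).mp h
      obtain ⟨l, n, hl⟩ := hB v
      refine ⟨n, ?_⟩
      have hl0 : l ≠ 0 := by
        rintro rfl
        rw [map_zero, zero_mul] at hl
        exact v.ne_zero hl
      have h1 : w.toMul = Units.map (algebraMap L (L ⊗[k] D)).toMonoidHom (Units.mk0 l hl0) *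
          J (χ (.ofAdd n)) := by
        apply Units.ext
        rw [← hv, hl, map_mul, AlgHom.commutes]
        rfl
      have h2 : w = Additive.ofMul (Units.map (algebraMap L (L ⊗[k] D)).toMonoidHom
          (Units.mk0 l hl0)) + κ n := congrArg Additive.ofMul h1
      rw [h2, map_add, hscalar _ l hl0 rfl, zero_add]
      rfl
    · rintro ⟨m, rfl⟩
      rw [AddMonoidHom.comp_apply, hq, hΕκ]
  · intro γ m x
    rw [AddMonoidHom.comp_apply, AddMonoidHom.comp_apply, hκ m, ← hΔγ, hκ]
    have h1 : J (χ (.ofAdd (a γ m))) =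
        Units.map (galoisTensor k L D γ : L ⊗[k] D →* L ⊗[k] D) (J (χ (.ofAdd m))) := by
      apply Units.ext
      rw [hJ, ← ha, galoisTensor_baseChange]
      rfl
    exact congrArg (fun w => Δ (Additive.ofMul w) x) h1
  · intro γ n y
    obtain ⟨w, rfl⟩ := hΔ n
    have h1 : (fun x => Δ w (γ⁻¹ • x)) = Δ (Additive.ofMul
        (Units.map (galoisTensor k L D γ : L ⊗[k] D →* L ⊗[k] D) w.toMul)) :=
      funext fun x => (hΔγ γ w.toMul x).symm
    rw [h1, hq, hq, hΕγ]
    rfl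

end StablyRational

/-! ### From stable rationality to a permutation resolution. -/

section StablyRationalField

variable {k L : Type*} [Field k] [Field L] [Algebra k L]

theorem rTensorAlgEquiv_baseChange_C {B : Type*} [CommRing B] [Algebra k B] (σ : Type*)
    (x : L ⊗[k] B) :
    MvPolynomial.rTensorAlgEquiv (σ := σ) (R := k) (S := L) (N := B)
      (baseChange L (IsScalarTower.toAlgHom k B (MvPolynomial σ B)) x) = MvPolynomial.C x := by
  classical
  induction x using TensorProduct.induction_on with
  | zero => simp
  | add x y hx hy => simp only [map_add, hx, hy]
  | tmul l b =>
    ext d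
    rw [Algebra.TensorProduct.map_tmul]
    change MvPolynomial.coeff d (MvPolynomial.rTensorAlgEquiv (l ⊗ₜ MvPolynomial.monomial 0 b)) = _
    rw [MvPolynomial.coeff_rTensorAlgEquiv_monomial_tmul, MvPolynomial.coeff_C]

/-- Clearing the denominators of the coefficients shows that `C[y]` has the same fraction field as
`K[y]`, so it can serve as a model of finite type. -/
theorem exists_fraction_of_fractionRing_mvPolynomial {C K E : Type*} [CommRing C] [IsDomain C]
    [Field K] [Algebra C K] [IsFractionRing C K] [Field E] {σ : Type*} [Algebra (MvPolynomial σ K) E]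
    [IsFractionRing (MvPolynomial σ K) E] (z : E) : ∃ P Q : MvPolynomial σ C,
      algebraMap (MvPolynomial σ K) E (MvPolynomial.map (algebraMap C K) Q) ≠ 0 ∧
        z * algebraMap (MvPolynomial σ K) E (MvPolynomial.map (algebraMap C K) Q) =
          algebraMap (MvPolynomial σ K) E (MvPolynomial.map (algebraMap C K) P) := by
  have key : ∀ P : MvPolynomial σ K, ∃ (P' : MvPolynomial σ C) (c : C), c ≠ 0 ∧
      P * MvPolynomial.map (algebraMap C K) (MvPolynomial.C c) =
        MvPolynomial.map (algebraMap C K) P' := by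
    intro P
    let := MvPolynomial.algebraMvPolynomial (σ := σ) (R := C) (S := K)
    obtain ⟨⟨P', ⟨_, c, hc, rfl⟩⟩, h⟩ := IsLocalization.surj
      ((nonZeroDivisors C).map (MvPolynomial.C : C →+* MvPolynomial σ C)) P
    exact ⟨P', c, nonZeroDivisors.ne_zero hc, h⟩
  obtain ⟨P, Q, hQ, rfl⟩ := IsFractionRing.div_surjective (A := MvPolynomial σ K) z
  obtain ⟨P', c, hc, hP⟩ := key P
  obtain ⟨Q', d, hd, hQ'⟩ := key Q
  have hinj := IsFractionRing.injective (MvPolynomial σ K) E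
  have h0 : ∀ c : C, c ≠ 0 → algebraMap (MvPolynomial σ K) E
      (MvPolynomial.map (algebraMap C K) (MvPolynomial.C c)) ≠ 0 := by
    intro c hc h
    rw [MvPolynomial.map_C, map_eq_zero_iff _ hinj, MvPolynomial.C_eq_zero] at h
    exact hc ((map_eq_zero_iff _ (IsFractionRing.injective C K)).mp h)
  have hQ0 : algebraMap (MvPolynomial σ K) E Q ≠ 0 := fun h =>
    nonZeroDivisors.ne_zero hQ ((map_eq_zero_iff _ hinj).mp h)
  refine ⟨P' * MvPolynomial.C d, Q' * MvPolynomial.C c, ?_, ?_⟩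
  · rw [map_mul, map_mul, ← hQ', map_mul]
    exact mul_ne_zero (mul_ne_zero hQ0 (h0 d hd)) (h0 c hc)
  · simp only [map_mul (MvPolynomial.map (algebraMap C K)), ← hQ', ← hP,
      map_mul (algebraMap (MvPolynomial σ K) E)]
    field_simp

theorem inv_mem_fractionSubalgebra {A F : Type*} [CommRing A] [Algebra k A] [Field F] [Algebra k F]
    (i : A →ₐ[k] F) {r : A} (hr : i r ≠ 0) : (i r)⁻¹ ∈ fractionSubalgebra i r :=
  ⟨1, 1, by rw [pow_one, map_one, inv_mul_cancel₀ hr]⟩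

theorem isUnit_codRestrict {A F : Type*} [CommRing A] [Algebra k A] [Field F] [Algebra k F]
    (i : A →ₐ[k] F) {D : Subalgebra k F} (h : ∀ x, i x ∈ D) {r : A} (hr : i r ≠ 0)
    (hinv : (i r)⁻¹ ∈ D) : IsUnit (i.codRestrict D h r) :=
  IsUnit.of_mul_eq_one ⟨_, hinv⟩ (Subtype.ext (mul_inv_cancel₀ hr))

/-- The two models are `k[x_1, …, x_N]` and `C[y_1, …, y_m]` inside one function field. Over `L`
both are factorial. The first has only constant units; in the second the `y_i` add no units to those
of the Laurent ring, which are monomials. -/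
theorem IsStablyRational.hasPermutationResolution {n : ℕ} {C : Type*} [CommRing C] [Algebra k C]
    {a : (L ≃ₐ[k] L) →* AddMonoid.End (Fin n → ℤ)} (hC : IsSplitWith k L C a)
    (h : IsStablyRational k C) : HasPermutationResolution fun γ v => a γ v := by
  obtain ⟨u, hu⟩ := hC
  have : IsDomain (L ⊗[k] C) := u.symm.toMulEquiv.isDomain _
  have : UniqueFactorizationMonoid (L ⊗[k] C) :=
    u.toMulEquiv.uniqueFactorizationMonoid inferInstance
  have : IsDomain C := (Algebra.TensorProduct.includeRight_injective (A := L) (B := C) (R := k)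
    (algebraMap k L).injective).isDomain (Algebra.TensorProduct.includeRight : C →ₐ[k] _)
  have : Algebra.FiniteType L (L ⊗[k] C) := Algebra.FiniteType.equiv inferInstance u
  have : Algebra.FiniteType k C :=
    Algebra.FiniteType.of_finiteType_tensorProduct_of_faithfullyFlat L
  obtain ⟨m, N, ⟨e⟩⟩ := h
  let A := MvPolynomial (Fin N) k
  let B := MvPolynomial (Fin m) C
  let F := FractionRing A
  let eA : L ⊗[k] A ≃ₐ[L] MvPolynomial (Fin N) L := MvPolynomial.algebraTensorAlgEquiv k L
  let eB : L ⊗[k] B ≃ₐ[L] MvPolynomial (Fin m) (L ⊗[k] C) := MvPolynomial.rTensorAlgEquiv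
  have : IsDomain (L ⊗[k] A) := eA.toMulEquiv.isDomain _
  have : UniqueFactorizationMonoid (L ⊗[k] A) :=
    eA.symm.toMulEquiv.uniqueFactorizationMonoid inferInstance
  have : IsDomain (L ⊗[k] B) := eB.toMulEquiv.isDomain _
  have : UniqueFactorizationMonoid (L ⊗[k] B) :=
    eB.symm.toMulEquiv.uniqueFactorizationMonoid inferInstance
  have : Algebra.FiniteType k B := Algebra.FiniteType.trans (S := C) inferInstance inferInstance
  let i : A →ₐ[k] F := IsScalarTower.toAlgHom k A F
  let j : B →ₐ[k] F := e.toAlgHom.comp ((IsScalarTower.toAlgHom k _ _).comp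
    (MvPolynomial.mapAlgHom (IsScalarTower.toAlgHom k C (FractionRing C))))
  have hj_apply : ∀ x, j x = e (algebraMap _ _
      (MvPolynomial.map (algebraMap C (FractionRing C)) x)) := fun _ => rfl
  have hi : Function.Injective i := IsFractionRing.injective A F
  have hj : Function.Injective j := fun x y h => by
    rw [hj_apply, hj_apply] at h
    exact MvPolynomial.map_injective _ (IsFractionRing.injective C (FractionRing C))
      (IsFractionRing.injective _ _ (e.injective h))
  -- The common localization plays the role of `D` in `hasPermutationResolution_of_models`.
  obtain ⟨r, s, hr, hs, hrs⟩ := exists_fractionSubalgebra_eq (i := i) (j := j)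
    (fun z => by
      obtain ⟨x, y, hy, rfl⟩ := IsFractionRing.div_surjective (A := A) z
      have hy0 : i y ≠ 0 := fun h => nonZeroDivisors.ne_zero hy ((map_eq_zero_iff _ hi).mp h)
      exact ⟨x, y, hy0, div_mul_cancel₀ _ hy0⟩)
    (fun z => by
      obtain ⟨P, Q, hQ, h⟩ := exists_fraction_of_fractionRing_mvPolynomial (C := C)
        (K := FractionRing C) (σ := Fin m) (e.symm z)
      refine ⟨P, Q, by rw [hj_apply]; exact (map_ne_zero_iff _ e.injective).mpr hQ, ?_⟩
      rw [hj_apply, hj_apply]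
      have h1 := congrArg e h
      rwa [map_mul, AlgEquiv.apply_symm_apply] at h1)
  have hmem : ∀ x, j x ∈ fractionSubalgebra i r := fun x => hrs ▸ apply_mem_fractionSubalgebra j s x
  have hinv : (j s)⁻¹ ∈ fractionSubalgebra i r := hrs ▸ inv_mem_fractionSubalgebra j hs
  let ι : L ⊗[k] C →ₐ[L] L ⊗[k] B := baseChange L (IsScalarTower.toAlgHom k C B)
  have hι : Function.Injective ι := baseChange_injective (MvPolynomial.C_injective _ _)
  have heB : ∀ x, eB (ι x) = MvPolynomial.C x := rTensorAlgEquiv_baseChange_C (Fin m)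
  let χ : Multiplicative (Fin n → ℤ) →* (L ⊗[k] B)ˣ := MonoidHom.toHomUnits
    (((ι.comp u.toAlgHom : _ →ₐ[L] L ⊗[k] B) : _ →* L ⊗[k] B).comp (AddMonoidAlgebra.of L _))
  have hχ : ∀ v, (χ (.ofAdd v) : L ⊗[k] B) = ι (u (AddMonoidAlgebra.single v 1)) := fun _ => rfl
  refine hasPermutationResolution_of_models (L := L)
    (i.codRestrict (fractionSubalgebra i r) (apply_mem_fractionSubalgebra i r))
    (j.codRestrict (fractionSubalgebra i r) hmem) ?_ ?_ (r := r) ?_ ?_ ?_ (s := s) ?_ ?_ ?_ ?_ ?_ ?_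
    ?_ a ?_
  · exact fun x y h => hi (congrArg Subtype.val h)
  · exact fun x y h => hj (congrArg Subtype.val h)
  · rintro rfl
    exact hr (map_zero i)
  · exact isUnit_codRestrict i _ hr (inv_mem_fractionSubalgebra i hr)
  · rintro ⟨z, N, a, h⟩
    exact ⟨N, a, Subtype.ext h⟩
  · rintro rfl
    exact hs (map_zero j)
  · exact isUnit_codRestrict j _ hs hinv
  · rintro ⟨z, hz⟩
    rw [hrs] at hz
    obtain ⟨N, a, h⟩ := hz
    exact ⟨N, a, Subtype.ext h⟩
  · intro v
    obtain ⟨l, -, hl⟩ := MvPolynomial.isUnit_iff_eq_C_of_isReduced.mp (v.isUnit.map eA)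
    refine ⟨l, eA.injective ?_⟩
    rw [hl, AlgEquiv.commutes]
    rfl
  · exact χ
  · intro v
    obtain ⟨x, hx, hl⟩ := MvPolynomial.isUnit_iff_eq_C_of_isReduced.mp (v.isUnit.map eB)
    obtain ⟨w, l, -, hw⟩ := AddMonoidAlgebra.exists_single_of_isUnit (hx.map u.symm)
    refine ⟨l, w, eB.injective ?_⟩
    have h1 : x = algebraMap L _ l * u (AddMonoidAlgebra.single w 1) := by
      rw [← u.apply_symm_apply x, hw, ← u.commutes, ← map_mul]
      congr 1
      change _ = AddMonoidAlgebra.single 0 l * _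
      rw [AddMonoidAlgebra.single_mul_single, zero_add, mul_one]
    rw [hl, hχ, ← ι.commutes, ← map_mul, heB, h1]
  · intro l w h
    rw [hχ, ← ι.commutes] at h
    have h1 := hι h
    rw [← u.commutes] at h1
    have h2 := u.injective h1
    change AddMonoidAlgebra.single 0 l = _ at h2
    have h3 := congrArg (fun z => z.coeff w) h2
    simp only [AddMonoidAlgebra.coeff_single, Finsupp.single_eq_same] at h3
    by_contra hw
    rw [Finsupp.single_eq_of_ne hw] at h3
    exact zero_ne_one h3
  · intro γ w
    rw [hχ, hχ, ← galoisTensor_baseChange, galoisTensor_apply, hu]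

end StablyRationalField

/-! ### The tori that are not stably rational -/

section NotStablyRational

variable {k L : Type*} [Field k] [Field L] [Algebra k L] {n : ℕ}

/-- The obstruction in terms of matrices. The passage from matrices to Galois elements reverses
products, so `ha` and `hb` have their sides arranged oppositely to the relations in the group. -/
theorem trace_eq_of_isStablyRational {G H : Subgroup (GL (Fin n) ℤ)} (hG : IsConjSubgroup G H)
    {φ : (L ≃ₐ[k] L) ≃* (G)ᵐᵒᵖ} {A : Type*} [CommRing A] [HopfAlgebra k A]
    (hA : HasCharacterModule k L A G φ) (hst : IsStablyRational k A) {C F : GL (Fin n) ℤ}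
    (hC : C ∈ H) (hF : F ∈ H) {p : ℕ} [Fact p.Prime] (hCp : C ^ p = 1) {a b : ℕ}
    (ha : F * C = C ^ a * F) (hb : C * F = F * C ^ b)
    (hfix : ∀ v, Matrix.vecMul v (C : Matrix (Fin n) (Fin n) ℤ) = v → v = 0) {V : Type*}
    [AddCommGroup V] [Module (ZMod p) V] [FiniteDimensional (ZMod p) V] (ℓ : (Fin n → ℤ) →+ V)
    (hℓ : Function.Surjective ℓ)
    (hker : ∀ v, ℓ v = 0 ↔ ∃ w, v = Matrix.vecMul w (C : Matrix (Fin n) (Fin n) ℤ) - w)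
    (g g' : V →ₗ[ZMod p] V)
    (hg : ∀ v, ℓ (Matrix.vecMul v (F : Matrix (Fin n) (Fin n) ℤ)) = g (ℓ v))
    (hg' : ∀ v, ℓ (Matrix.vecMul v ((F⁻¹ : GL (Fin n) ℤ) : Matrix (Fin n) (Fin n) ℤ)) = g' (ℓ v)) :
    a * LinearMap.trace (ZMod p) V g = b * LinearMap.trace (ZMod p) V g' := by
  obtain ⟨x, rfl⟩ := hG
  let D : (L ≃ₐ[k] L) →* (GL (Fin n) ℤ)ᵐᵒᵖ := MonoidHom.mk'
    (fun s => MulOpposite.op (x⁻¹ * ((φ s).unop : GL (Fin n) ℤ) * x)) fun s t => by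
      rw [map_mul, ← MulOpposite.op_mul, MulOpposite.unop_mul, Subgroup.coe_mul]
      congr 1
      group
  have hD : ∀ s, (D s).unop = x⁻¹ * ((φ s).unop : GL (Fin n) ℤ) * x := fun _ => rfl
  have hDinj : Function.Injective D := fun s t h => by
    have h1 := congrArg MulOpposite.unop h
    rw [hD, hD] at h1
    exact φ.injective (MulOpposite.unop_injective (Subtype.ext
      (mul_left_cancel (mul_right_cancel h1))))
  have hDsurj : ∀ y ∈ H, ∃ s, (D s).unop = y := fun y hy =>
    ⟨φ.symm (MulOpposite.op ⟨MulAut.conj x y, y, hy, rfl⟩), by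
      rw [hD, MulEquiv.apply_symm_apply, MulOpposite.unop_op]
      simp only [MulAut.conj_apply]
      group⟩
  have hsplit := hA.isSplitWith_of_conj D x fun s => by rw [hD]; group
  obtain ⟨c, hc⟩ := hDsurj C hC
  obtain ⟨f, hf⟩ := hDsurj F hF
  have hac : ∀ v, rowAction D c v = Matrix.vecMul v (C : Matrix (Fin n) (Fin n) ℤ) := fun v => by
    rw [rowAction_apply, hc]
  have hext : ∀ s t, (D s).unop = (D t).unop → s = t := fun s t h =>
    hDinj (MulOpposite.unop_injective h)
  refine (hst.hasPermutationResolution hsplit).trace_eq (p := p) (c := c) (f := f) ?_ ?_ ?_ ?_ ℓ hℓ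
    ?_ g g' ?_ ?_
  · exact hext _ _ (by rw [map_pow, MulOpposite.unop_pow, hc, hCp, map_one]; rfl)
  · exact hext _ _ (by
      rw [map_mul, map_mul, map_pow, MulOpposite.unop_mul, MulOpposite.unop_mul,
        MulOpposite.unop_pow, hc, hf, ha])
  · exact hext _ _ (by
      rw [map_mul, map_mul, map_pow, MulOpposite.unop_mul, MulOpposite.unop_mul,
        MulOpposite.unop_pow, hc, hf, hb])
  · intro v hv
    exact hfix v (by rw [← hac]; exact hv)
  · intro v
    simp only [hac]
    exact hker v
  · intro v
    rw [rowAction_apply, hf]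
    exact hg v
  · intro v
    rw [rowAction_apply, map_inv, MulOpposite.unop_inv, hf]
    exact hg' v

theorem vecMul_c (v : Fin 4 → ℤ) : Matrix.vecMul v (I4.c : Matrix (Fin 4) (Fin 4) ℤ) =
    ![-v 3, v 0 - v 3, v 1 - v 3, v 2 - v 3] := by
  ext i
  fin_cases i <;> simp [I4.c, Matrix.vecMul, dotProduct, Fin.sum_univ_four] <;> ring

theorem vecMul_f (v : Fin 4 → ℤ) : Matrix.vecMul v (I4.f : Matrix (Fin 4) (Fin 4) ℤ) =
    ![v 2, v 0, v 3, v 1] := by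
  ext i
  fin_cases i <;> simp [I4.f, Matrix.vecMul, dotProduct, Fin.sum_univ_four]

theorem vecMul_f_inv (v : Fin 4 → ℤ) :
    Matrix.vecMul v ((I4.f⁻¹ : GL (Fin 4) ℤ) : Matrix (Fin 4) (Fin 4) ℤ) =
      ![v 1, v 3, v 0, v 2] := by
  ext i
  change Matrix.vecMul v I4.f.inv i = _
  fin_cases i <;> simp [I4.f, Matrix.vecMul, dotProduct, Fin.sum_univ_four]

theorem vecMul_cMat (v : Fin 4 → ℤ) :
    Matrix.vecMul v (Metacyclic.cMat : Matrix (Fin 4) (Fin 4) ℤ) =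
      ![-v 0 + v 1, -v 0, -v 0 - v 2 - v 3, v 0 - v 1 + v 2] := by
  ext i
  fin_cases i <;> simp [Metacyclic.cMat, Matrix.vecMul, dotProduct, Fin.sum_univ_four] <;> ring

/-- The sum of the coordinates modulo 5. -/
def coordSum : (Fin 4 → ℤ) →+ ZMod 5 where
  toFun v := ((v 0 + v 1 + v 2 + v 3 : ℤ) : ZMod 5)
  map_zero' := by simp
  map_add' v w := by push_cast [Pi.add_apply]; ring

theorem coordSum_apply (v : Fin 4 → ℤ) : coordSum v = ((v 0 + v 1 + v 2 + v 3 : ℤ) : ZMod 5) := rfl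

theorem f_mul_c : I4.f * I4.c = I4.c ^ 3 * I4.f := by
  apply Units.ext
  simp only [pow_succ, pow_zero, one_mul, Units.val_mul]
  decide

theorem c_mul_f : I4.c * I4.f = I4.f * I4.c ^ 2 := by
  apply Units.ext
  simp only [pow_succ, pow_zero, one_mul, Units.val_mul]
  decide

theorem c_pow : I4.c ^ 5 = 1 := by
  apply Units.ext
  simp only [pow_succ, pow_zero, one_mul, Units.val_mul]
  decide

theorem three_mul_ne_two_mul_mod_five : ((3 : ℕ) : ZMod 5) * 1 ≠ ((2 : ℕ) : ZMod 5) * 1 ∧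
    ((3 : ℕ) : ZMod 5) * -1 ≠ ((2 : ℕ) : ZMod 5) * -1 := by
  decide

/-- The sum of coordinates identifies `M / (c - 1) M` with `𝔽₅`, where `f` and its inverse act by
the same sign. The factors 3 and 2 differ modulo 5, so the trace relation fails. -/
theorem not_isStablyRational_of_letters {G H : Subgroup (GL (Fin 4) ℤ)} (hG : IsConjSubgroup G H)
    {φ : (L ≃ₐ[k] L) ≃* (G)ᵐᵒᵖ} {A : Type*} [CommRing A] [HopfAlgebra k A]
    (hA : HasCharacterModule k L A G φ) (hc : I4.c ∈ H) (hf : I4.f ∈ H ∨ -I4.f ∈ H) :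
    ¬ IsStablyRational k A := by
  intro hst
  have : Fact (Nat.Prime 5) := ⟨by norm_num⟩
  have hfix : ∀ v, Matrix.vecMul v (I4.c : Matrix (Fin 4) (Fin 4) ℤ) = v → v = 0 := by
    intro v hv
    rw [vecMul_c] at hv
    have h0 : -v 3 = v 0 := congrFun hv 0
    have h1 : v 0 - v 3 = v 1 := congrFun hv 1
    have h2 : v 1 - v 3 = v 2 := congrFun hv 2
    have h3 : v 2 - v 3 = v 3 := congrFun hv 3
    ext i
    fin_cases i <;> simp <;> omega
  have hsurj : Function.Surjective coordSum := fun z => by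
    obtain ⟨m, rfl⟩ := ZMod.intCast_surjective z
    exact ⟨![m, 0, 0, 0], by simp [coordSum_apply]⟩
  have hker : ∀ v, coordSum v = 0 ↔
      ∃ w, v = Matrix.vecMul w (I4.c : Matrix (Fin 4) (Fin 4) ℤ) - w := by
    intro v
    rw [coordSum_apply, ZMod.intCast_zmod_eq_zero_iff_dvd]
    constructor
    · rintro ⟨t, ht⟩
      push_cast at ht
      -- Adding the four equations `w c - w = v` gives `-5 w₃ = 5 t`; the other coordinates follow
      -- by forward substitution.
      refine ⟨![-v 0 + t, -v 0 - v 1 + 2 * t, -v 0 - v 1 - v 2 + 3 * t, -t], ?_⟩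
      rw [vecMul_c]
      ext i
      fin_cases i <;> simp <;> omega
    · rintro ⟨w, rfl⟩
      rw [vecMul_c]
      exact ⟨-w 3, by simp; ring⟩
  have htr : LinearMap.trace (ZMod 5) (ZMod 5) LinearMap.id = 1 := by
    rw [LinearMap.trace_id, Module.finrank_self, Nat.cast_one]
  rcases hf with hf | hf
  · have h := trace_eq_of_isStablyRational hG hA hst hc hf c_pow f_mul_c c_mul_f hfix coordSum
      hsurj hker LinearMap.id LinearMap.id
      (fun v => by rw [vecMul_f]; simp [coordSum_apply]; ring)
      (fun v => by rw [vecMul_f_inv]; simp [coordSum_apply]; ring)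
    rw [htr] at h
    exact three_mul_ne_two_mul_mod_five.1 h
  · have h := trace_eq_of_isStablyRational hG hA hst hc hf c_pow (a := 3) (b := 2)
      (by rw [neg_mul, f_mul_c, mul_neg]) (by rw [mul_neg, c_mul_f, neg_mul]) hfix coordSum
      hsurj hker (-LinearMap.id) (-LinearMap.id)
      (fun v => by
        rw [Units.val_neg, Matrix.vecMul_neg, vecMul_f, map_neg]
        simp [coordSum_apply]; ring)
      (fun v => by
        rw [← FiveLetters.neg_inv_eq, Units.val_neg, Matrix.vecMul_neg, vecMul_f_inv, map_neg]
        simp [coordSum_apply]; ring)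
    rw [map_neg, htr] at h
    exact three_mul_ne_two_mul_mod_five.2 h

/-- The coordinates dual to the vectors modulo 3 that are fixed by `cMat`. -/
def fixedPairing : (Fin 4 → ℤ) →+ (Fin 2 → ZMod 3) where
  toFun v := Matrix.vecMul (fun i => (v i : ZMod 3)) Metacyclic.fixedBasis
  map_zero' := by
    simp only [Pi.zero_apply, Int.cast_zero]
    exact Matrix.zero_vecMul _
  map_add' v w := by
    rw [← Matrix.add_vecMul]
    congr 1
    ext i
    exact Int.cast_add _ _

theorem fixedPairing_apply (v : Fin 4 → ℤ) :
    fixedPairing v = Matrix.vecMul (fun i => (v i : ZMod 3)) Metacyclic.fixedBasis := rfl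

theorem fixedPairing_vecMul (v : Fin 4 → ℤ) (M : Matrix (Fin 4) (Fin 4) ℤ) :
    fixedPairing (Matrix.vecMul v M) =
      Matrix.vecMul (fun i => (v i : ZMod 3)) (Metacyclic.red M * Metacyclic.fixedBasis) := by
  rw [fixedPairing_apply, ← Matrix.vecMul_vecMul]
  congr 1
  ext i
  simp [Matrix.vecMul, dotProduct]

/-- The inverse of `Metacyclic.fixedAction`. -/
def fixedActionInv : Matrix (Fin 2) (Fin 2) (ZMod 3) := !![0, 2; 2, 2]

theorem red_l4_mul_fixedBasis : Metacyclic.red (I4.l4 : Matrix (Fin 4) (Fin 4) ℤ) *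
    Metacyclic.fixedBasis = Metacyclic.fixedBasis * Metacyclic.fixedAction := by
  decide +kernel

theorem red_l4_inv_mul_fixedBasis : Metacyclic.red I4.l4.inv * Metacyclic.fixedBasis =
    Metacyclic.fixedBasis * fixedActionInv := by
  decide +kernel

theorem two_mul_trace_fixedAction_ne : ((2 : ℕ) : ZMod 3) * Metacyclic.fixedAction.transpose.trace ≠
    ((2 : ℕ) : ZMod 3) * fixedActionInv.transpose.trace := by
  decide +kernel

/-- Here `M / (c - 1) M` is `𝔽₃²` and both factors are 2, so `λ₄` and its inverse would need equal
traces there; these are 1 and 2. -/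
theorem not_isStablyRational_of_metacyclic {G H : Subgroup (GL (Fin 4) ℤ)}
    (hG : IsConjSubgroup G H) {φ : (L ≃ₐ[k] L) ≃* (G)ᵐᵒᵖ} {A : Type*} [CommRing A]
    [HopfAlgebra k A] (hA : HasCharacterModule k L A G φ) (hc : Metacyclic.cMat ∈ H)
    (hf : I4.l4 ∈ H) : ¬ IsStablyRational k A := by
  intro hst
  have : Fact (Nat.Prime 3) := ⟨Nat.prime_three⟩
  have hfix : ∀ v, Matrix.vecMul v (Metacyclic.cMat : Matrix (Fin 4) (Fin 4) ℤ) = v → v = 0 := by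
    intro v hv
    rw [vecMul_cMat] at hv
    have h0 : -v 0 + v 1 = v 0 := congrFun hv 0
    have h1 : -v 0 = v 1 := congrFun hv 1
    have h2 : -v 0 - v 2 - v 3 = v 2 := congrFun hv 2
    have h3 : v 0 - v 1 + v 2 = v 3 := congrFun hv 3
    ext i
    fin_cases i <;> simp <;> omega
  have hval : ∀ v, fixedPairing v = ![((v 1 + v 2 + 2 * v 3 : ℤ) : ZMod 3),
      ((v 0 + v 1 : ℤ) : ZMod 3)] := by
    intro v
    ext i
    fin_cases i <;> simp [fixedPairing_apply, Metacyclic.fixedBasis, Matrix.vecMul, dotProduct,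
      Fin.sum_univ_four] <;> ring
  have hsurj : Function.Surjective fixedPairing := fun z => by
    obtain ⟨m, hm⟩ := ZMod.intCast_surjective (z 0)
    obtain ⟨l, hl⟩ := ZMod.intCast_surjective (z 1)
    refine ⟨![l, 0, m, 0], ?_⟩
    rw [hval]
    ext i
    fin_cases i <;> simp [hm, hl]
  have hker : ∀ v, fixedPairing v = 0 ↔
      ∃ w, v = Matrix.vecMul w (Metacyclic.cMat : Matrix (Fin 4) (Fin 4) ℤ) - w := by
    intro v
    rw [hval]
    constructor
    · intro h
      have h0 : ((v 1 + v 2 + 2 * v 3 : ℤ) : ZMod 3) = 0 := congrFun h 0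
      have h1 : ((v 0 + v 1 : ℤ) : ZMod 3) = 0 := congrFun h 1
      rw [ZMod.intCast_zmod_eq_zero_iff_dvd] at h0 h1
      obtain ⟨s, hs⟩ := h0
      obtain ⟨t, ht⟩ := h1
      push_cast at hs ht
      -- In `w c - w = v` the two divisibilities read `-3 w₀ = 3 t` and `-3 (w₁ + w₃) = 3 s`. The
      -- first equation gives `w₁` and the last one gives `w₂`.
      refine ⟨![-t, v 0 - 2 * t, t - s + v 3, -v 0 + 2 * t - s], ?_⟩
      rw [vecMul_cMat]
      ext i
      fin_cases i <;> simp <;> omega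
    · rintro ⟨w, rfl⟩
      have h0 : ∀ z : ℤ, (3 : ℤ) ∣ z → (z : ZMod 3) = 0 := fun z h =>
        (ZMod.intCast_zmod_eq_zero_iff_dvd z 3).mpr h
      rw [vecMul_cMat]
      ext i
      fin_cases i
      · exact h0 _ ⟨-w 1 - w 3, by simp; ring⟩
      · exact h0 _ ⟨-w 0, by simp; ring⟩
  have h := trace_eq_of_isStablyRational hG hA hst hc hf Metacyclic.cMat_pow (a := 2) (b := 2)
    Metacyclic.l4_mul_cMat
    (by
      apply Units.ext
      simp only [pow_succ, pow_zero, one_mul, Units.val_mul]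
      decide) hfix fixedPairing hsurj hker
    (Matrix.toLin' Metacyclic.fixedAction.transpose) (Matrix.toLin' fixedActionInv.transpose)
    (fun v => by
      rw [fixedPairing_vecMul, red_l4_mul_fixedBasis, ← Matrix.vecMul_vecMul,
        Matrix.toLin'_apply, Matrix.mulVec_transpose]
      rfl)
    (fun v => by
      rw [fixedPairing_vecMul]
      change Matrix.vecMul _ (Metacyclic.red I4.l4.inv * _) = _
      rw [red_l4_inv_mul_fixedBasis, ← Matrix.vecMul_vecMul, Matrix.toLin'_apply,
        Matrix.mulVec_transpose]
      rfl)
  rw [Matrix.trace_toLin'_eq, Matrix.trace_toLin'_eq] at h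
  exact two_mul_trace_fixedAction_ne h

theorem letterHom_double_inv : FiveLetters.letterHom (FiveLetters.double⁻¹, 1) = I4.f := by
  have h := map_inv FiveLetters.letterHom (FiveLetters.double, 1)
  rw [FiveLetters.letterHom_double, inv_inv] at h
  exact h

theorem letterHom_double_inv_neg : FiveLetters.letterHom (FiveLetters.double⁻¹, -1) = -I4.f := by
  rw [FiveLetters.mk_neg_one, map_mul, FiveLetters.letterHom_neg_one, letterHom_double_inv,
    neg_one_mul]

/-- Each five-letter group contains `c` together with `f` or `-f`: for `S₅` this is the affine
subgroup, and the twisted form contains `-f` because `double` is odd. -/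
theorem not_isStablyRational_of_mem_all {H G : Subgroup (GL (Fin 4) ℤ)} (hH : H ∈ I4.all)
    (hG : IsConjSubgroup G H) {φ : (L ≃ₐ[k] L) ≃* (G)ᵐᵒᵖ} {A : Type*} [CommRing A] [HopfAlgebra k A]
    (hA : HasCharacterModule k L A G φ) : ¬ IsStablyRational k A := by
  have hsub : ∀ {x : GL (Fin 4) ℤ} {S : Set (GL (Fin 4) ℤ)}, x ∈ S → x ∈ Subgroup.closure S :=
    fun h => Subgroup.subset_closure h
  simp only [I4.all, List.mem_cons, List.not_mem_nil, or_false] at hH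
  rcases hH with rfl | rfl | rfl | rfl | rfl | rfl | rfl
  · exact not_isStablyRational_of_letters hG hA (hsub (by simp)) (Or.inl (hsub (by simp)))
  · exact not_isStablyRational_of_letters hG hA (hsub (by simp)) (Or.inr (hsub (by simp)))
  · exact not_isStablyRational_of_letters hG hA (hsub (by simp)) (Or.inl (hsub (by simp)))
  · refine not_isStablyRational_of_letters hG hA (hsub (by simp)) (Or.inl ?_)
    rw [FiveLetters.G4_eq_range]
    exact ⟨FiveLetters.double⁻¹, letterHom_double_inv⟩
  · refine not_isStablyRational_of_letters hG hA (hsub (by simp)) (Or.inr ?_)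
    rw [FiveLetters.G5_eq_range]
    refine ⟨FiveLetters.double⁻¹, ?_⟩
    change FiveLetters.letterHom
      (FiveLetters.double⁻¹, 1 * Equiv.Perm.sign FiveLetters.double⁻¹) = _
    rw [Equiv.Perm.sign_inv, FiveLetters.sign_double, one_mul, letterHom_double_inv_neg]
  · refine not_isStablyRational_of_letters hG hA (hsub (by simp)) (Or.inl ?_)
    rw [FiveLetters.G6_eq_range]
    exact ⟨(FiveLetters.double⁻¹, 1), letterHom_double_inv⟩
  · rw [Metacyclic.G7_eq_range] at hG
    exact not_isStablyRational_of_metacyclic hG hA ⟨_, Metacyclic.rep_c⟩ ⟨_, Metacyclic.rep_b⟩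

end NotStablyRational

theorem theorem1p31 (k : Type u₁) [Field k] (L : Type u₂) [Field L] [Algebra k L]
    [FiniteDimensional k L] [IsGalois k L] :
    -- no `T_i` and no `T_i^σ` is stably rational
    (∀ H ∈ I4.all, ∀ G : Subgroup (GL (Fin 4) ℤ), IsConjSubgroup G H →
      ∀ φ : (L ≃ₐ[k] L) ≃* (G)ᵐᵒᵖ,
        (∀ (A : Type u₃) [CommRing A] [HopfAlgebra k A],
          HasCharacterModule k L A G φ → ¬ IsStablyRational k A) ∧
        (∀ (σ : MulAut G) (Aσ : Type u₄) [CommRing Aσ] [HopfAlgebra k Aσ],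
          HasCharacterModule k L Aσ G (twist φ σ) → ¬ IsStablyRational k Aσ)) ∧
    -- (1) `T_1 × T_2` is stably rational
    (∀ G G' : Subgroup (GL (Fin 4) ℤ), IsConjSubgroup G I4.G1 → IsConjSubgroup G' I4.G2 →
      ∀ (φ : (L ≃ₐ[k] L) ≃* (G)ᵐᵒᵖ) (φ' : (L ≃ₐ[k] L) ≃* (G')ᵐᵒᵖ)
        (A : Type u₃) [CommRing A] [HopfAlgebra k A]
        (A' : Type u₄) [CommRing A'] [HopfAlgebra k A'],
        HasCharacterModule k L A G φ → HasCharacterModule k L A' G' φ' →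
          IsStablyRational k (A ⊗[k] A')) ∧
    -- (2) `Aut(G)/Inn(G)` has order 2, and `T_3 × T_3^σ` is stably rational for outer `σ`
    (∀ G : Subgroup (GL (Fin 4) ℤ), IsConjSubgroup G I4.G3 →
      (innerAut G).index = 2 ∧
      ∀ (φ : (L ≃ₐ[k] L) ≃* (G)ᵐᵒᵖ) (σ : MulAut G), σ ∉ innerAut G →
        ∀ (A : Type u₃) [CommRing A] [HopfAlgebra k A]
        (Aσ : Type u₄) [CommRing Aσ] [HopfAlgebra k Aσ],
        HasCharacterModule k L A G φ → HasCharacterModule k L Aσ G (twist φ σ) →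
          IsStablyRational k (A ⊗[k] Aσ)) ∧
    -- (3) `T_4 × T_5` is stably rational
    (∀ G G' : Subgroup (GL (Fin 4) ℤ), IsConjSubgroup G I4.G4 → IsConjSubgroup G' I4.G5 →
      ∀ (φ : (L ≃ₐ[k] L) ≃* (G)ᵐᵒᵖ) (φ' : (L ≃ₐ[k] L) ≃* (G')ᵐᵒᵖ)
        (A : Type u₃) [CommRing A] [HopfAlgebra k A]
        (A' : Type u₄) [CommRing A'] [HopfAlgebra k A'],
        HasCharacterModule k L A G φ → HasCharacterModule k L A' G' φ' →
          IsStablyRational k (A ⊗[k] A')) ∧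
    -- (4) `Aut(G)/Inn(G)` has order 2, and `T_6 × T_6^σ` is stably rational for outer `σ`
    (∀ G : Subgroup (GL (Fin 4) ℤ), IsConjSubgroup G I4.G6 →
      (innerAut G).index = 2 ∧
      ∀ (φ : (L ≃ₐ[k] L) ≃* (G)ᵐᵒᵖ) (σ : MulAut G), σ ∉ innerAut G →
        ∀ (A : Type u₃) [CommRing A] [HopfAlgebra k A]
        (Aσ : Type u₄) [CommRing Aσ] [HopfAlgebra k Aσ],
        HasCharacterModule k L A G φ → HasCharacterModule k L Aσ G (twist φ σ) →
          IsStablyRational k (A ⊗[k] Aσ)) ∧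
    -- (5) `X = Aut_{GL(4,ℤ)}(G) ≃ D_6` has index 2, and `T_7 × T_7^σ` is stably rational
    -- for `σ` outside `X`
    (∀ G : Subgroup (GL (Fin 4) ℤ), IsConjSubgroup G I4.G7 →
      Nonempty (autGL G ≃* DihedralGroup 6) ∧ (autGL G).index = 2 ∧
      ∀ (φ : (L ≃ₐ[k] L) ≃* (G)ᵐᵒᵖ) (σ : MulAut G), σ ∉ autGL G →
        ∀ (A : Type u₃) [CommRing A] [HopfAlgebra k A]
        (Aσ : Type u₄) [CommRing Aσ] [HopfAlgebra k Aσ],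
        HasCharacterModule k L A G φ → HasCharacterModule k L Aσ G (twist φ σ) →
          IsStablyRational k (A ⊗[k] Aσ)) := by
  refine ⟨?_, ?_, ?_, ?_, ?_, ?_⟩
  · intro H hH G hG φ
    -- The identification of the Galois group with `G` is arbitrary in this criterion, so the
    -- twisted torus needs no separate argument.
    exact ⟨fun A _ _ hA => not_isStablyRational_of_mem_all hH hG hA,
      fun σ A _ _ hA => not_isStablyRational_of_mem_all hH hG hA⟩
  · intro G G' hG hG' φ φ' A _ _ A' _ _ hA hA'
    rw [FiveLetters.G1_eq_range] at hG
    rw [FiveLetters.G2_eq_range] at hG'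
    exact FiveLetters.isStablyRational_tensor_of_range Subtype.val_injective
      FiveLetters.mem_innerAut_affine hG hG' hA hA'
  · intro G hG
    rw [FiveLetters.G3_eq_range] at hG
    exact ⟨hG.innerAut_index_of_range Subtype.val_injective FiveLetters.affine_sign_ne_one
        FiveLetters.mem_innerAut_affine FiveLetters.affine_character FiveLetters.affine_center,
      fun φ σ hσ A _ _ Aσ _ _ hA hA' => FiveLetters.isStablyRational_tensor_twist_of_range
        Subtype.val_injective FiveLetters.mem_innerAut_affine FiveLetters.affine_character
        FiveLetters.affine_center hG hσ hA hA'⟩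
  · intro G G' hG hG' φ φ' A _ _ A' _ _ hA hA'
    rw [FiveLetters.G4_eq_range] at hG
    rw [FiveLetters.G5_eq_range] at hG'
    exact FiveLetters.isStablyRational_tensor_of_range Function.injective_id
      FiveLetters.mem_innerAut_perm hG hG' hA hA'
  · intro G hG
    rw [FiveLetters.G6_eq_range] at hG
    exact ⟨hG.innerAut_index_of_range Function.injective_id FiveLetters.perm_sign_ne_one
        FiveLetters.mem_innerAut_perm FiveLetters.perm_character FiveLetters.perm_center,
      fun φ σ hσ A _ _ Aσ _ _ hA hA' => FiveLetters.isStablyRational_tensor_twist_of_range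
        Function.injective_id FiveLetters.mem_innerAut_perm FiveLetters.perm_character
        FiveLetters.perm_center hG hσ hA hA'⟩
  · intro G hG
    rw [Metacyclic.G7_eq_range] at hG
    exact ⟨Metacyclic.autGL_mulEquiv hG, Metacyclic.autGL_index hG,
      fun φ σ hσ A _ _ Aσ _ _ hA hA' => Metacyclic.isStablyRational_tensor_twist hG hσ hA hA'⟩
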